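/- Let $d\ge 1$, let $\mathcal P$ be the set of probability vectors on $\mathbb Z^d$, and let $\Omega=\mathcal P^{\mathbb Z^d}$ with its product $\sigma$-field; for $\omega\in\Omega$ write $\omega_x=(\omega_{x,z})_{z\in\mathbb Z^d}$, and let $(T_z\omega)_x=\omega_{x+z}$. For $z\in\mathbb Z^d$ let $P_z^\omega$ be the law of the Markov chain $(X_n)_{n\ge 0}$ on $\mathbb Z^d$ with $X_0=z$ and $P_z^\omega(X_{n+1}=y\mid X_n=x)=\omega_{x,y-x}$. For a probability measure $\mu$ on $\Omega$ let $P_0^{\mu}(d\omega,dx_{0,\infty})=\mu(d\omega)P^\omega_0(dx_{0,\infty})$ be the joint law of environment and walk, with expectation $E_0^\mu$. Let $\mathbb P$ be an i.i.d. product measure on $\Omega$ (the vectors $\omega_x$ are i.i.d. under $\mathbb P$), and write $P_0=P_0^{\mathbb P}$, $E_0=E_0^{\mathbb P}$. Fix $\hat u\in\mathbb Z^d$ and for real $\ell$ let $\mathfrak S_\ell=\sigma\{\omega_x: x\cdot\hat u\ge \ell\}$. Let $\tau_1\in\{1,2,\dots\}\cup\{\infty\}$ be the first $n\ge1$ such that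 $$\sup_{m<n}X_m\cdot\hat u<X_n\cdot\hat u=\inf_{m\ge n}X_m\cdot\hat u .$$ Assume: 1. (transience) $P_0(X_n\cdot\hat u\to\infty)=1$; 2. (bounded steps) there is a finite constant $\mathbb M>0$ such that $\mathbb P(\omega_{0,z}=0)=1$ whenever $|z|>\mathbb M$ (Euclidean norm); 3. (moments) $E_0(\tau_1^{\bar p})<\infty$ for some real $\bar p>4d+1$. Then there is a unique probability measure $\mathbb P_\infty$ on $\Omega$ with the properties (a)–(d): (a) $\mathbb P_\infty(\omega_{x,z}=0)=1$ for all $x,z\in\mathbb Z^d$ with $|z|>\mathbb M$; (b) $\mathbb P_\infty$ is invariant and ergodic for the transition kernel $\Pi(\omega,A)=P_0^\omega(T_{X_1}\omega\in A)$, where ergodic means that every measurable $A$ with $\Pi(\cdot,A)=\mathbf 1_A$ $\mathbb P_\infty$-a.s. has $\mathbb P_\infty(A)\in\{0,1\}$; (c) there is a constant $C$ such that $\sup_{A\in\mathfrak S_\ell}\{\mathbb P_\infty(A)-\mathbb P(A)\}\le C\ell^{1-\bar p}$ for all integers $\ell\ge 1$; (d) there is a constant $C$ such that $E_0^{\mathbb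 P_\infty}\big[|\inf_{n\ge0}X_n\cdot\hat u|^{r}\big]\le C$ for $1\le r\le\bar p-1$, and $P_0^{\mathbb P_\infty}(X_n\cdot\hat u\le n^{1/2})\le Cn^{-r}$ for $1\le r\le(\bar p-1)/2$ and $n\ge1$. Moreover, with $\mathbb E_\infty$ the expectation under this measure $\mathbb P_\infty$, for every $0<a<\infty$: - for every bounded $\mathfrak S_{-a}$-measurable function $\Psi:\Omega\to\mathbb R$, $$\lim_{n\to\infty}n^{-1}\sum_{j=0}^{n-1}\Psi(T_{X_j}\omega)=\mathbb E_\infty\Psi\qquad P_0\text{-almost surely};$$ - the restriction of $\mathbb P_\infty$ to $\mathfrak S_{-a}$ is absolutely continuous with respect to the restriction of $\mathbb P$ to $\mathfrak S_{-a}$. -/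

import Mathlib

open MeasureTheory ProbabilityTheory Filter Topology Finset
open scoped ENNReal

namespace RWRE

/-- Sites of the lattice `ℤ^d`. -/
abbrev Site (d : ℕ) : Type := Fin d → ℤ

/-- The Euclidean norm of a site. -/
noncomputable def euclNorm {d : ℕ} (z : Site d) : ℝ :=
  Real.sqrt (∑ i, ((z i : ℤ) : ℝ) ^ 2)

/-- The coordinatewise σ-algebra on the simplex of probability vectors on `ℤ^d`. -/
instance instMeasurableSpaceStep (d : ℕ) : MeasurableSpace (PMF (Site d)) :=
  MeasurableSpace.comap (fun (p : PMF (Site d)) (z : Site d) => p z) MeasurableSpace.pi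

/-- Environments: `ω x z` is the probability of jumping from `x` to `x + z`.
The σ-algebra is the product σ-algebra. -/
abbrev Env (d : ℕ) : Type := Site d → PMF (Site d)

/-- The natural shift: `(T_z ω)_x = ω_{x + z}`. -/
def shift {d : ℕ} (z : Site d) (ω : Env d) : Env d := fun x => ω (x + z)

/-- The σ-algebra generated by the environment at levels `≥ ℓ`, that is, by the
`ω_x` with `x · u ≥ ℓ`. -/
abbrev levelSigma {d : ℕ} (u : Site d) (ℓ : ℝ) : MeasurableSpace (Env d) :=
  ⨆ (x : Site d) (_ : ℓ ≤ ((x ⬝ᵥ u : ℤ) : ℝ)),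
    MeasurableSpace.comap (fun ω : Env d => ω x) inferInstance

theorem levelSigma_le {d : ℕ} (u : Site d) (ℓ : ℝ) :
    levelSigma u ℓ ≤ (inferInstance : MeasurableSpace (Env d)) :=
  iSup_le fun x => iSup_le fun _ => (measurable_pi_apply x).comap_le

/-- One step of the walk in the environment `ω`: from `x` move to `x + z` with
probability `ω x z`. -/
noncomputable def stepKernel {d : ℕ} (ω : Env d) : Kernel (Site d) (Site d) :=
  Kernel.ofFunOfCountable fun x => ((ω x).map fun z => x + z).toMeasure

instance {d : ℕ} (ω : Env d) : IsMarkovKernel (stepKernel ω) :=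
  ⟨fun x => PMF.toMeasure.isProbabilityMeasure ((ω x).map fun z => x + z)⟩

/-- The Markov chain of the environment `ω`: given the path up to time `n`, the next
position is drawn from the step kernel at the current position. -/
noncomputable def chainKernel {d : ℕ} (ω : Env d) (n : ℕ) :
    Kernel (Π _ : Iic n, Site d) (Site d) :=
  (stepKernel ω).comap (fun h => h ⟨n, mem_Iic.2 le_rfl⟩) (by fun_prop)

instance {d : ℕ} (ω : Env d) (n : ℕ) : IsMarkovKernel (chainKernel ω n) := by
  unfold chainKernel; infer_instance

/-- The quenched law `P_z^ω` on paths: the Markov chain in `ω` started at `z`. -/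
noncomputable def quenchedLaw {d : ℕ} (z : Site d) (ω : Env d) : Measure (ℕ → Site d) :=
  Kernel.traj (X := fun _ => Site d) (chainKernel ω) 0 (fun _ => z)

instance {d : ℕ} (z : Site d) (ω : Env d) : IsProbabilityMeasure (quenchedLaw z ω) := by
  unfold quenchedLaw; infer_instance

theorem measurable_jump {d : ℕ} (x z : Site d) : Measurable fun ω : Env d => ω x z := by
  have h : Measurable fun (p : PMF (Site d)) (z : Site d) => p z := comap_measurable _
  exact (measurable_pi_apply z).comp (h.comp (measurable_pi_apply x))

theorem measurable_stepKernel {d : ℕ} (x : Site d) (A : Set (Site d)) :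
    Measurable fun ω : Env d => stepKernel ω x A := by
  have h : ∀ ω : Env d, stepKernel ω x A
      = ∑' z, ((fun z => x + z) ⁻¹' A).indicator (fun z => ω x z) z := by
    intro ω
    change ((ω x).map fun z => x + z).toMeasure A = _
    rw [PMF.toMeasure_map_apply _ _ _ (measurable_of_countable _) (Set.to_countable A).measurableSet,
      PMF.toMeasure_apply]
    exact (Set.to_countable _).measurableSet
  simp_rw [h]
  refine Measurable.tsum fun z => ?_
  by_cases hz : z ∈ (fun z => x + z) ⁻¹' A
  · simpa [Set.indicator_of_mem hz] using measurable_jump x z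
  · simp [Set.indicator_of_notMem hz]

theorem measurable_partialTraj {d : ℕ} (z : Site d) (n : ℕ) :
    ∀ S : Set (Π _ : Iic n, Site d), Measurable fun ω : Env d =>
      Kernel.partialTraj (X := fun _ => Site d) (chainKernel ω) 0 n (fun _ => z) S := by
  induction n with
  | zero => intro S; simp only [Kernel.partialTraj_self]; exact measurable_const
  | succ n ih =>
    intro S
    have hS : MeasurableSet S := (Set.to_countable S).measurableSet
    have hm : Measurable (IicProdIoc (X := fun _ => Site d) n (n + 1)) := measurable_IicProdIoc
    have h : ∀ ω : Env d,
        Kernel.partialTraj (X := fun _ => Site d) (chainKernel ω) 0 (n + 1) (fun _ => z) S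
        = ∑' h : (Π _ : Iic n, Site d),
            stepKernel ω (h ⟨n, mem_Iic.2 le_rfl⟩)
              {y | IicProdIoc (X := fun _ => Site d) n (n + 1)
                (h, MeasurableEquiv.piSingleton (X := fun _ => Site d) n y) ∈ S} *
            Kernel.partialTraj (X := fun _ => Site d) (chainKernel ω) 0 n (fun _ => z) {h} := by
      intro ω
      rw [Kernel.partialTraj_succ_of_le (Nat.zero_le n), Kernel.map_apply' _ hm _ hS,
        Kernel.comp_apply' _ _ _ (hm hS), lintegral_countable']
      refine tsum_congr fun h => ?_
      congr 1
      have hp := (MeasurableEquiv.piSingleton (X := fun _ => Site d) n).measurable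
      rw [Kernel.id_prod_apply' _ _ (hm hS),
        Kernel.map_apply' _ hp _ (measurable_prodMk_left (hm hS))]
      rfl
    simp_rw [h]
    exact Measurable.tsum fun h => (measurable_stepKernel _ _).mul (ih _)

theorem measurable_quenchedLaw {d : ℕ} (z : Site d) :
    Measurable (quenchedLaw z : Env d → Measure (ℕ → Site d)) := by
  refine Measurable.measure_of_isPiSystem_of_isProbabilityMeasure
    (S := measurableCylinders fun _ : ℕ => Site d) generateFrom_measurableCylinders.symm
    isPiSystem_measurableCylinders fun t ht => ?_
  obtain ⟨N, S, mS, rfl⟩ : ∃ N S, MeasurableSet S ∧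
      t = cylinder (α := fun _ : ℕ => Site d) (Iic N) S := by
    simpa [measurableCylinders_nat] using ht
  have h : ∀ ω : Env d, quenchedLaw z ω (cylinder (α := fun _ : ℕ => Site d) (Iic N) S)
      = Kernel.partialTraj (X := fun _ => Site d) (chainKernel ω) 0 N (fun _ => z) S := by
    intro ω
    rw [← Kernel.traj_map_frestrictLe_apply,
      Measure.map_apply (Preorder.measurable_frestrictLe N) mS]
    rfl
  simp_rw [h]
  exact measurable_partialTraj z N S

/-- The quenched laws `ω ↦ P_z^ω` as a kernel from environments to paths. -/
noncomputable def quenched {d : ℕ} (z : Site d) : Kernel (Env d) (ℕ → Site d) where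
  toFun := quenchedLaw z
  measurable' := measurable_quenchedLaw z

instance {d : ℕ} (z : Site d) : IsMarkovKernel (quenched z) :=
  ⟨fun ω => inferInstanceAs (IsProbabilityMeasure (quenchedLaw z ω))⟩

/-- The joint law `μ(dω) P_z^ω(dx)` on environments and paths. -/
noncomputable def jointLaw {d : ℕ} (μ : Measure (Env d)) (z : Site d) :
    Measure (Env d × (ℕ → Site d)) :=
  μ ⊗ₘ quenched z

/-- The averaged law of the walk started at `z`: the path marginal of the joint law. -/
noncomputable def averagedLaw {d : ℕ} (μ : Measure (Env d)) (z : Site d) :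
    Measure (ℕ → Site d) :=
  (jointLaw μ z).snd

theorem measurable_shift_step {d : ℕ} :
    Measurable fun q : Env d × (ℕ → Site d) => shift (q.2 1) q.1 := by
  have h : Measurable fun q : Env d × Site d => shift q.2 q.1 := by
    refine measurable_from_prod_countable_left fun z => ?_
    exact measurable_pi_lambda _ fun x => measurable_pi_apply (x + z)
  exact h.comp (measurable_fst.prodMk ((measurable_pi_apply 1).comp measurable_snd))

/-- The transition kernel of the environment process,
`Π(ω, A) = P_0^ω {T_{X_1} ω ∈ A}`. -/
noncomputable def envKernel (d : ℕ) : Kernel (Env d) (Env d) :=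
  (Kernel.id ×ₖ quenched 0).map fun q => shift (q.2 1) q.1

theorem envKernel_apply {d : ℕ} (ω : Env d) {A : Set (Env d)} (hA : MeasurableSet A) :
    envKernel d ω A = quenchedLaw 0 ω {x | shift (x 1) ω ∈ A} := by
  rw [envKernel, Kernel.map_apply' _ measurable_shift_step _ hA,
    Kernel.id_prod_apply' _ _ (measurable_shift_step hA)]
  rfl

/-- `n ≥ 1` is a regeneration time of the path `x` in direction `u`:
`sup_{m < n} x_m · u < x_n · u = inf_{m ≥ n} x_m · u`. -/
def IsRegeneration {d : ℕ} (u : Site d) (x : ℕ → Site d) (n : ℕ) : Prop :=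
  1 ≤ n ∧ (∀ m < n, x m ⬝ᵥ u < x n ⬝ᵥ u) ∧ ∀ m ≥ n, x n ⬝ᵥ u ≤ x m ⬝ᵥ u

/-- The first regeneration time `τ₁` (`∞` if there is none). -/
noncomputable def regenTime {d : ℕ} (u : Site d) (x : ℕ → Site d) : ℝ≥0∞ :=
  ⨅ (n : ℕ) (_ : IsRegeneration u x n), (n : ℝ≥0∞)

/-- The variation distance `sup {μ(A) - ν(A)}` of the restrictions of two probability
measures to a sub-σ-algebra `m`. -/
noncomputable def varDistOn {Ω : Type*} [MeasurableSpace Ω] (μ ν : Measure Ω)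
    (m : MeasurableSpace Ω) : ℝ :=
  ⨆ A : {A : Set Ω // MeasurableSet[m] A}, (μ.real A.1 - ν.real A.1)

/-- A measure `Q` is ergodic for a Markov kernel `κ`: sets that are `κ`-invariant modulo
`Q` have measure zero or full measure. -/
def ErgodicFor {Ω : Type*} [MeasurableSpace Ω] (κ : Kernel Ω Ω) (Q : Measure Ω) : Prop :=
  ∀ A : Set Ω, MeasurableSet A →
    (∀ᵐ ω ∂Q, κ ω A = A.indicator (fun _ => (1 : ℝ≥0∞)) ω) → Q A = 0 ∨ Q Aᶜ = 0

/-- The properties that single out the invariant environment measure `ℙ_∞` (here `Q`)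
associated with the environment law `ℙ` (here `P`). -/
structure IsInvariantEnvLaw {d : ℕ} (u : Site d) (M p : ℝ) (P Q : Measure (Env d)) :
    Prop where
  isProbabilityMeasure : IsProbabilityMeasure Q
  /-- Steps are bounded by `M`, almost surely at every site. -/
  bounded_steps : ∀ x z : Site d, M < euclNorm z → ∀ᵐ ω ∂Q, ω x z = 0
  invariant : Kernel.Invariant (envKernel d) Q
  ergodic : ErgodicFor (envKernel d) Q
  /-- Closeness to `P` far in the direction `u`. -/
  varDist_le : ∃ C : ℝ, ∀ ℓ : ℕ, 1 ≤ ℓ →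
    varDistOn Q P (levelSigma u ℓ) ≤ C * (ℓ : ℝ) ^ (1 - p)
  /-- Moments of the backtracking `|inf_n X_n · u|`. -/
  backtrack_le : ∃ C : ℝ, ∀ r : ℝ, 1 ≤ r → r ≤ p - 1 →
    ∫⁻ x, (⨅ n : ℕ, (((x n ⬝ᵥ u : ℤ) : ℝ) : EReal)).abs ^ r ∂(averagedLaw Q 0)
      ≤ ENNReal.ofReal C
  /-- Slow progress is unlikely. -/
  slow_le : ∃ C : ℝ, ∀ r : ℝ, 1 ≤ r → r ≤ (p - 1) / 2 → ∀ n : ℕ, 1 ≤ n →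
    (averagedLaw Q 0).real {x | ((x n ⬝ᵥ u : ℤ) : ℝ) ≤ Real.sqrt n} ≤ C * (n : ℝ) ^ (-r)

end RWRE

/-! Regeneration times cut the walk into blocks. Before such a time the walk has used only sites
strictly below the current level, and from then on it never goes below that level. In an i.i.d.
environment the future, together with the environment it uses, is therefore independent of the past
and distributed as the walk from the origin conditioned never to go below level `0`
(`jointLaw_renewal`, `jointLaw_nxt`). Consequently the map `regenMap`, which recentres at the next
regeneration point and forgets the environment below it, preserves the conditioned law
(`measurePreserving_regenMap`). It is ergodic, because an invariant event can be read off after any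
late regeneration and so is independent of every cylinder event, hence of itself
(`ergodic_regenMap`).

The moment hypothesis makes the mean block length finite. Consider a bounded observable of the
environment seen from the walker that looks at most `k` levels down. During the `k`-th block of a
path staying above `0` the walk is at level at least `k`, so the sum of the observable over that
block depends only on the environment above `0`. Birkhoff's theorem for `regenMap` applies to this
sum and to the block length, and the quotient gives an almost sure time average, the integral
against `blockLaw ν u k` (`tendsto_average_blockLaw`). Since almost sure limits are unique, the
block laws for different `k` agree on common half-spaces, and an extension argument glues them into
one law `Q` (`exists_limitLaw`).

The remaining properties of `Q` come from `IsLimitLaw`, the statement that `Q` gives the limits of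
local averages, and from block estimates. Null local events of the i.i.d. law are never seen by the
walker, which gives absolute continuity. The Markov property passes to Cesàro limits, which gives
invariance. A time at which the environment far ahead is not fresh lies in a long block, which gives
the variation bound. Under `Q` the path is seen from a uniform time of a size-biased block
(`IsLimitLaw.averagedLaw_eq`), which reduces backtracking and slow progress to moments of the block
length.

For uniqueness, let `Q'` be a transient law close to the i.i.d. law far in the direction `u`. The
walk reaches a distant level from which it never returns, and an exceptional environment there has
small `Q'`-probability; so the averages under `Q'` converge to the same limits
(`isLimitLaw_of_close`). If `Q'` is also invariant, its own mean is constant in time, and `Q' = Q`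
(`eq_of_invariant`). Ergodicity is the same argument applied to `Q` conditioned on an invariant set
(`ergodicFor_of_isLimitLaw`). -/

namespace RWRE

variable {d : ℕ}

/-! ### Prefix events and the quenched Markov chain -/

/-- Paths that agree with `x` up to time `n`. -/
def cyl (x : ℕ → Site d) (n : ℕ) : Set (ℕ → Site d) := {X | ∀ i ≤ n, X i = x i}

/-- The probability of following `x` for `n` steps in the environment `ω`. -/
noncomputable def wt (ω : Env d) (x : ℕ → Site d) (n : ℕ) : ℝ≥0∞ :=
  ∏ i ∈ range n, ω (x i) (x (i + 1) - x i)

/-- Membership in `A` is decided by the path up to time `n`. -/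
def PrefixDet (n : ℕ) (A : Set (ℕ → Site d)) : Prop :=
  ∀ X X' : ℕ → Site d, (∀ i ≤ n, X i = X' i) → X ∈ A → X' ∈ A

/-- The constant extension of a finite path. -/
def ext (n : ℕ) (p : Π _ : Iic n, Site d) : ℕ → Site d :=
  fun i => p ⟨min i n, mem_Iic.2 (min_le_right _ _)⟩

theorem cyl_ext (n : ℕ) (p : Π _ : Iic n, Site d) :
    cyl (ext n p) n = Preorder.frestrictLe (π := fun _ : ℕ => Site d) n ⁻¹' {p} := by
  ext X
  simp only [cyl, Set.mem_ofPred_eq, Set.mem_preimage, Set.mem_singleton_iff]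
  constructor
  · intro h
    ext1 ⟨i, hi⟩
    have := h i (mem_Iic.1 hi)
    simpa [ext, min_eq_left (mem_Iic.1 hi)] using this
  · rintro rfl i hi
    simp [ext, min_eq_left hi]

theorem cyl_eq_preimage (x : ℕ → Site d) (n : ℕ) :
    cyl x n = Preorder.frestrictLe (π := fun _ : ℕ => Site d) n ⁻¹'
      {Preorder.frestrictLe (π := fun _ : ℕ => Site d) n x} := by
  ext X
  simp only [cyl, Set.mem_ofPred_eq, Set.mem_preimage, Set.mem_singleton_iff]
  constructor
  · intro h
    ext1 ⟨i, hi⟩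
    exact h i (mem_Iic.1 hi)
  · intro h i hi
    exact congrFun h ⟨i, mem_Iic.2 hi⟩

theorem PrefixDet.eq_preimage {n : ℕ} {A : Set (ℕ → Site d)} (hA : PrefixDet n A) :
    A = Preorder.frestrictLe (π := fun _ : ℕ => Site d) n ⁻¹' {p | ext n p ∈ A} := by
  ext X
  simp only [Set.mem_preimage, Set.mem_ofPred_eq]
  have h : ∀ i ≤ n, X i = ext n (Preorder.frestrictLe (π := fun _ : ℕ => Site d) n X) i := by
    intro i hi
    simp [ext, min_eq_left hi]
  exact ⟨hA _ _ h, hA _ _ fun i hi => (h i hi).symm⟩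

theorem PrefixDet.measurableSet {n : ℕ} {A : Set (ℕ → Site d)} (hA : PrefixDet n A) :
    MeasurableSet A := by
  rw [hA.eq_preimage]
  exact Preorder.measurable_frestrictLe n (Set.to_countable _).measurableSet

theorem prefixDet_cyl (x : ℕ → Site d) (n : ℕ) : PrefixDet n (cyl x n) :=
  fun _ _ h hX i hi => (h i hi).symm.trans (hX i hi)

theorem PrefixDet.mono {n m : ℕ} {A : Set (ℕ → Site d)} (hA : PrefixDet n A) (h : n ≤ m) :
    PrefixDet m A := fun X X' hX => hA X X' fun i hi => hX i (hi.trans h)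

theorem PrefixDet.inter {n : ℕ} {A B : Set (ℕ → Site d)} (hA : PrefixDet n A)
    (hB : PrefixDet n B) : PrefixDet n (A ∩ B) :=
  fun X X' h hX => ⟨hA X X' h hX.1, hB X X' h hX.2⟩

theorem measurableSet_cyl (x : ℕ → Site d) (n : ℕ) : MeasurableSet (cyl x n) :=
  (prefixDet_cyl x n).measurableSet

theorem iUnion_cyl_ext (n : ℕ) : ⋃ p : (Π _ : Iic n, Site d), cyl (ext n p) n = Set.univ := by
  simp_rw [cyl_ext]
  rw [← Set.preimage_iUnion, Set.iUnion_of_singleton, Set.preimage_univ]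

theorem pairwise_disjoint_cyl_ext (n : ℕ) :
    Pairwise (Function.onFun Disjoint fun p : (Π _ : Iic n, Site d) => cyl (ext n p) n) := by
  intro p q hpq
  simp only [Function.onFun, cyl_ext]
  exact Disjoint.preimage _ (by simpa using hpq)

theorem lintegral_prefix (m : Measure (ℕ → Site d)) (n : ℕ) (f : (ℕ → Site d) → ℝ≥0∞) :
    ∫⁻ X, f X ∂m = ∑' p : (Π _ : Iic n, Site d), ∫⁻ X in cyl (ext n p) n, f X ∂m := by
  rw [← lintegral_iUnion (fun p => measurableSet_cyl _ _) (pairwise_disjoint_cyl_ext n),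
    iUnion_cyl_ext, Measure.restrict_univ]

theorem measure_prefix (m : Measure (ℕ → Site d)) (n : ℕ) {A : Set (ℕ → Site d)}
    (hA : MeasurableSet A) :
    m A = ∑' p : (Π _ : Iic n, Site d), m (cyl (ext n p) n ∩ A) := by
  rw [← measure_iUnion, ← Set.iUnion_inter, iUnion_cyl_ext, Set.univ_inter]
  · exact fun p q hpq => (pairwise_disjoint_cyl_ext n hpq).mono Set.inter_subset_left
      Set.inter_subset_left
  · exact fun p => (measurableSet_cyl _ _).inter hA

/-- Finite measures on paths are determined by their values on prefix sets. -/
theorem path_measure_ext {μ ν : Measure (ℕ → Site d)} [IsFiniteMeasure μ]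
    (h : ∀ x n, μ (cyl x n) = ν (cyl x n)) : μ = ν := by
  have key : ∀ n (A : Set (ℕ → Site d)), PrefixDet n A → μ A = ν A := by
    intro n A hA
    rw [measure_prefix μ n hA.measurableSet, measure_prefix ν n hA.measurableSet]
    refine tsum_congr fun p => ?_
    by_cases hp : ext n p ∈ A
    · have : cyl (ext n p) n ∩ A = cyl (ext n p) n :=
        Set.inter_eq_left.2 fun X hX => hA _ _ (fun i hi => (hX i hi).symm) hp
      rw [this, h]
    · have : cyl (ext n p) n ∩ A = ∅ := by
        ext X
        simp only [Set.mem_inter_iff, Set.mem_empty_iff_false, iff_false, not_and]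
        exact fun hX hXA => hp (hA _ _ hX hXA)
      simp [this]
  refine ext_of_generate_finite (measurableCylinders fun _ : ℕ => Site d)
    generateFrom_measurableCylinders.symm isPiSystem_measurableCylinders ?_ ?_
  · intro t ht
    obtain ⟨N, S, mS, rfl⟩ : ∃ N S, MeasurableSet S ∧
        t = cylinder (α := fun _ : ℕ => Site d) (Iic N) S := by
      simpa [measurableCylinders_nat] using ht
    refine key N _ fun X X' hX hXS => ?_
    have : (Iic N).restrict X' = (Iic N).restrict X := by
      ext1 ⟨i, hi⟩
      exact (hX i (mem_Iic.1 hi)).symm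
    simpa [mem_cylinder, this] using hXS
  · exact key 0 _ fun _ _ _ _ => trivial

theorem stepKernel_singleton (ω : Env d) (x y : Site d) :
    stepKernel ω x {y} = ω x (y - x) := by
  change ((ω x).map fun z => x + z).toMeasure {y} = _
  rw [PMF.toMeasure_apply_singleton _ _ (measurableSet_singleton y), PMF.map_apply,
    tsum_eq_single (y - x)]
  · simp
  · intro z hz
    have : y ≠ x + z := by rintro rfl; simp at hz
    simp [this]

/-- Unfolding the trajectory kernel one step at a time multiplies the transition probabilities.
Together with `path_measure_ext` this explicit formula replaces the kernel construction in later
arguments. -/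
theorem quenchedLaw_cyl (z : Site d) (ω : Env d) (x : ℕ → Site d) (n : ℕ) :
    quenchedLaw z ω (cyl x n) = if x 0 = z then wt ω x n else 0 := by
  have h0 : quenchedLaw z ω (cyl x n) = Kernel.partialTraj (X := fun _ => Site d)
      (chainKernel ω) 0 n (fun _ => z)
      {Preorder.frestrictLe (π := fun _ : ℕ => Site d) n x} := by
    rw [← Kernel.traj_map_frestrictLe_apply,
      Measure.map_apply (Preorder.measurable_frestrictLe n) (measurableSet_singleton _),
      ← cyl_eq_preimage]
    rfl
  rw [h0]
  clear h0
  induction n with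
  | zero =>
    rw [Kernel.partialTraj_self, Kernel.id_apply, Measure.dirac_apply' _ (measurableSet_singleton _)]
    by_cases h : x 0 = z
    · have : (fun _ : Iic 0 => z) = Preorder.frestrictLe (π := fun _ : ℕ => Site d) 0 x := by
        ext1 ⟨i, hi⟩
        obtain rfl : i = 0 := by simpa using hi
        exact h.symm
      simp [h, wt, Set.indicator, this]
    · have : (fun _ : Iic 0 => z) ≠ Preorder.frestrictLe (π := fun _ : ℕ => Site d) 0 x := by
        intro h'
        exact h (congrFun h' ⟨0, by simp⟩).symm
      simp [h, Set.indicator, this]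
  | succ n ih =>
    set S : Set (Π _ : Iic (n + 1), Site d) :=
      {Preorder.frestrictLe (π := fun _ : ℕ => Site d) (n + 1) x} with hSdef
    have hS : MeasurableSet S := measurableSet_singleton _
    have hm : Measurable (IicProdIoc (X := fun _ => Site d) n (n + 1)) := measurable_IicProdIoc
    have h : Kernel.partialTraj (X := fun _ => Site d) (chainKernel ω) 0 (n + 1) (fun _ => z) S
        = ∑' h : (Π _ : Iic n, Site d),
            stepKernel ω (h ⟨n, mem_Iic.2 le_rfl⟩)
              {y | IicProdIoc (X := fun _ => Site d) n (n + 1)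
                (h, MeasurableEquiv.piSingleton (X := fun _ => Site d) n y) ∈ S} *
            Kernel.partialTraj (X := fun _ => Site d) (chainKernel ω) 0 n (fun _ => z) {h} := by
      rw [Kernel.partialTraj_succ_of_le (Nat.zero_le n), Kernel.map_apply' _ hm _ hS,
        Kernel.comp_apply' _ _ _ (hm hS), lintegral_countable']
      refine tsum_congr fun h => ?_
      congr 1
      have hp := (MeasurableEquiv.piSingleton (X := fun _ => Site d) n).measurable
      rw [Kernel.id_prod_apply' _ _ (hm hS),
        Kernel.map_apply' _ hp _ (measurable_prodMk_left (hm hS))]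
      rfl
    have key : ∀ (h : Π _ : Iic n, Site d) (y : Site d), IicProdIoc (X := fun _ => Site d) n (n + 1)
        (h, MeasurableEquiv.piSingleton (X := fun _ => Site d) n y) ∈ S ↔
        h = Preorder.frestrictLe (π := fun _ : ℕ => Site d) n x ∧ y = x (n + 1) := by
      intro h y
      rw [hSdef, Set.mem_singleton_iff]
      constructor
      · intro e
        constructor
        · ext1 ⟨i, hi⟩
          have hi' := mem_Iic.1 hi
          have := congrFun e ⟨i, mem_Iic.2 (by omega)⟩
          simpa [IicProdIoc, hi'] using this
        · have := congrFun e ⟨n + 1, mem_Iic.2 le_rfl⟩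
          simpa [IicProdIoc, MeasurableEquiv.piSingleton] using this
      · rintro ⟨rfl, rfl⟩
        ext1 ⟨i, hi⟩
        have hi' := mem_Iic.1 hi
        by_cases hin : i ≤ n
        · simp [IicProdIoc, hin]
        · obtain rfl : i = n + 1 := by omega
          simp [IicProdIoc, MeasurableEquiv.piSingleton]
    rw [h, tsum_eq_single (Preorder.frestrictLe (π := fun _ : ℕ => Site d) n x)]
    · rw [ih]
      have : {y | IicProdIoc (X := fun _ => Site d) n (n + 1)
          (Preorder.frestrictLe (π := fun _ : ℕ => Site d) n x,
            MeasurableEquiv.piSingleton (X := fun _ => Site d) n y) ∈ S} = {x (n + 1)} := by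
        ext y
        simp only [Set.mem_ofPred_eq, key, true_and, Set.mem_singleton_iff]
      rw [this, stepKernel_singleton]
      split_ifs
      · rw [mul_comm, wt, wt, prod_range_succ]; rfl
      · simp
    · intro h hne
      have : {y | IicProdIoc (X := fun _ => Site d) n (n + 1)
          (h, MeasurableEquiv.piSingleton (X := fun _ => Site d) n y) ∈ S} = ∅ := by
        ext y
        simp only [Set.mem_ofPred_eq, key, hne, false_and, Set.mem_empty_iff_false]
      simp [this]

theorem measurable_wt (x : ℕ → Site d) (n : ℕ) : Measurable fun ω : Env d => wt ω x n :=
  Finset.measurable_prod _ fun _ _ => measurable_jump _ _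

theorem quenchedLaw_start (z : Site d) (ω : Env d) : ∀ᵐ X ∂(quenchedLaw z ω), X 0 = z := by
  have h : quenchedLaw z ω (cyl (fun _ => z) 0) = 1 := by
    rw [quenchedLaw_cyl]; simp [wt]
  have h2 := (prob_compl_eq_zero_iff (measurableSet_cyl _ _)).2 h
  refine measure_mono_null (fun X hX => ?_) h2
  simp only [Set.mem_compl_iff, Set.mem_ofPred_eq, cyl] at hX ⊢
  exact fun h => hX (h 0 le_rfl)

theorem wt_congr {ω ω' : Env d} {x : ℕ → Site d} {n : ℕ} (h : ∀ i < n, ω (x i) = ω' (x i)) :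
    wt ω x n = wt ω' x n :=
  prod_congr rfl fun i hi => by rw [h i (mem_range.1 hi)]

/-- The Markov property at a fixed time. -/
theorem quenchedLaw_cyl_inter (z : Site d) (ω : Env d) (x : ℕ → Site d) (n : ℕ)
    {H : Set (ℕ → Site d)} (hH : MeasurableSet H) :
    quenchedLaw z ω (cyl x n ∩ {X | (fun m => X (n + m)) ∈ H})
      = quenchedLaw z ω (cyl x n) * quenchedLaw (x n) ω H := by
  have hm : Measurable fun (X : ℕ → Site d) (m : ℕ) => X (n + m) := by fun_prop
  -- Proving an identity of measures reduces an arbitrary future event to cylinders, where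
  -- concatenating two prefixes multiplies their weights.
  have key : ((quenchedLaw z ω).restrict (cyl x n)).map (fun X m => X (n + m))
      = quenchedLaw z ω (cyl x n) • quenchedLaw (x n) ω := by
    refine path_measure_ext fun y m => ?_
    rw [Measure.map_apply hm (measurableSet_cyl _ _),
      Measure.restrict_apply (hm (measurableSet_cyl _ _)), Measure.smul_apply, smul_eq_mul]
    simp only [quenchedLaw_cyl (x n) ω y m]
    split_ifs with hy
    · have e : (fun X : ℕ → Site d => fun m => X (n + m)) ⁻¹' (cyl y m) ∩ cyl x n
          = cyl (fun i => if i ≤ n then x i else y (i - n)) (n + m) := by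
        ext X
        simp only [cyl, Set.mem_inter_iff, Set.mem_preimage, Set.mem_ofPred_eq]
        constructor
        · rintro ⟨h1, h2⟩ i hi
          split_ifs with hin
          · exact h2 i hin
          · have := h1 (i - n) (by omega)
            rwa [Nat.add_sub_cancel' (by omega)] at this
        · intro h
          constructor
          · intro i hi
            have := h (n + i) (by omega)
            rcases Nat.eq_zero_or_pos i with rfl | hi0
            · simpa [hy] using this
            · simpa [Nat.not_le.2 (Nat.lt_add_of_pos_right hi0)] using this
          · intro i hi
            have := h i (by omega)
            simpa [hi] using this
      rw [e, quenchedLaw_cyl, quenchedLaw_cyl]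
      simp only [Nat.zero_le, if_true]
      split_ifs
      · rw [wt, prod_range_add]
        congr 1
        · refine prod_congr rfl fun i hi => ?_
          have := mem_range.1 hi
          simp [this.le, Nat.succ_le_of_lt this]
        · refine prod_congr rfl fun i hi => ?_
          have h1 : (if n + i ≤ n then x (n + i) else y (n + i - n)) = y i := by
            rcases Nat.eq_zero_or_pos i with rfl | hi0
            · simp [hy]
            · simp [Nat.not_le.2 (Nat.lt_add_of_pos_right hi0)]
          have h2 : (if n + i + 1 ≤ n then x (n + i + 1) else y (n + i + 1 - n)) = y (i + 1) := by
            rw [if_neg (by omega)]; congr 1; omega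
          rw [h1, h2]
      · simp
    · have e : (fun X : ℕ → Site d => fun m => X (n + m)) ⁻¹' (cyl y m) ∩ cyl x n = ∅ := by
        ext X
        simp only [cyl, Set.mem_inter_iff, Set.mem_preimage, Set.mem_ofPred_eq,
          Set.mem_empty_iff_false, iff_false, not_and]
        intro h1 h2
        exact hy ((h1 0 (Nat.zero_le _)).symm.trans (h2 n le_rfl))
      simp [e]
  have := congrArg (fun m => m H) key
  simp only [Measure.smul_apply, smul_eq_mul] at this
  rw [← this, Measure.map_apply hm hH, Measure.restrict_apply (hm hH), Set.inter_comm]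
  rfl

/-- Translating the walk is the same as translating the environment, since weights of cylinders
involve only increments and the environment along the path. -/
theorem quenchedLaw_map_sub (z : Site d) (ω : Env d) :
    (quenchedLaw z ω).map (fun X m => X m - z) = quenchedLaw 0 (shift z ω) := by
  have hm : Measurable fun (X : ℕ → Site d) (m : ℕ) => X m - z :=
    measurable_pi_lambda _ fun m => (measurable_pi_apply m).sub measurable_const
  have : IsProbabilityMeasure ((quenchedLaw z ω).map (fun X m => X m - z)) :=
    Measure.isProbabilityMeasure_map hm.aemeasurable
  refine path_measure_ext fun x n => ?_
  rw [Measure.map_apply hm (measurableSet_cyl _ _)]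
  have e : (fun (X : ℕ → Site d) (m : ℕ) => X m - z) ⁻¹' (cyl x n) = cyl (fun m => x m + z) n := by
    ext X
    simp [cyl, sub_eq_iff_eq_add]
  rw [e, quenchedLaw_cyl, quenchedLaw_cyl]
  simp only [add_eq_right]
  split_ifs
  · simp [wt, shift]
  · rfl

theorem quenchedLaw_cyl_inter_sub (z : Site d) (ω : Env d) (x : ℕ → Site d) (n : ℕ)
    {H : Set (ℕ → Site d)} (hH : MeasurableSet H) :
    quenchedLaw z ω (cyl x n ∩ {X | (fun m => X (n + m) - X n) ∈ H})
      = quenchedLaw z ω (cyl x n) * quenchedLaw 0 (shift (x n) ω) H := by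
  have hm : Measurable fun (X : ℕ → Site d) (m : ℕ) => X m - x n :=
    measurable_pi_lambda _ fun m => (measurable_pi_apply m).sub measurable_const
  rw [← quenchedLaw_map_sub, Measure.map_apply hm hH, ← quenchedLaw_cyl_inter z ω x n (hm hH)]
  congr 1
  ext X
  simp only [Set.mem_inter_iff, Set.mem_ofPred_eq, Set.mem_preimage, and_congr_right_iff]
  intro hX
  rw [hX n le_rfl]

/-- The weight of a prefix of length `n` uses the environment only at times strictly before `n`, so
the endpoint may lie outside `V`. -/
theorem quenchedLaw_congr_of_prefixDet {V : Set (Site d)} {ω ω' : Env d}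
    (hV : ∀ x ∈ V, ω x = ω' x) (z : Site d) {n : ℕ} {H : Set (ℕ → Site d)} (hH : PrefixDet n H)
    (hHV : ∀ X ∈ H, ∀ i < n, X i ∈ V) : quenchedLaw z ω H = quenchedLaw z ω' H := by
  rw [measure_prefix _ n hH.measurableSet, measure_prefix (quenchedLaw z ω') n hH.measurableSet]
  refine tsum_congr fun p => ?_
  by_cases hp : ext n p ∈ H
  · have : cyl (ext n p) n ∩ H = cyl (ext n p) n :=
      Set.inter_eq_left.2 fun X hX => hH _ _ (fun i hi => (hX i hi).symm) hp
    rw [this, quenchedLaw_cyl, quenchedLaw_cyl,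
      wt_congr fun i hi => hV _ (hHV _ hp i hi)]
  · have : cyl (ext n p) n ∩ H = ∅ := by
      ext X
      simp only [Set.mem_inter_iff, Set.mem_empty_iff_false, iff_false, not_and]
      exact fun hX hXA => hp (hH _ _ hX hXA)
    simp [this]

/-- The law of the walk on paths that stay in `V` depends only on the environment in `V`. -/
theorem quenchedLaw_congr_of_stay {V : Set (Site d)} {ω ω' : Env d}
    (hV : ∀ x ∈ V, ω x = ω' x) (z : Site d) {H : Set (ℕ → Site d)} (hH : MeasurableSet H)
    (hHV : ∀ X ∈ H, ∀ i, X i ∈ V) : quenchedLaw z ω H = quenchedLaw z ω' H := by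
  -- Staying in `V` forever is not a prefix event; it is the decreasing limit of staying up to time
  -- `n`, and continuity from above transfers the finite-time identity.
  set W : ℕ → Set (ℕ → Site d) := fun n => {X | ∀ i ≤ n, X i ∈ V} with hW
  have hWdet : ∀ n, PrefixDet n (W n) := fun n X X' h hX i hi => by
    rw [← h i hi]; exact hX i hi
  have hWanti : Antitone W := fun m n hmn X hX i hi => hX i (hi.trans hmn)
  set Wi : Set (ℕ → Site d) := ⋂ n, W n
  have hWi : MeasurableSet Wi := .iInter fun n => (hWdet n).measurableSet
  have key : (quenchedLaw z ω).restrict Wi = (quenchedLaw z ω').restrict Wi := by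
    refine path_measure_ext fun x n => ?_
    rw [Measure.restrict_apply (measurableSet_cyl _ _), Measure.restrict_apply (measurableSet_cyl _ _)]
    have lim : ∀ ω : Env d, Tendsto (fun m => quenchedLaw z ω (cyl x n ∩ W m)) atTop
        (𝓝 (quenchedLaw z ω (cyl x n ∩ Wi))) := by
      intro ω
      rw [Set.inter_iInter]
      refine tendsto_measure_iInter_atTop
        (fun m => ((measurableSet_cyl _ _).inter (hWdet m).measurableSet).nullMeasurableSet)
        (fun a b hab => Set.inter_subset_inter_right _ (hWanti hab)) ⟨0, measure_ne_top _ _⟩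
    refine tendsto_nhds_unique_of_eventuallyEq (lim ω) (lim ω') ?_
    filter_upwards [eventually_ge_atTop n] with m hm
    exact quenchedLaw_congr_of_prefixDet hV z (((prefixDet_cyl x n).mono hm).inter (hWdet m))
      fun X hX i hi => hX.2 i hi.le
  have hsub : H ⊆ Wi := fun X hX => Set.mem_iInter.2 fun n i _ => hHV X hX i
  have := congrArg (fun m => m H) key
  simpa [Measure.restrict_apply hH, Set.inter_eq_left.2 hsub] using this

/-! ### The environment seen from the walker -/

/-- The environment and the path seen from the walker at time `n`. -/
def theta (n : ℕ) (q : Env d × (ℕ → Site d)) : Env d × (ℕ → Site d) :=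
  (shift (q.2 n) q.1, fun m => q.2 (n + m) - q.2 n)

theorem shift_shift (y z : Site d) (ω : Env d) : shift y (shift z ω) = shift (z + y) ω := by
  funext x
  simp only [shift]
  congr 1
  abel

theorem shift_zero (ω : Env d) : shift 0 ω = ω := by
  funext x; simp [shift]

theorem theta_theta (m n : ℕ) (q : Env d × (ℕ → Site d)) :
    theta m (theta n q) = theta (n + m) q := by
  refine Prod.ext ?_ ?_
  · simp [theta, shift_shift]
  · funext l
    simp [theta, add_assoc]

theorem measurable_shift (z : Site d) : Measurable (shift z : Env d → Env d) :=
  measurable_pi_lambda _ fun x => measurable_pi_apply (x + z)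

theorem measurable_theta (n : ℕ) : Measurable (theta n : Env d × (ℕ → Site d) → _) := by
  have h : Measurable fun q : Env d × Site d => shift q.2 q.1 :=
    measurable_from_prod_countable_left fun z => measurable_shift z
  refine Measurable.prodMk
    (h.comp (measurable_fst.prodMk ((measurable_pi_apply n).comp measurable_snd))) ?_
  exact measurable_pi_lambda _ fun m => ((measurable_pi_apply (n + m)).comp measurable_snd).sub
    ((measurable_pi_apply n).comp measurable_snd)

instance (μ : Measure (Env d)) [IsProbabilityMeasure μ] (z : Site d) :
    IsProbabilityMeasure (jointLaw μ z) := by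
  unfold jointLaw; infer_instance

theorem jointLaw_apply (μ : Measure (Env d)) [SFinite μ] (z : Site d)
    {D : Set (Env d × (ℕ → Site d))} (hD : MeasurableSet D) :
    jointLaw μ z D = ∫⁻ ω, quenchedLaw z ω (Prod.mk ω ⁻¹' D) ∂μ :=
  Measure.compProd_apply hD

theorem lintegral_jointLaw (μ : Measure (Env d)) [SFinite μ] (z : Site d)
    {f : Env d × (ℕ → Site d) → ℝ≥0∞} (hf : Measurable f) :
    ∫⁻ q, f q ∂(jointLaw μ z) = ∫⁻ ω, ∫⁻ X, f (ω, X) ∂(quenchedLaw z ω) ∂μ :=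
  Measure.lintegral_compProd hf

theorem jointLaw_fst (μ : Measure (Env d)) [SFinite μ] (z : Site d) :
    (jointLaw μ z).fst = μ := Measure.fst_compProd _ _

theorem measurable_quenchedLaw_section (z : Site d) {D : Set (Env d × (ℕ → Site d))}
    (hD : MeasurableSet D) : Measurable fun ω => quenchedLaw z ω (Prod.mk ω ⁻¹' D) :=
  Kernel.measurable_kernel_prodMk_left (κ := quenched z) hD

/-- The Markov property: the environment and the path seen at time `n` follow the joint law
started from the environment seen at time `n`. -/
theorem jointLaw_map_theta (μ : Measure (Env d)) [IsProbabilityMeasure μ] (z : Site d) (n : ℕ) :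
    (jointLaw μ z).map (theta n) = jointLaw ((jointLaw μ z).map fun q => (theta n q).1) 0 := by
  have hfst : Measurable fun q : Env d × (ℕ → Site d) => (theta n q).1 :=
    (measurable_theta n).fst
  have : IsProbabilityMeasure ((jointLaw μ z).map fun q => (theta n q).1) :=
    Measure.isProbabilityMeasure_map hfst.aemeasurable
  ext D hD
  have hms := measurable_quenchedLaw_section (0 : Site d) hD
  rw [Measure.map_apply (measurable_theta n) hD, jointLaw_apply _ _ hD, lintegral_map hms hfst,
    lintegral_jointLaw μ z (f := fun q => quenchedLaw 0 (theta n q).1 (Prod.mk (theta n q).1 ⁻¹' D))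
      (hms.comp hfst), jointLaw_apply _ _ (measurable_theta n hD)]
  refine lintegral_congr fun ω => ?_
  have hD' : MeasurableSet (Prod.mk ω ⁻¹' (theta n ⁻¹' D)) :=
    measurable_prodMk_left (measurable_theta n hD)
  rw [measure_prefix _ n hD', lintegral_prefix _ n]
  refine tsum_congr fun p => ?_
  set x := ext n p
  have hDx : MeasurableSet (Prod.mk (shift (x n) ω) ⁻¹' D) := measurable_prodMk_left hD
  have e : cyl x n ∩ Prod.mk ω ⁻¹' (theta n ⁻¹' D)
      = cyl x n ∩ {X | (fun m => X (n + m) - X n) ∈ Prod.mk (shift (x n) ω) ⁻¹' D} := by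
    ext X
    simp only [Set.mem_inter_iff, Set.mem_ofPred_eq, Set.mem_preimage, and_congr_right_iff, theta]
    intro hX
    rw [hX n le_rfl]
  rw [e, quenchedLaw_cyl_inter_sub _ _ _ _ hDx, setLIntegral_congr_fun (measurableSet_cyl x n)
    (g := fun _ => quenchedLaw 0 (shift (x n) ω) (Prod.mk (shift (x n) ω) ⁻¹' D)),
    setLIntegral_const, mul_comm]
  intro X hX
  simp [theta, hX n le_rfl]

/-! ### Restricted environments, their σ-algebras and independence -/

/-- The environment `ω` on `S`, replaced by a degenerate environment elsewhere. -/
noncomputable def keep (S : Set (Site d)) (ω : Env d) : Env d := by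
  classical exact fun x => if x ∈ S then ω x else PMF.pure 0

theorem keep_of_mem {S : Set (Site d)} {x : Site d} (h : x ∈ S) (ω : Env d) :
    keep S ω x = ω x := by simp [keep, h]

theorem keep_of_notMem {S : Set (Site d)} {x : Site d} (h : x ∉ S) (ω : Env d) :
    keep S ω x = PMF.pure 0 := by simp [keep, h]

theorem keep_congr {S : Set (Site d)} {ω ω' : Env d} (h : ∀ x ∈ S, ω x = ω' x) :
    keep S ω = keep S ω' := by
  funext x
  by_cases hx : x ∈ S
  · rw [keep_of_mem hx, keep_of_mem hx, h x hx]
  · rw [keep_of_notMem hx, keep_of_notMem hx]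

theorem keep_keep {S S' : Set (Site d)} (h : S ⊆ S') (ω : Env d) :
    keep S (keep S' ω) = keep S ω :=
  keep_congr fun _ hx => keep_of_mem (h hx) ω

/-- The σ-algebra generated by the environment in `S`. -/
abbrev siteSigma (S : Set (Site d)) : MeasurableSpace (Env d) :=
  ⨆ x ∈ S, MeasurableSpace.comap (fun ω : Env d => ω x) inferInstance

theorem siteSigma_le (S : Set (Site d)) :
    siteSigma S ≤ (inferInstance : MeasurableSpace (Env d)) :=
  iSup_le fun x => iSup_le fun _ => (measurable_pi_apply x).comap_le

theorem siteSigma_mono {S S' : Set (Site d)} (h : S ⊆ S') : siteSigma S ≤ siteSigma S' :=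
  biSup_mono h

theorem measurable_keep_siteSigma (S : Set (Site d)) : Measurable[siteSigma S] (keep S) := by
  refine @measurable_pi_lambda _ _ _ (siteSigma S) _ _ fun x => ?_
  by_cases hx : x ∈ S
  · have : (fun ω : Env d => keep S ω x) = fun ω => ω x := funext fun ω => keep_of_mem hx ω
    rw [this]
    exact Measurable.mono (comap_measurable _) (le_iSup₂_of_le x hx le_rfl) le_rfl
  · have : (fun ω : Env d => keep S ω x) = fun _ => PMF.pure 0 :=
      funext fun ω => keep_of_notMem hx ω
    rw [this]
    exact measurable_const

theorem measurable_keep (S : Set (Site d)) : Measurable (keep S) :=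
  (measurable_keep_siteSigma S).mono (siteSigma_le S) le_rfl

/-- A measurable function of the environment that only looks at sites in `S` is measurable for
the σ-algebra of `S`. -/
theorem measurable_siteSigma_of_keep {β : Type*} [MeasurableSpace β] {S : Set (Site d)}
    {f : Env d → β} (hf : Measurable f) (h : ∀ ω, f (keep S ω) = f ω) :
    Measurable[siteSigma S] f := by
  have : f = f ∘ keep S := funext fun ω => (h ω).symm
  rw [this]
  exact hf.comp (measurable_keep_siteSigma S)

/-- The sets whose membership is unaffected by `keep S` form a σ-algebra that contains the
generators of `siteSigma S`. With `measurable_siteSigma_of_keep` this turns measurability for a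
half-space into an equation. -/
theorem keep_mem_iff {S : Set (Site d)} {A : Set (Env d)} (hA : MeasurableSet[siteSigma S] A)
    (ω : Env d) : keep S ω ∈ A ↔ ω ∈ A := by
  let m : MeasurableSpace (Env d) :=
    { MeasurableSet' := fun A => ∀ ω, keep S ω ∈ A ↔ ω ∈ A
      measurableSet_empty := fun ω => by simp
      measurableSet_compl := fun s hs ω => not_congr (hs ω)
      measurableSet_iUnion := fun s hs ω => by
        simp only [Set.mem_iUnion]
        exact exists_congr fun i => hs i ω }
  have hm : siteSigma S ≤ m := by
    refine iSup₂_le fun x hx => ?_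
    rintro _ ⟨t, _, rfl⟩ ω
    simp [keep_of_mem hx]
  exact hm A hA ω

theorem keep_eq_of_measurable {β : Type*} [MeasurableSpace β] [MeasurableSingletonClass β]
    {S : Set (Site d)} {f : Env d → β} (hf : Measurable[siteSigma S] f) (ω : Env d) :
    f (keep S ω) = f ω :=
  (keep_mem_iff (hf (measurableSet_singleton (f ω))) ω).2 rfl

/-- Sites at levels at least `ℓ`. -/
def above (u : Site d) (ℓ : ℤ) : Set (Site d) := {x | ℓ ≤ x ⬝ᵥ u}

theorem mem_above {u : Site d} {ℓ : ℤ} {x : Site d} : x ∈ above u ℓ ↔ ℓ ≤ x ⬝ᵥ u := Iff.rfl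

theorem above_anti (u : Site d) {k l : ℤ} (h : k ≤ l) : above u l ⊆ above u k :=
  fun _ hx => h.trans hx

theorem levelSigma_intCast (u : Site d) (ℓ : ℤ) : levelSigma u ℓ = siteSigma (above u ℓ) := by
  simp only [levelSigma, siteSigma, mem_above, Int.cast_le]

theorem levelSigma_anti (u : Site d) {a b : ℝ} (h : a ≤ b) : levelSigma u b ≤ levelSigma u a :=
  biSup_mono fun _ hx => h.trans hx

section Product

variable (ν : Measure (PMF (Site d))) [IsProbabilityMeasure ν]

theorem indep_siteSigma {S S' : Set (Site d)} (h : Disjoint S S') :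
    Indep (siteSigma S) (siteSigma S') (Measure.infinitePi fun _ : Site d => ν) := by
  have hi : iIndepFun (fun (x : Site d) (ω : Env d) => ω x)
      (Measure.infinitePi fun _ : Site d => ν) :=
    iIndepFun_infinitePi (P := fun _ : Site d => ν) (X := fun _ p => p) (fun _ => measurable_id)
  exact indep_iSup_of_disjoint (fun x => (measurable_pi_apply x).comap_le) hi h

theorem lintegral_mul_of_disjoint {S S' : Set (Site d)} (h : Disjoint S S') {f g : Env d → ℝ≥0∞}
    (hf : Measurable[siteSigma S] f) (hg : Measurable[siteSigma S'] g) :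
    ∫⁻ ω, f ω * g ω ∂(Measure.infinitePi fun _ : Site d => ν)
      = (∫⁻ ω, f ω ∂(Measure.infinitePi fun _ : Site d => ν))
        * ∫⁻ ω, g ω ∂(Measure.infinitePi fun _ : Site d => ν) :=
  lintegral_mul_eq_lintegral_mul_lintegral_of_independent_measurableSpace
    (siteSigma_le S) (siteSigma_le S') (indep_siteSigma ν h) hf hg

/-- A shift permutes the factors of a product of identical laws; it suffices to compare finite
boxes. -/
theorem infinitePi_map_shift (z : Site d) :
    (Measure.infinitePi fun _ : Site d => ν).map (shift z)
      = Measure.infinitePi fun _ : Site d => ν := by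
  refine Measure.eq_infinitePi _ fun s t ht => ?_
  rw [Measure.map_apply (measurable_shift z) (.pi (Finset.countable_toSet s) fun i _ => ht i)]
  have e : shift z ⁻¹' (s : Set (Site d)).pi t
      = ((s.map (addRightEmbedding z) : Finset (Site d)) : Set (Site d)).pi
        (fun x => t (x - z)) := by
    ext ω
    simp only [shift, Set.mem_pi, Set.mem_preimage, Finset.mem_coe, Finset.mem_map,
      addRightEmbedding_apply]
    constructor
    · rintro h _ ⟨x, hx, rfl⟩
      simpa using h x hx
    · intro h x hx
      simpa using h (x + z) ⟨x, hx, rfl⟩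
  rw [e, Measure.infinitePi_pi _ fun i _ => ht _]
  simp

end Product

/-! ### Standard Borel structure on probability vectors -/

theorem standardBorelSpace_of_measurableEquiv {α β : Type*} [MeasurableSpace α]
    [MeasurableSpace β] [StandardBorelSpace β] (e : α ≃ᵐ β) : StandardBorelSpace α := by
  let _ := upgradeStandardBorel β
  let _ : TopologicalSpace α := TopologicalSpace.induced e inferInstance
  have : PolishSpace α := (e.toEquiv.toHomeomorphOfIsInducing ⟨rfl⟩).isClosedEmbedding.polishSpace
  have : BorelSpace α := ⟨calc
    _ = MeasurableSpace.comap e ‹MeasurableSpace β› := e.measurableEmbedding.comap_eq.symm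
    _ = MeasurableSpace.comap e (borel β) :=
      congrArg (MeasurableSpace.comap e) BorelSpace.measurable_eq
    _ = _ := borel_comap.symm⟩
  infer_instance

/-- Probability vectors are the measurable subset of total mass one in a countable product of copies
of `ℝ≥0∞`. The structure provides the conditional kernels used in the extension theorem. -/
instance : StandardBorelSpace (PMF (Site d)) := by
  have hcomap : Measurable fun (p : PMF (Site d)) (z : Site d) => p z := comap_measurable _
  have hinj : Function.Injective fun (p : PMF (Site d)) (z : Site d) => p z :=
    fun p q h => PMF.ext fun z => congrFun h z
  have hrange : MeasurableSet (Set.range fun (p : PMF (Site d)) (z : Site d) => p z) := by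
    have : Set.range (fun (p : PMF (Site d)) (z : Site d) => p z)
        = {g : Site d → ℝ≥0∞ | ∑' z, g z = 1} := by
      ext g
      constructor
      · rintro ⟨p, rfl⟩
        exact p.tsum_coe
      · intro hg
        exact ⟨⟨g, hg ▸ ENNReal.summable.hasSum⟩, rfl⟩
    rw [this]
    exact (Measurable.tsum fun z => measurable_pi_apply z) (measurableSet_singleton 1)
  have hemb : MeasurableEmbedding fun (p : PMF (Site d)) (z : Site d) => p z := by
    refine ⟨hinj, hcomap, ?_⟩
    rintro _ ⟨t, ht, rfl⟩
    rw [Set.image_preimage_eq_inter_range]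
    exact ht.inter hrange
  have := hrange.standardBorel
  exact standardBorelSpace_of_measurableEquiv hemb.equivRange

/-! ### Birkhoff's theorem through the maximal ergodic theorem -/

section Birkhoff

variable {α : Type*}

/-- The running maximum `max_{0 ≤ k ≤ n} (g + g ∘ T + ⋯ + g ∘ T^[k-1])`. -/
noncomputable def maxSum (T : α → α) (g : α → ℝ) : ℕ → α → ℝ
  | 0 => 0
  | n + 1 => fun x => max 0 (g x + maxSum T g n (T x))

theorem maxSum_nonneg (T : α → α) (g : α → ℝ) (n : ℕ) (x : α) : 0 ≤ maxSum T g n x := by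
  cases n with
  | zero => exact le_rfl
  | succ n => exact le_max_left _ _

theorem maxSum_le_succ (T : α → α) (g : α → ℝ) (n : ℕ) (x : α) :
    maxSum T g n x ≤ maxSum T g (n + 1) x := by
  induction n generalizing x with
  | zero => exact maxSum_nonneg T g 1 x
  | succ n ih => exact max_le_max le_rfl (by gcongr; exact ih (T x))

theorem birkhoffSum_le_maxSum (T : α → α) (g : α → ℝ) (n : ℕ) (x : α) :
    birkhoffSum T g n x ≤ maxSum T g n x := by
  induction n generalizing x with
  | zero => simp [maxSum]
  | succ n ih =>
    rw [birkhoffSum_succ']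
    exact (add_le_add le_rfl (ih (T x))).trans (le_max_right _ _)

variable [MeasurableSpace α] {μ : Measure α} {T : α → α} {g : α → ℝ}

theorem integrable_maxSum (hT : MeasurePreserving T μ μ) (hg : Integrable g μ) (n : ℕ) :
    Integrable (maxSum T g n) μ := by
  induction n with
  | zero => exact integrable_zero _ _ _
  | succ n ih =>
    exact (integrable_zero α ℝ μ).sup (hg.add (hT.integrable_comp_of_integrable ih))

theorem measurable_maxSum (hT : Measurable T) (hg : Measurable g) (n : ℕ) :
    Measurable (maxSum T g n) := by
  induction n with
  | zero => exact measurable_zero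
  | succ n ih => exact measurable_const.max (hg.add (ih.comp hT))

/-- The maximal ergodic theorem. -/
theorem setIntegral_maxSum_pos_nonneg (hT : MeasurePreserving T μ μ) (hgm : Measurable g)
    (hg : Integrable g μ) : 0 ≤ ∫ x in ⋃ n, {x | 0 < maxSum T g n x}, g x ∂μ := by
  have hms : ∀ n, MeasurableSet {x | 0 < maxSum T g n x} := fun n =>
    measurableSet_lt measurable_const (measurable_maxSum hT.measurable hgm n)
  have hmono : Monotone fun n => {x | 0 < maxSum T g n x} :=
    monotone_nat_of_le_succ fun n x hx => lt_of_lt_of_le hx (maxSum_le_succ T g n x)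
  refine ge_of_tendsto' (tendsto_setIntegral_of_monotone hms hmono hg.integrableOn) fun n => ?_
  have hi := integrable_maxSum hT hg n
  have hiT : Integrable (fun x => maxSum T g n (T x)) μ := hT.integrable_comp_of_integrable hi
  -- Writing `M` for the running maximum, `M - M ∘ T` has integral zero. It is at most `g` where `M
  -- > 0`, and at most `0` elsewhere, because there `M` vanishes while `M ∘ T` is nonnegative.
  have h1 : ∫ x, (maxSum T g n x - maxSum T g n (T x)) ∂μ = 0 := by
    rw [integral_sub hi hiT, sub_eq_zero]
    conv_lhs => rw [← hT.map_eq]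
    rw [integral_map hT.measurable.aemeasurable]
    rw [hT.map_eq]
    exact hi.aestronglyMeasurable
  refine h1.symm.le.trans ?_
  rw [← integral_indicator (hms n)]
  refine integral_mono (hi.sub hiT) (hg.indicator (hms n)) fun x => ?_
  by_cases hx : 0 < maxSum T g n x
  · rw [Set.indicator_of_mem (by exact hx)]
    cases n with
    | zero => exact absurd hx (lt_irrefl _)
    | succ n =>
      have h2 := maxSum_le_succ T g n (T x)
      have h3 : maxSum T g (n + 1) x = g x + maxSum T g n (T x) := by
        rcases max_choice 0 (g x + maxSum T g n (T x)) with h | h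
        · exact absurd hx (not_lt.2 (le_of_eq h))
        · exact h
      linarith
  · rw [Set.indicator_of_notMem (by exact hx)]
    have h2 := maxSum_nonneg T g n (T x)
    linarith

/-- The set of points with sums unbounded above is strictly invariant, so it is null or conull. If
it were conull, some running maximum would be positive almost everywhere, and the maximal theorem
would force a nonnegative integral. -/
theorem ae_bddAbove_birkhoffSum [IsProbabilityMeasure μ] (hT : Ergodic T μ) (hgm : Measurable g)
    (hg : Integrable g μ) (hneg : ∫ x, g x ∂μ < 0) :
    ∀ᵐ x ∂μ, ∃ k : ℕ, ∀ n, birkhoffSum T g n x ≤ k := by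
  set F : Set α := {x | ∀ k : ℕ, ∃ n, (k : ℝ) < birkhoffSum T g n x} with hF
  have hbm : ∀ n, Measurable (birkhoffSum T g n) := fun n => by
    unfold birkhoffSum
    exact Finset.measurable_sum _ fun i _ => hgm.comp (hT.measurable.iterate i)
  have hFm : MeasurableSet F := by
    have : F = ⋂ k : ℕ, ⋃ n, {x | (k : ℝ) < birkhoffSum T g n x} := by
      ext x; simp [hF]
    rw [this]
    exact .iInter fun k => .iUnion fun n => measurableSet_lt measurable_const (hbm n)
  have hinv : T ⁻¹' F = F := by
    ext x
    simp only [Set.mem_preimage, hF, Set.mem_ofPred_eq]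
    constructor
    · intro h k
      obtain ⟨m, hm⟩ := exists_nat_gt (k - g x)
      obtain ⟨n, hn⟩ := h m
      exact ⟨n + 1, by rw [birkhoffSum_succ']; linarith⟩
    · intro h k
      obtain ⟨m, hm⟩ := exists_nat_gt (k + |g x|)
      obtain ⟨n, hn⟩ := h m
      have := le_abs_self (g x)
      have := abs_nonneg (g x)
      cases n with
      | zero =>
        rw [birkhoffSum_zero] at hn
        exact absurd hn (by have := Nat.cast_nonneg (α := ℝ) m; linarith)
      | succ n => exact ⟨n, by rw [birkhoffSum_succ'] at hn; linarith⟩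
  rcases hT.toPreErgodic.ae_mem_or_ae_notMem hFm hinv with h | h
  · exfalso
    have hE := setIntegral_maxSum_pos_nonneg hT.toMeasurePreserving hgm hg
    rw [setIntegral_eq_integral_of_ae_compl_eq_zero] at hE
    · exact absurd hneg (not_lt.2 hE)
    · filter_upwards [h] with x hx hx'
      obtain ⟨n, hn⟩ := hx 0
      exact absurd (Set.mem_iUnion.2 ⟨n, (lt_of_le_of_lt (by simp) hn).trans_le
        (birkhoffSum_le_maxSum T g n x)⟩) hx'
  · filter_upwards [h] with x hx
    simpa [hF] using hx

/-- Birkhoff's pointwise ergodic theorem for ergodic maps. -/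
theorem tendsto_average_of_ergodic [IsProbabilityMeasure μ] (hT : Ergodic T μ) (hgm : Measurable g)
    (hg : Integrable g μ) :
    ∀ᵐ x ∂μ, Tendsto (fun n : ℕ => (n : ℝ)⁻¹ * birkhoffSum T g n x) atTop (𝓝 (∫ x, g x ∂μ)) := by
  -- Subtracting slightly more than the mean makes the integral negative, so the sums exceed `n`
  -- times the raised level by a bounded amount at most. Applied to `g` and `-g` this gives both
  -- halves of the limit.
  have upper : ∀ f : α → ℝ, Measurable f → Integrable f μ → ∀ᵐ x ∂μ, ∀ m : ℕ, ∃ k : ℕ, ∀ n : ℕ,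
      birkhoffSum T f n x ≤ k + n * (∫ x, f x ∂μ + 1 / ((m : ℝ) + 1)) := by
    intro f hfm hf
    rw [ae_all_iff]
    intro m
    have hpos : (0 : ℝ) < 1 / ((m : ℝ) + 1) := by positivity
    have := ae_bddAbove_birkhoffSum hT
      (g := fun x => f x - (∫ x, f x ∂μ + 1 / ((m : ℝ) + 1))) (hfm.sub measurable_const)
      (hf.sub (integrable_const _)) (by
        rw [integral_sub hf (integrable_const _)]
        simp only [integral_const, probReal_univ, smul_eq_mul, one_mul]
        linarith)
    filter_upwards [this] with x ⟨k, hk⟩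
    refine ⟨k, fun n => ?_⟩
    have h1 := hk n
    simp only [birkhoffSum, sum_sub_distrib, sum_const, card_range, nsmul_eq_mul] at h1 ⊢
    linarith
  filter_upwards [upper g hgm hg, upper (fun x => -g x) hgm.neg hg.neg] with x hx hx'
  rw [Metric.tendsto_atTop]
  intro ε hε
  obtain ⟨m, hm⟩ := exists_nat_one_div_lt (half_pos hε)
  obtain ⟨k, hk⟩ := hx m
  obtain ⟨k', hk'⟩ := hx' m
  obtain ⟨N, hN⟩ := exists_nat_gt ((k + k' : ℝ) / (ε / 2))
  refine ⟨N + 1, fun n hn => ?_⟩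
  have hn0 : (0 : ℝ) < n := by exact_mod_cast (by omega : 0 < n)
  have hNn : (N : ℝ) < n := by exact_mod_cast (by omega : N < n)
  have h1 : (k + k' : ℝ) < n * (ε / 2) := by
    rw [div_lt_iff₀ (half_pos hε)] at hN
    nlinarith
  have h2 := hk n
  have h3 := hk' n
  simp only [birkhoffSum, sum_neg_distrib, integral_neg] at h2 h3
  have hk0 : (0 : ℝ) ≤ k := Nat.cast_nonneg _
  have hk0' : (0 : ℝ) ≤ k' := Nat.cast_nonneg _
  rw [Real.dist_eq, abs_lt]
  simp only [birkhoffSum]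
  have e : (n : ℝ)⁻¹ * ∑ i ∈ range n, g (T^[i] x) - ∫ x, g x ∂μ
      = (∑ i ∈ range n, g (T^[i] x) - n * ∫ x, g x ∂μ) / n := by
    field_simp
  have hm' : n * (1 / ((m : ℝ) + 1)) < n * (ε / 2) := by gcongr
  rw [e]
  constructor
  · rw [lt_div_iff₀ hn0]; linarith
  · rw [div_lt_iff₀ hn0]; linarith

end Birkhoff

/-! ### From block averages to time averages -/

/-- If the averages of a bounded sequence over a growing number of blocks converge, then so do the
averages over time. -/
theorem tendsto_average_of_blocks {f : ℕ → ℝ} {b : ℝ} (hb : ∀ j, |f j| ≤ b) {t : ℕ → ℕ}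
    (ht : StrictMono t) (ht0 : t 0 = 0) {E L : ℝ} (hE : 0 < E)
    (hlen : Tendsto (fun n : ℕ => (n : ℝ)⁻¹ * t n) atTop (𝓝 E))
    (hsum : Tendsto (fun n : ℕ => (n : ℝ)⁻¹ * ∑ j ∈ range (t n), f j) atTop (𝓝 L)) :
    Tendsto (fun n : ℕ => (n : ℝ)⁻¹ * ∑ j ∈ range n, f j) atTop (𝓝 (L / E)) := by
  set c := L / E
  set H : ℕ → ℝ := fun J => ∑ j ∈ range J, (f j - c) with hH
  have hHeq : ∀ J, H J = ∑ j ∈ range J, f j - J * c := fun J => by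
    simp [hH, sum_sub_distrib]
  have h1 : Tendsto (fun n : ℕ => (n : ℝ)⁻¹ * H (t n)) atTop (𝓝 0) := by
    have := hsum.sub (hlen.mul_const c)
    have e : L - E * c = 0 := by simp only [c]; field_simp; ring
    rw [e] at this
    refine this.congr fun n => ?_
    rw [hHeq]; ring
  -- A single block is negligible against the number of blocks, since the averages at `n` and `n +
  -- 1` have the same limit. This controls the incomplete last block.
  have h2 : Tendsto (fun n : ℕ => (n : ℝ)⁻¹ * ((t (n + 1) : ℝ) - t n)) atTop (𝓝 0) := by
    have h3 : Tendsto (fun n : ℕ => ((n + 1 : ℕ) : ℝ)⁻¹ * t (n + 1)) atTop (𝓝 E) :=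
      hlen.comp (tendsto_add_atTop_nat 1)
    have h4 : Tendsto (fun n : ℕ => 1 + (n : ℝ)⁻¹) atTop (𝓝 (1 + 0)) :=
      tendsto_const_nhds.add tendsto_inv_atTop_nhds_zero_nat
    have h5 := (h4.mul h3).sub hlen
    rw [add_zero, one_mul, sub_self] at h5
    refine h5.congr' ?_
    filter_upwards [eventually_gt_atTop 0] with n hn
    have : (n : ℝ) ≠ 0 := by positivity
    push_cast
    field_simp
  have hbc : ∀ j, |f j - c| ≤ b + |c| := fun j => (abs_sub _ _).trans (by gcongr; exact hb j)
  have hB : 0 ≤ b + |c| := (abs_nonneg _).trans (hbc 0)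
  suffices h : Tendsto (fun n : ℕ => (n : ℝ)⁻¹ * H n) atTop (𝓝 0) by
    have := h.add_const c
    rw [zero_add] at this
    refine this.congr' ?_
    filter_upwards [eventually_gt_atTop 0] with n hn
    have : (n : ℝ) ≠ 0 := by positivity
    rw [hHeq]
    field_simp
    ring
  have h2' := h2.const_mul (b + |c|)
  rw [mul_zero] at h2'
  rw [Metric.tendsto_atTop] at h1 h2' ⊢
  intro ε hε
  obtain ⟨N1, hN1⟩ := h1 (ε / 2) (half_pos hε)
  obtain ⟨N2, hN2⟩ := h2' (ε / 2) (half_pos hε)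
  refine ⟨t (max (max N1 N2) 1), fun J hJ => ?_⟩
  have hex : ∃ n, J < t n := ⟨J + 1, (Nat.lt_succ_self J).trans_le (ht.le_apply)⟩
  obtain ⟨n, hn⟩ : ∃ n, Nat.find hex = n + 1 := by
    refine Nat.exists_eq_succ_of_ne_zero fun h => ?_
    have := Nat.find_spec hex
    rw [h, ht0] at this
    omega
  have hJ2 : J < t (n + 1) := hn ▸ Nat.find_spec hex
  have hJ1 : t n ≤ J := not_lt.1 (Nat.find_min hex (by omega))
  have hn' : max (max N1 N2) 1 ≤ n := by
    have := ht.lt_iff_lt.1 (hJ.trans_lt hJ2)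
    omega
  have hnpos : (0 : ℝ) < n := by
    have : 0 < n := by omega
    exact_mod_cast this
  have hnJ : (n : ℝ) ≤ J := by exact_mod_cast (ht.le_apply (x := n)).trans hJ1
  have a1 := hN1 n (by omega)
  have a2 := hN2 n (by omega)
  rw [Real.dist_eq, sub_zero, abs_mul, abs_of_pos (inv_pos.2 hnpos), inv_mul_lt_iff₀ hnpos] at a1
  rw [Real.dist_eq, sub_zero] at a2
  have a2' := (le_abs_self _).trans_lt a2
  rw [mul_left_comm, inv_mul_lt_iff₀ hnpos] at a2'
  have a3 : |H J| ≤ |H (t n)| + (b + |c|) * ((t (n + 1) : ℝ) - t n) := by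
    have e : H J = H (t n) + ∑ j ∈ Ico (t n) J, (f j - c) :=
      (sum_range_add_sum_Ico _ hJ1).symm
    rw [e]
    refine (abs_add_le _ _).trans (add_le_add le_rfl ?_)
    refine (abs_sum_le_sum_abs _ _).trans ((sum_le_sum fun j _ => hbc j).trans ?_)
    rw [sum_const, Nat.card_Ico, nsmul_eq_mul, mul_comm, Nat.cast_sub hJ1]
    gcongr
  rw [Real.dist_eq, sub_zero, abs_mul, abs_of_nonneg (by positivity),
    inv_mul_lt_iff₀ (hnpos.trans_le hnJ)]
  nlinarith

/-! ### Renewal in an i.i.d. environment -/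

/-- The environment law under which the `ω_x` are i.i.d. with law `ν`. -/
noncomputable abbrev iid (ν : Measure (PMF (Site d))) : Measure (Env d) :=
  Measure.infinitePi fun _ : Site d => ν

theorem shift_keep (u z : Site d) (ℓ : ℤ) (ω : Env d) :
    shift z (keep (above u (z ⬝ᵥ u + ℓ)) ω) = keep (above u ℓ) (shift z ω) := by
  funext x
  by_cases hx : ℓ ≤ x ⬝ᵥ u
  · have h1 : x + z ∈ above u (z ⬝ᵥ u + ℓ) := by
      rw [mem_above, add_dotProduct]; linarith
    rw [keep_of_mem (mem_above.2 hx), shift, shift, keep_of_mem h1]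
  · have h1 : x + z ∉ above u (z ⬝ᵥ u + ℓ) := by
      rw [mem_above, add_dotProduct]; intro h; exact hx (by linarith)
    rw [keep_of_notMem (by rwa [mem_above]), shift, keep_of_notMem h1]

theorem measurable_wt_siteSigma {S : Set (Site d)} {x : ℕ → Site d} {n : ℕ}
    (h : ∀ i < n, x i ∈ S) : Measurable[siteSigma S] fun ω : Env d => wt ω x n :=
  measurable_siteSigma_of_keep (measurable_wt x n) fun ω =>
    wt_congr fun i hi => keep_of_mem (h i hi) ω

theorem measurable_comp_shift_siteSigma (u z : Site d) (ℓ : ℤ) {h : Env d → ℝ≥0∞}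
    (hm : Measurable h) (hk : ∀ ω, h (keep (above u ℓ) ω) = h ω) :
    Measurable[siteSigma (above u (z ⬝ᵥ u + ℓ))] fun ω => h (shift z ω) :=
  measurable_siteSigma_of_keep (hm.comp (measurable_shift z)) fun ω => by
    rw [shift_keep, hk]

theorem lintegral_comp_shift (ν : Measure (PMF (Site d))) [IsProbabilityMeasure ν] (z : Site d)
    {h : Env d → ℝ≥0∞} (hm : Measurable h) :
    ∫⁻ ω, h (shift z ω) ∂(iid ν) = ∫⁻ ω, h ω ∂(iid ν) := by
  rw [← lintegral_map hm (measurable_shift z), infinitePi_map_shift]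

/-- Independence of the past of the walk and of the environment ahead of it: before time `n` the
walk has only used sites below level `X_n · u + ℓ`, and `F` only looks at the environment
above that level. -/
theorem jointLaw_renewal (ν : Measure (PMF (Site d))) [IsProbabilityMeasure ν] {u : Site d} {n : ℕ}
    {ℓ L : ℤ} {A : Set (ℕ → Site d)} (hA : PrefixDet n A)
    (hAu : ∀ X ∈ A, (∀ m < n, X m ⬝ᵥ u < X n ⬝ᵥ u + ℓ) ∧ L ≤ X n ⬝ᵥ u + ℓ)
    {E : Set (Env d)} (hE : MeasurableSet[siteSigma (above u L)ᶜ] E)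
    {F : Set (Env d × (ℕ → Site d))} (hF : MeasurableSet F)
    (hFu : ∀ ω, quenchedLaw 0 (keep (above u ℓ) ω) (Prod.mk (keep (above u ℓ) ω) ⁻¹' F)
      = quenchedLaw 0 ω (Prod.mk ω ⁻¹' F)) :
    jointLaw (iid ν) 0 {q | q.1 ∈ E ∧ q.2 ∈ A ∧ theta n q ∈ F}
      = jointLaw (iid ν) 0 {q | q.1 ∈ E ∧ q.2 ∈ A} * jointLaw (iid ν) 0 F := by
  classical
  have hEm : MeasurableSet E := siteSigma_le _ _ hE
  set h : Env d → ℝ≥0∞ := fun ω => quenchedLaw 0 ω (Prod.mk ω ⁻¹' F) with hh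
  have hhm : Measurable h := measurable_quenchedLaw_section 0 hF
  -- The contribution of one prefix: it depends on the environment in `E` and at the sites used
  -- before time `n`. Summing over prefixes freezes the random position at time `n`.
  set f : (Π _ : Iic n, Site d) → Env d → ℝ≥0∞ := fun p ω =>
    if ext n p ∈ A ∧ ext n p 0 = 0 then E.indicator 1 ω * wt ω (ext n p) n else 0 with hf
  have hfm : ∀ p, Measurable (f p) := by
    intro p
    simp only [hf]
    split_ifs
    · exact (measurable_one.indicator hEm).mul (measurable_wt _ _)
    · exact measurable_const
  have m1 : MeasurableSet {q : Env d × (ℕ → Site d) | q.1 ∈ E ∧ q.2 ∈ A} :=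
    (measurable_fst hEm).inter (measurable_snd hA.measurableSet)
  have m2 : MeasurableSet {q : Env d × (ℕ → Site d) | q.1 ∈ E ∧ q.2 ∈ A ∧ theta n q ∈ F} := by
    simp_rw [← and_assoc]
    exact m1.inter (measurable_theta n hF)
  have key : ∀ (G : Set (Env d × (ℕ → Site d))), MeasurableSet G → ∀ ω,
      quenchedLaw 0 ω (Prod.mk ω ⁻¹' {q | q.1 ∈ E ∧ q.2 ∈ A ∧ theta n q ∈ G})
      = ∑' p, f p ω * quenchedLaw 0 (shift (ext n p n) ω)
          (Prod.mk (shift (ext n p n) ω) ⁻¹' G) := by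
    intro G hG ω
    have m3 : MeasurableSet {q : Env d × (ℕ → Site d) | q.1 ∈ E ∧ q.2 ∈ A ∧ theta n q ∈ G} := by
      simp_rw [← and_assoc]
      exact m1.inter (measurable_theta n hG)
    rw [measure_prefix _ n (measurable_prodMk_left m3)]
    refine tsum_congr fun p => ?_
    set x := ext n p with hx
    by_cases hpE : x ∈ A ∧ ω ∈ E
    · have e : cyl x n ∩ Prod.mk ω ⁻¹' {q | q.1 ∈ E ∧ q.2 ∈ A ∧ theta n q ∈ G}
          = cyl x n ∩ {X | (fun m => X (n + m) - X n) ∈ Prod.mk (shift (x n) ω) ⁻¹' G} := by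
        ext X
        simp only [Set.mem_inter_iff, Set.mem_ofPred_eq, Set.mem_preimage, and_congr_right_iff,
          theta, hpE.2, true_and]
        intro hX
        rw [hX n le_rfl]
        exact and_iff_right (hA _ _ (fun i hi => (hX i hi).symm) hpE.1)
      rw [e, quenchedLaw_cyl_inter_sub _ _ _ _ (measurable_prodMk_left hG), quenchedLaw_cyl]
      by_cases h0 : x 0 = 0
      · simp [hf, ← hx, hpE.1, hpE.2, h0]
      · simp [hf, ← hx, h0]
    · have e : cyl x n ∩ Prod.mk ω ⁻¹' {q | q.1 ∈ E ∧ q.2 ∈ A ∧ theta n q ∈ G} = ∅ := by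
        ext X
        simp only [Set.mem_inter_iff, Set.mem_ofPred_eq, Set.mem_preimage,
          Set.mem_empty_iff_false, iff_false]
        rintro ⟨hX, hXE, hXA, -⟩
        exact hpE ⟨hA _ _ hX hXA, hXE⟩
      rw [e, measure_empty]
      symm
      rw [mul_eq_zero]
      left
      simp only [hf, ← hx]
      split_ifs with hc
      · have : ω ∉ E := fun h => hpE ⟨hc.1, h⟩
        simp [this]
      · rfl
  have hind : ∀ p, ∫⁻ ω, f p ω * h (shift (ext n p n) ω) ∂(iid ν)
      = (∫⁻ ω, f p ω ∂(iid ν)) * ∫⁻ ω, h ω ∂(iid ν) := by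
    intro p
    set x := ext n p with hx
    by_cases hp : x ∈ A ∧ x 0 = 0
    · obtain ⟨hlt, hL⟩ := hAu x hp.1
      -- For a fixed prefix the two factors use opposite sides of level `x n · u + ℓ`. The bound by
      -- `L` keeps `E` on the lower side, and stationarity removes the shift from the upper factor.
      rw [lintegral_mul_of_disjoint ν (S := (above u (x n ⬝ᵥ u + ℓ))ᶜ)
        (S' := above u (x n ⬝ᵥ u + ℓ)) disjoint_compl_left, lintegral_comp_shift ν _ hhm]
      · simp only [hf, ← hx, if_pos hp]
        have hE' : MeasurableSet[siteSigma (above u (x n ⬝ᵥ u + ℓ))ᶜ] E :=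
          siteSigma_mono (Set.compl_subset_compl.2 (above_anti u hL)) _ hE
        exact Measurable.mul (Measurable.indicator measurable_const hE')
          (measurable_wt_siteSigma fun i hi => by
            simpa [mem_above] using hlt i hi)
      · exact measurable_comp_shift_siteSigma u _ ℓ hhm hFu
    · simp [hf, ← hx, hp]
  have hF1 := jointLaw_apply (iid ν) 0 hF
  have e1 : {q : Env d × (ℕ → Site d) | q.1 ∈ E ∧ q.2 ∈ A}
      = {q | q.1 ∈ E ∧ q.2 ∈ A ∧ theta n q ∈ Set.univ} := by simp
  rw [hF1, jointLaw_apply _ _ m2, e1, jointLaw_apply _ _ (e1 ▸ m1)]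
  simp_rw [key F hF, key Set.univ .univ]
  simp only [Set.preimage_univ, measure_univ, mul_one]
  rw [lintegral_tsum (f := fun p ω => f p ω * h (shift (ext n p n) ω))
      fun p => ((hfm p).mul (hhm.comp (measurable_shift _))).aemeasurable,
    lintegral_tsum fun p => (hfm p).aemeasurable, ← ENNReal.tsum_mul_right]
  exact tsum_congr hind

/-! ### Regeneration -/

/-- Paths that never go below level `0`. -/
def stay (u : Site d) : Set (ℕ → Site d) := {X | ∀ m, 0 ≤ X m ⬝ᵥ u}

/-- `n` is a regeneration time with `n ≥ K` whose level is at least `K`. -/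
def RegenFrom (u : Site d) (K : ℕ) (X : ℕ → Site d) (n : ℕ) : Prop :=
  K ≤ n ∧ (K : ℤ) ≤ X n ⬝ᵥ u ∧ IsRegeneration u X n

/-- The path has a regeneration time at least `K` whose level is at least `K`. -/
def hasRegen (u : Site d) (K : ℕ) : Set (ℕ → Site d) := {X | ∃ n, RegenFrom u K X n}

/-- The second alternative makes the search in `nxt` total: when there is no suitable regeneration,
every index qualifies and the search returns `0`. -/
theorem exists_regenFrom_or (u : Site d) (K : ℕ) (X : ℕ → Site d) :
    ∃ n, RegenFrom u K X n ∨ X ∉ hasRegen u K := by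
  by_cases h : X ∈ hasRegen u K
  · exact h.imp fun n hn => Or.inl hn
  · exact ⟨0, Or.inr h⟩

open Classical in
/-- The first regeneration time at least `K` whose level is at least `K`, or `0`. -/
noncomputable def nxt (u : Site d) (K : ℕ) (X : ℕ → Site d) : ℕ :=
  Nat.find (exists_regenFrom_or u K X)

theorem regenFrom_nxt {u : Site d} {K : ℕ} {X : ℕ → Site d} (h : X ∈ hasRegen u K) :
    RegenFrom u K X (nxt u K X) := by
  classical
  exact (Nat.find_spec (exists_regenFrom_or u K X)).resolve_right (not_not.2 h)

theorem nxt_le {u : Site d} {K n : ℕ} {X : ℕ → Site d} (h : RegenFrom u K X n) :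
    nxt u K X ≤ n := by
  classical
  exact Nat.find_min' _ (Or.inl h)

theorem measurable_level (u : Site d) (n : ℕ) : Measurable fun X : ℕ → Site d => X n ⬝ᵥ u :=
  (measurable_of_countable fun x : Site d => x ⬝ᵥ u).comp (measurable_pi_apply n)

theorem measurableSet_stay (u : Site d) : MeasurableSet (stay u) := by
  have : stay u = ⋂ m, {X | 0 ≤ X m ⬝ᵥ u} := by ext; simp [stay]
  rw [this]
  exact .iInter fun m => measurableSet_le measurable_const (measurable_level u m)

theorem measurableSet_regenFrom (u : Site d) (K n : ℕ) :
    MeasurableSet {X | RegenFrom u K X n} := by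
  have : {X : ℕ → Site d | RegenFrom u K X n} = {X | K ≤ n} ∩ ({X | (K : ℤ) ≤ X n ⬝ᵥ u} ∩
      ({X | 1 ≤ n} ∩ ((⋂ m, {X | m < n → X m ⬝ᵥ u < X n ⬝ᵥ u}) ∩
        ⋂ m, {X | n ≤ m → X n ⬝ᵥ u ≤ X m ⬝ᵥ u}))) := by
    ext X; simp [RegenFrom, IsRegeneration]
  rw [this]
  refine .inter (.const _) (.inter (measurableSet_le measurable_const (measurable_level u n))
    (.inter (.const _) (.inter (.iInter fun m => ?_) (.iInter fun m => ?_))))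
  · exact (MeasurableSet.const _).imp (measurableSet_lt (measurable_level u m) (measurable_level u n))
  · exact (MeasurableSet.const _).imp (measurableSet_le (measurable_level u n) (measurable_level u m))

theorem measurableSet_hasRegen (u : Site d) (K : ℕ) : MeasurableSet (hasRegen u K) := by
  have : hasRegen u K = ⋃ n, {X | RegenFrom u K X n} := by ext; simp [hasRegen]
  rw [this]
  exact .iUnion fun n => measurableSet_regenFrom u K n

theorem measurable_nxt (u : Site d) (K : ℕ) : Measurable (nxt u K) := by
  classical
  exact measurable_find _ fun n =>
    (measurableSet_regenFrom u K n).union (measurableSet_hasRegen u K).compl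

/-- Up to time `n` the two paths coincide, and after `n` the path `X` stays above its level at `n`,
which is at least its level at `m`. Thus regenerations up to a common time transfer between paths.
-/
theorem isRegeneration_of_agree {u : Site d} {X X' : ℕ → Site d} {n : ℕ}
    (h : ∀ i ≤ n, X i = X' i) (hX : ∀ m ≥ n, X n ⬝ᵥ u ≤ X m ⬝ᵥ u) {m : ℕ} (hm : m ≤ n)
    (hm' : IsRegeneration u X' m) : IsRegeneration u X m := by
  refine ⟨hm'.1, fun k hk => ?_, fun k hk => ?_⟩
  · rw [h k (hk.le.trans hm), h m hm]; exact hm'.2.1 k hk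
  · have h1 : X m ⬝ᵥ u ≤ X n ⬝ᵥ u := by
      rw [h m hm, h n le_rfl]; exact hm'.2.2 n hm
    rcases le_total k n with hkn | hkn
    · rw [h m hm, h k hkn]; exact hm'.2.2 k hk
    · exact h1.trans (hX k hkn)

/-- Given that a regeneration happens at the time `nxt u K`, membership in `C` is decided by the
path up to that time. -/
def NxtDet (u : Site d) (K : ℕ) (C : Set (ℕ → Site d)) : Prop :=
  ∀ X X' : ℕ → Site d, X ∈ hasRegen u K → X' ∈ hasRegen u K → nxt u K X' = nxt u K X →
    (∀ i ≤ nxt u K X, X i = X' i) → X ∈ C → X' ∈ C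

theorem nxtDet_univ (u : Site d) (K : ℕ) : NxtDet u K Set.univ := fun _ _ _ _ _ _ _ => trivial

/-- After the regeneration the path stays above the regeneration level, so only the prefix can go
below `0`. -/
theorem nxtDet_stay (u : Site d) (K : ℕ) : NxtDet u K (stay u) := by
  intro X X' _ hX' he h hs m
  rcases le_total m (nxt u K X) with hm | hm
  · rw [← h m hm]; exact hs m
  · have h1 := (regenFrom_nxt hX').2.2.2.2 m (he ▸ hm)
    rw [he, ← h _ le_rfl] at h1
    exact (hs _).trans h1

theorem NxtDet.inter {u : Site d} {K : ℕ} {C C' : Set (ℕ → Site d)} (h : NxtDet u K C)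
    (h' : NxtDet u K C') : NxtDet u K (C ∩ C') :=
  fun X X' a b c e hX => ⟨h X X' a b c e hX.1, h' X X' a b c e hX.2⟩

theorem PrefixDet.nxtDet {u : Site d} {K : ℕ} {C : Set (ℕ → Site d)} (h : PrefixDet K C) :
    NxtDet u K C :=
  fun X X' a _ _ e hX => h X X' (fun i hi => e i (hi.trans (regenFrom_nxt a).1)) hX

theorem nxtDet_nxt_eq (u : Site d) (K j : ℕ) : NxtDet u K {X | nxt u K X = j} :=
  fun _ _ _ _ c _ hX => c.trans hX

/-- `F` looks at the environment only above level `0`, along paths that stay there. -/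
def RightSet (u : Site d) (F : Set (Env d × (ℕ → Site d))) : Prop :=
  (∀ q ∈ F, q.2 ∈ stay u) ∧ ∀ ω X, (keep (above u 0) ω, X) ∈ F ↔ (ω, X) ∈ F

theorem RightSet.quenchedLaw_keep {u : Site d} {F : Set (Env d × (ℕ → Site d))}
    (hF : RightSet u F) (hFm : MeasurableSet F) (ω : Env d) :
    quenchedLaw 0 (keep (above u 0) ω) (Prod.mk (keep (above u 0) ω) ⁻¹' F)
      = quenchedLaw 0 ω (Prod.mk ω ⁻¹' F) := by
  have e : Prod.mk (keep (above u 0) ω) ⁻¹' F = Prod.mk ω ⁻¹' F := by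
    ext X; exact hF.2 ω X
  rw [e]
  exact quenchedLaw_congr_of_stay (V := above u 0) (fun x hx => keep_of_mem hx ω) 0
    (measurable_prodMk_left hFm) fun X hX i => hF.1 _ hX i

theorem rightSet_stay (u : Site d) : RightSet u {q | q.2 ∈ stay u} :=
  ⟨fun _ h => h, fun _ _ => Iff.rfl⟩

/-- The renewal structure at the regeneration time `nxt u K`. -/
theorem jointLaw_nxt (ν : Measure (PMF (Site d))) [IsProbabilityMeasure ν] (u : Site d) (K : ℕ)
    {E : Set (Env d)} (hE : MeasurableSet[siteSigma (above u K)ᶜ] E) {C : Set (ℕ → Site d)}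
    (hC : NxtDet u K C) :
    ∃ c : ℝ≥0∞, ∀ F, MeasurableSet F → RightSet u F →
      jointLaw (iid ν) 0 {q | q.1 ∈ E ∧ q.2 ∈ C ∧ q.2 ∈ hasRegen u K ∧ theta (nxt u K q.2) q ∈ F}
        = c * jointLaw (iid ν) 0 F := by
  -- Prefixes that extend to some path of `C` regenerating first at `n`. A regeneration time depends
  -- on the future, but such a prefix followed by a path that stays above its endpoint already
  -- forces `nxt u K = n`; this converts the event into prefix times future.
  set A : ℕ → Set (ℕ → Site d) := fun n =>
    {X | ∃ X', X' ∈ hasRegen u K ∧ X' ∈ C ∧ nxt u K X' = n ∧ ∀ i ≤ n, X i = X' i} with hAdef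
  have hA : ∀ n, PrefixDet n (A n) := by
    rintro n X Y hXY ⟨X', h1, h2, h3, h4⟩
    exact ⟨X', h1, h2, h3, fun i hi => (hXY i hi).symm.trans (h4 i hi)⟩
  refine ⟨∑' n, jointLaw (iid ν) 0 {q | q.1 ∈ E ∧ q.2 ∈ A n}, fun F hFm hF => ?_⟩
  have hset : ∀ n, {q : Env d × (ℕ → Site d) | (q.1 ∈ E ∧ q.2 ∈ C ∧ q.2 ∈ hasRegen u K ∧
      theta (nxt u K q.2) q ∈ F) ∧ nxt u K q.2 = n} = {q | q.1 ∈ E ∧ q.2 ∈ A n ∧ theta n q ∈ F} := by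
    intro n
    ext ⟨ω, X⟩
    simp only [Set.mem_ofPred_eq]
    constructor
    · rintro ⟨⟨h1, h2, h3, h4⟩, rfl⟩
      exact ⟨h1, ⟨X, h3, h2, rfl, fun _ _ => rfl⟩, h4⟩
    · rintro ⟨h1, ⟨X', h2, h3, h4, h5⟩, h6⟩
      have hst := hF.1 _ h6
      have hfut : ∀ m ≥ n, X n ⬝ᵥ u ≤ X m ⬝ᵥ u := by
        intro m hm
        have := hst (m - n)
        simp only [theta, Nat.add_sub_cancel' hm, sub_dotProduct] at this
        linarith
      have hr' := regenFrom_nxt h2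
      rw [h4] at hr'
      have hr : RegenFrom u K X n := ⟨hr'.1, by rw [h5 n le_rfl]; exact hr'.2.1,
        isRegeneration_of_agree h5 hfut le_rfl hr'.2.2⟩
      have hh : X ∈ hasRegen u K := ⟨n, hr⟩
      have hn : nxt u K X = n := by
        -- An earlier candidate for `X` would be a candidate for the reference path `X'` too, since
        -- `X'` also stays above its level at `n`; this contradicts minimality there.
        refine le_antisymm (nxt_le hr) ?_
        by_contra hlt
        rw [not_le] at hlt
        have hs := regenFrom_nxt hh
        have : RegenFrom u K X' (nxt u K X) := ⟨hs.1, by rw [← h5 _ hlt.le]; exact hs.2.1,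
          isRegeneration_of_agree (fun i hi => (h5 i hi).symm) hr'.2.2.2.2 hlt.le hs.2.2⟩
        exact absurd (nxt_le this) (by omega)
      refine ⟨⟨h1, ?_, hh, hn ▸ h6⟩, hn⟩
      exact hC X' X h2 hh (hn.trans h4.symm) (fun i hi => (h5 i (h4 ▸ hi)).symm) h3
  have hnm : Measurable fun q : Env d × (ℕ → Site d) => nxt u K q.2 :=
    (measurable_nxt u K).comp measurable_snd
  have hD : {q : Env d × (ℕ → Site d) | q.1 ∈ E ∧ q.2 ∈ C ∧ q.2 ∈ hasRegen u K ∧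
      theta (nxt u K q.2) q ∈ F} = ⋃ n, {q | q.1 ∈ E ∧ q.2 ∈ A n ∧ theta n q ∈ F} := by
    simp_rw [← hset]
    ext q; simp
  have hmeas : ∀ n, MeasurableSet {q : Env d × (ℕ → Site d) | q.1 ∈ E ∧ q.2 ∈ A n ∧
      theta n q ∈ F} := fun n =>
    (measurable_fst (siteSigma_le _ _ hE)).inter
      ((measurable_snd (hA n).measurableSet).inter (measurable_theta n hFm))
  rw [hD, measure_iUnion _ hmeas, ← ENNReal.tsum_mul_right]
  · refine tsum_congr fun n => ?_
    refine jointLaw_renewal ν (ℓ := 0) (L := K) (hA n) ?_ hE hFm (hF.quenchedLaw_keep hFm)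
    rintro X ⟨X', h1, -, h3, h4⟩
    have hr' := regenFrom_nxt h1
    rw [h3] at hr'
    refine ⟨fun m hm => ?_, ?_⟩
    · rw [add_zero, h4 m hm.le, h4 n le_rfl]; exact hr'.2.2.2.1 m hm
    · rw [add_zero, h4 n le_rfl]; exact hr'.2.1
  · intro m n hmn
    simp only [Function.onFun, ← hset]
    refine Set.disjoint_left.2 fun q hq hq' => hmn (hq.2.symm.trans hq'.2)

/-! ### Iterated regenerations along a path -/

/-- The path seen from its first regeneration point. -/
noncomputable def regenPath (u : Site d) (X : ℕ → Site d) : ℕ → Site d :=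
  fun m => X (nxt u 1 X + m) - X (nxt u 1 X)

/-- The environment and the path seen from the first regeneration point. -/
noncomputable def regenShift (u : Site d) (q : Env d × (ℕ → Site d)) : Env d × (ℕ → Site d) :=
  theta (nxt u 1 q.2) q

/-- Forget the environment below level `ℓ`. -/
noncomputable def res (u : Site d) (ℓ : ℤ) (q : Env d × (ℕ → Site d)) : Env d × (ℕ → Site d) :=
  (keep (above u ℓ) q.1, q.2)

/-- The regeneration map on environments above level `0`. -/
noncomputable def regenMap (u : Site d) (q : Env d × (ℕ → Site d)) : Env d × (ℕ → Site d) :=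
  res u 0 (regenShift u q)

/-- The `i`-th regeneration time, with `τ_0 = 0`. -/
noncomputable def tau (u : Site d) (X : ℕ → Site d) (i : ℕ) : ℕ :=
  ∑ l ∈ range i, nxt u 1 ((regenPath u)^[l] X)

/-- Paths from the origin with infinitely many regenerations. -/
def Good (u : Site d) (X : ℕ → Site d) : Prop :=
  X 0 = 0 ∧ ∀ i, (regenPath u)^[i] X ∈ hasRegen u 1

theorem measure_congr_iff {α : Type*} [MeasurableSpace α] {μ : Measure α} {A B : Set α}
    (h : ∀ᵐ x ∂μ, x ∈ A ↔ x ∈ B) : μ A = μ B :=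
  measure_congr (eventuallyEq_set.2 h)

theorem res_res (u : Site d) {k l : ℤ} (h : l ≤ k) (q : Env d × (ℕ → Site d)) :
    res u k (res u l q) = res u k q :=
  Prod.ext (keep_keep (above_anti u h) q.1) rfl

theorem res_theta_res (u : Site d) {k l : ℤ} {n : ℕ} {q : Env d × (ℕ → Site d)}
    (h : l ≤ k + q.2 n ⬝ᵥ u) : res u k (theta n (res u l q)) = res u k (theta n q) := by
  refine Prod.ext (keep_congr fun x hx => ?_) rfl
  refine keep_of_mem ?_ q.1
  rw [mem_above] at hx ⊢
  simp only [res, add_dotProduct]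
  linarith

theorem measurable_res (u : Site d) (ℓ : ℤ) : Measurable (res u ℓ) :=
  ((measurable_keep _).comp measurable_fst).prodMk measurable_snd

theorem measurable_theta_of_measurable {f : Env d × (ℕ → Site d) → ℕ} (hf : Measurable f) :
    Measurable fun q => theta (f q) q := by
  have h : Measurable fun p : (Env d × (ℕ → Site d)) × ℕ => theta p.2 p.1 :=
    measurable_from_prod_countable_left fun n => measurable_theta n
  exact h.comp (measurable_id.prodMk hf)

theorem measurable_regenShift (u : Site d) : Measurable (regenShift u) :=
  measurable_theta_of_measurable ((measurable_nxt u 1).comp measurable_snd)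

theorem measurable_regenMap (u : Site d) : Measurable (regenMap u) :=
  (measurable_res u 0).comp (measurable_regenShift u)

theorem measurable_regenPath (u : Site d) : Measurable (regenPath u) := by
  have h : Measurable fun p : (ℕ → Site d) × ℕ => fun m => p.1 (p.2 + m) - p.1 p.2 := by
    refine measurable_from_prod_countable_left fun n => measurable_pi_lambda _ fun m => ?_
    exact (measurable_pi_apply (n + m)).sub (measurable_pi_apply n)
  exact h.comp (measurable_id.prodMk (measurable_nxt u 1))

theorem iterate_regenShift_snd (u : Site d) (i : ℕ) (q : Env d × (ℕ → Site d)) :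
    ((regenShift u)^[i] q).2 = (regenPath u)^[i] q.2 :=
  Function.Semiconj.iterate_right (f := Prod.snd) (ga := regenShift u) (gb := regenPath u)
    (fun _ => rfl) i q

theorem theta_zero {q : Env d × (ℕ → Site d)} (h : q.2 0 = 0) : theta 0 q = q := by
  refine Prod.ext ?_ ?_
  · simp [theta, h, shift_zero]
  · funext m; simp [theta, h]

theorem tau_zero (u : Site d) (X : ℕ → Site d) : tau u X 0 = 0 := rfl

theorem tau_succ (u : Site d) (X : ℕ → Site d) (i : ℕ) :
    tau u X (i + 1) = tau u X i + nxt u 1 ((regenPath u)^[i] X) := sum_range_succ _ _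

theorem iterate_regenShift (u : Site d) (i : ℕ) {q : Env d × (ℕ → Site d)} (h : q.2 0 = 0) :
    (regenShift u)^[i] q = theta (tau u q.2 i) q := by
  induction i with
  | zero => exact (theta_zero h).symm
  | succ i ih =>
    rw [Function.iterate_succ_apply', regenShift, iterate_regenShift_snd, ih, theta_theta, tau_succ]

theorem iterate_regenPath (u : Site d) (i : ℕ) {X : ℕ → Site d} (h : X 0 = 0) :
    (regenPath u)^[i] X = fun m => X (tau u X i + m) - X (tau u X i) := by
  have e := iterate_regenShift u i (q := ((fun _ => PMF.pure 0 : Env d), X)) h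
  have := iterate_regenShift_snd u i ((fun _ => PMF.pure 0 : Env d), X)
  rw [e] at this
  exact this.symm

section GoodPath

variable {u : Site d} {X : ℕ → Site d}

theorem one_le_nxt (h : X ∈ hasRegen u 1) : 1 ≤ nxt u 1 X := (regenFrom_nxt h).1

theorem Good.strictMono_tau (h : Good u X) : StrictMono (tau u X) :=
  strictMono_nat_of_lt_succ fun i => by
    rw [tau_succ]
    have := one_le_nxt (h.2 i)
    omega

theorem Good.regenPath_iterate (h : Good u X) (i : ℕ) : Good u ((regenPath u)^[i] X) := by
  refine ⟨?_, fun j => ?_⟩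
  · rw [iterate_regenPath u i h.1]; simp
  · rw [← Function.iterate_add_apply]; exact h.2 _

theorem Good.level_tau_succ (h : Good u X) (i : ℕ) :
    X (tau u X i) ⬝ᵥ u + 1 ≤ X (tau u X (i + 1)) ⬝ᵥ u := by
  have := (regenFrom_nxt (h.2 i)).2.1
  rw [iterate_regenPath u i h.1] at this
  rw [tau_succ, iterate_regenPath u i h.1]
  simp only [sub_dotProduct, Nat.cast_one] at this
  linarith

theorem Good.level_tau_add (h : Good u X) (i j : ℕ) :
    X (tau u X i) ⬝ᵥ u + j ≤ X (tau u X (i + j)) ⬝ᵥ u := by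
  induction j with
  | zero => simp
  | succ j ih =>
    have := h.level_tau_succ (i + j)
    rw [← add_assoc]
    push_cast
    linarith

theorem Good.le_level_tau (h : Good u X) (i : ℕ) : (i : ℤ) ≤ X (tau u X i) ⬝ᵥ u := by
  have := h.level_tau_add 0 i
  simpa [tau_zero, h.1] using this

theorem Good.isRegeneration_tau (h : Good u X) (i : ℕ) :
    IsRegeneration u X (tau u X (i + 1)) := by
  induction i with
  | zero =>
    have := (regenFrom_nxt (h.2 0)).2.2
    simpa [tau_succ, tau_zero] using this
  | succ i ih =>
    have h1 := (regenFrom_nxt (h.2 (i + 1))).2.2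
    have e := tau_succ u X (i + 1)
    set n := nxt u 1 ((regenPath u)^[i + 1] X)
    rw [iterate_regenPath u (i + 1) h.1] at h1
    rw [e]
    set t := tau u X (i + 1)
    have h2 : ∀ m < n, X (t + m) ⬝ᵥ u < X (t + n) ⬝ᵥ u := fun m hm => by
      have := h1.2.1 m hm
      simp only [sub_dotProduct] at this
      linarith
    refine ⟨by have := h1.1; omega, fun m hm => ?_, fun m hm => ?_⟩
    · rcases lt_or_ge m t with hmt | hmt
      · exact (ih.2.1 m hmt).trans (by simpa using h2 0 h1.1)
      · have := h2 (m - t) (by omega)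
        rwa [Nat.add_sub_cancel' hmt] at this
    · have := h1.2.2 (m - t) (by omega)
      simp only [sub_dotProduct, Nat.add_sub_cancel' (show t ≤ m by omega)] at this
      linarith

theorem exists_block {t : ℕ → ℕ} (ht : StrictMono t) (ht0 : t 0 = 0) (n : ℕ) :
    ∃ i, t i ≤ n ∧ n < t (i + 1) := by
  have hex : ∃ i, n < t i := ⟨n + 1, (Nat.lt_succ_self n).trans_le ht.le_apply⟩
  obtain ⟨i, hi⟩ : ∃ i, Nat.find hex = i + 1 := by
    refine Nat.exists_eq_succ_of_ne_zero fun h => ?_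
    have := Nat.find_spec hex
    rw [h, ht0] at this
    omega
  exact ⟨i, not_lt.1 (Nat.find_min hex (by omega)), hi ▸ Nat.find_spec hex⟩

/-- A regeneration strictly inside a block would be a regeneration of the recentred path before the
block's end. Hence the times `nxt u K` also occur among the iterated times `tau`. -/
theorem Good.exists_eq_tau (h : Good u X) {n : ℕ} (hn : IsRegeneration u X n) :
    ∃ i, n = tau u X i := by
  obtain ⟨i, h1, h2⟩ := exists_block h.strictMono_tau (tau_zero u X) n
  refine ⟨i, (eq_or_lt_of_le h1).elim Eq.symm fun hlt => ?_⟩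
  exfalso
  have hlev : X (tau u X i) ⬝ᵥ u < X n ⬝ᵥ u := hn.2.1 _ hlt
  have hr : RegenFrom u 1 ((regenPath u)^[i] X) (n - tau u X i) := by
    rw [iterate_regenPath u i h.1]
    refine ⟨by omega, ?_, by omega, fun m hm => ?_, fun m hm => ?_⟩ <;>
      simp only [sub_dotProduct, Nat.add_sub_cancel' h1, Nat.cast_one]
    · linarith
    · have := hn.2.1 (tau u X i + m) (by omega)
      linarith
    · have := hn.2.2 (tau u X i + m) (by omega)
      linarith
  have := nxt_le hr
  rw [tau_succ] at h2
  omega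

theorem Good.hasRegen (h : Good u X) (K : ℕ) : X ∈ hasRegen u K := by
  refine ⟨tau u X (K + 1), ?_, ?_, h.isRegeneration_tau K⟩
  · have := h.strictMono_tau.le_apply (x := K + 1); omega
  · have := h.le_level_tau (K + 1); push_cast at this; linarith

theorem Good.exists_nxt_eq_tau (h : Good u X) (K : ℕ) : ∃ j, nxt u K X = tau u X j :=
  h.exists_eq_tau (regenFrom_nxt (h.hasRegen K)).2.2

theorem Good.iterate_mem_stay (h : Good u X) (i : ℕ) :
    (regenPath u)^[i + 1] X ∈ stay u := by
  rw [iterate_regenPath u _ h.1]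
  intro m
  have := (h.isRegeneration_tau i).2.2 (tau u X (i + 1) + m) (by omega)
  simp only [sub_dotProduct]
  linarith

end GoodPath

/-- If the path stays above `0`, so does its regeneration point, and the half-space above that point
does not meet the forgotten sites. -/
theorem regenMap_res {u : Site d} {q : Env d × (ℕ → Site d)} (h : q.2 ∈ stay u) :
    regenMap u (res u 0 q) = regenMap u q :=
  res_theta_res u (by simpa using h _)

theorem iterate_regenMap_res {u : Site d} {q : Env d × (ℕ → Site d)} (h : q.2 ∈ stay u)
    (hg : Good u q.2) (i : ℕ) :
    (regenMap u)^[i] (res u 0 q) = res u 0 ((regenShift u)^[i] q) := by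
  induction i with
  | zero => rfl
  | succ i ih =>
    rw [Function.iterate_succ_apply', ih, Function.iterate_succ_apply', regenMap_res, regenMap]
    rw [iterate_regenShift_snd]
    cases i with
    | zero => exact h
    | succ i => exact hg.iterate_mem_stay i

theorem rightSet_res (u : Site d) (D : Set (Env d × (ℕ → Site d))) :
    RightSet u {q | q.2 ∈ stay u ∧ res u 0 q ∈ D} := by
  refine ⟨fun q hq => hq.1, fun ω X => ?_⟩
  have : res u 0 (keep (above u 0) ω, X) = res u 0 (ω, X) := res_res u le_rfl (ω, X)
  simp [this]

theorem measurableSet_stay_res (u : Site d) {D : Set (Env d × (ℕ → Site d))}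
    (hD : MeasurableSet D) : MeasurableSet {q : Env d × (ℕ → Site d) | q.2 ∈ stay u ∧ res u 0 q ∈ D} :=
  (measurable_snd (measurableSet_stay u)).inter (measurable_res u 0 hD)

theorem jointLaw_start (μ : Measure (Env d)) [IsProbabilityMeasure μ] (z : Site d) :
    ∀ᵐ q ∂(jointLaw μ z), q.2 0 = z := by
  have hm : MeasurableSet {q : Env d × (ℕ → Site d) | q.2 0 = z} :=
    measurableSet_eq_fun ((measurable_pi_apply 0).comp measurable_snd) measurable_const
  rw [ae_iff]
  change jointLaw μ z {q | q.2 0 = z}ᶜ = 0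
  rw [jointLaw_apply _ _ hm.compl, lintegral_eq_zero_iff (measurable_quenchedLaw_section z hm.compl)]
  exact ae_of_all _ fun ω => quenchedLaw_start z ω

/-! ### The regeneration map is measure preserving and ergodic -/

/-- The law of the environment and path seen from the first regeneration point, above its level. -/
noncomputable def regenLaw (ν : Measure (PMF (Site d))) (u : Site d) :
    Measure (Env d × (ℕ → Site d)) :=
  (jointLaw (iid ν) 0).map (regenMap u)

section System

variable {ν : Measure (PMF (Site d))} [IsProbabilityMeasure ν] {u : Site d}

instance : IsProbabilityMeasure (regenLaw ν u) :=
  Measure.isProbabilityMeasure_map (measurable_regenMap u).aemeasurable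

theorem theta_nxt_mem_stay {K : ℕ} {q : Env d × (ℕ → Site d)} (h : q.2 ∈ hasRegen u K) :
    (theta (nxt u K q.2) q).2 ∈ stay u := fun m => by
  have := (regenFrom_nxt h).2.2.2.2 (nxt u K q.2 + m) (by omega)
  simp only [theta, sub_dotProduct]
  linarith

/-- The probability of never backtracking. -/
noncomputable def stayProb (ν : Measure (PMF (Site d))) (u : Site d) : ℝ≥0∞ :=
  jointLaw (iid ν) 0 {q | q.2 ∈ stay u}

/-- The unknown constant of `jointLaw_nxt` is identified by taking the future event to be `stay u`,
which holds automatically at a regeneration. -/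
theorem jointLaw_nxt_mul {K : ℕ} (hreg : ∀ᵐ q ∂(jointLaw (iid ν) 0), q.2 ∈ hasRegen u K)
    {E : Set (Env d)} (hE : MeasurableSet[siteSigma (above u K)ᶜ] E) {C : Set (ℕ → Site d)}
    (hC : NxtDet u K C) {F : Set (Env d × (ℕ → Site d))} (hFm : MeasurableSet F)
    (hF : RightSet u F) :
    jointLaw (iid ν) 0 {q | q.1 ∈ E ∧ q.2 ∈ C ∧ theta (nxt u K q.2) q ∈ F} * stayProb ν u
      = jointLaw (iid ν) 0 {q | q.1 ∈ E ∧ q.2 ∈ C} * jointLaw (iid ν) 0 F := by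
  obtain ⟨c, hc⟩ := jointLaw_nxt ν u K hE hC
  have h1 := hc F hFm hF
  have h2 := hc {q | q.2 ∈ stay u} (measurable_snd (measurableSet_stay u)) (rightSet_stay u)
  have e1 : jointLaw (iid ν) 0 {q | q.1 ∈ E ∧ q.2 ∈ C ∧ theta (nxt u K q.2) q ∈ F}
      = c * jointLaw (iid ν) 0 F := by
    rw [← h1]
    refine measure_congr_iff ?_
    filter_upwards [hreg] with q hq
    simp [hq]
  have e2 : jointLaw (iid ν) 0 {q | q.1 ∈ E ∧ q.2 ∈ C} = c * stayProb ν u := by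
    rw [stayProb, ← h2]
    refine measure_congr_iff ?_
    filter_upwards [hreg] with q hq
    have := theta_nxt_mem_stay hq
    simp [hq, this]
  rw [e1, e2]
  ring

variable (hreg : ∀ᵐ q ∂(jointLaw (iid ν) 0), q.2 ∈ hasRegen u 1)
include hreg

/-- From a regeneration point the path never backtracks. Were this a null event for the fresh walk,
the renewal identity would make having a regeneration null as well. -/
theorem stayProb_ne_zero : stayProb ν u ≠ 0 := by
  obtain ⟨c, hc⟩ := jointLaw_nxt ν u 1 (E := Set.univ) .univ (nxtDet_univ u 1)
  have h := hc {q | q.2 ∈ stay u} (measurable_snd (measurableSet_stay u)) (rightSet_stay u)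
  intro h0
  rw [stayProb] at h0
  rw [h0, mul_zero] at h
  have h1 : jointLaw (iid ν) 0 Set.univ = 0 := by
    rw [← h]
    refine measure_congr_iff ?_
    filter_upwards [hreg] with q hq
    have := theta_nxt_mem_stay hq
    simp [hq, this]
  simp at h1

omit hreg in
theorem stayProb_ne_top : stayProb ν u ≠ ∞ := measure_ne_top _ _

theorem jointLaw_regenShift {F : Set (Env d × (ℕ → Site d))} (hFm : MeasurableSet F)
    (hF : RightSet u F) :
    jointLaw (iid ν) 0 {q | regenShift u q ∈ F} = (stayProb ν u)⁻¹ * jointLaw (iid ν) 0 F := by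
  have h := jointLaw_nxt_mul hreg (E := Set.univ) .univ (nxtDet_univ u 1) hFm hF
  simp only [Set.mem_univ, true_and, Set.ofPred_true, measure_univ, one_mul] at h
  rw [← h, mul_comm, mul_assoc, ENNReal.mul_inv_cancel (stayProb_ne_zero hreg) stayProb_ne_top,
    mul_one]
  rfl

theorem regenLaw_apply {D : Set (Env d × (ℕ → Site d))} (hD : MeasurableSet D) :
    regenLaw ν u D
      = (stayProb ν u)⁻¹ * jointLaw (iid ν) 0 {q | q.2 ∈ stay u ∧ res u 0 q ∈ D} := by
  rw [regenLaw, Measure.map_apply (measurable_regenMap u) hD,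
    ← jointLaw_regenShift hreg (measurableSet_stay_res u hD) (rightSet_res u D)]
  refine measure_congr_iff ?_
  filter_upwards [hreg] with q hq
  have := theta_nxt_mem_stay hq
  exact (and_iff_right this).symm

theorem ae_regenPath {N : Set (ℕ → Site d)} (hN : MeasurableSet N)
    (h : ∀ᵐ q ∂(jointLaw (iid ν) 0), q.2 ∈ N) :
    ∀ᵐ q ∂(jointLaw (iid ν) 0), regenPath u q.2 ∈ N := by
  have hF : RightSet u {q : Env d × (ℕ → Site d) | q.2 ∈ stay u ∧ q.2 ∈ Nᶜ} :=
    ⟨fun q hq => hq.1, fun ω X => Iff.rfl⟩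
  have hFm : MeasurableSet {q : Env d × (ℕ → Site d) | q.2 ∈ stay u ∧ q.2 ∈ Nᶜ} :=
    (measurable_snd (measurableSet_stay u)).inter (measurable_snd hN.compl)
  have h0 : jointLaw (iid ν) 0 {q : Env d × (ℕ → Site d) | q.2 ∈ stay u ∧ q.2 ∈ Nᶜ} = 0 :=
    measure_mono_null (fun q hq => hq.2) h
  have h1 := jointLaw_regenShift hreg hFm hF
  rw [h0, mul_zero] at h1
  have h2 : ∀ᵐ q ∂(jointLaw (iid ν) 0), ¬ (regenShift u q ∈
    {q : Env d × (ℕ → Site d) | q.2 ∈ stay u ∧ q.2 ∈ Nᶜ}) := measure_eq_zero_iff_ae_notMem.1 h1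
  filter_upwards [h2, hreg] with q hq hq'
  by_contra hc
  exact hq ⟨theta_nxt_mem_stay hq', hc⟩

/-- After recentring at a regeneration the law is the original one conditioned on `stay u`, so
almost sure path properties, such as having one more regeneration, are inherited inductively. -/
theorem ae_good : ∀ᵐ q ∂(jointLaw (iid ν) 0), Good u q.2 := by
  have h : ∀ i, ∀ᵐ q ∂(jointLaw (iid ν) 0), (regenPath u)^[i] q.2 ∈ hasRegen u 1 := by
    intro i
    induction i with
    | zero => exact hreg
    | succ i ih =>
      exact ae_regenPath hreg (N := (regenPath u)^[i] ⁻¹' hasRegen u 1)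
        ((measurable_regenPath u).iterate i (measurableSet_hasRegen u 1)) ih
  filter_upwards [jointLaw_start (iid ν) 0, ae_all_iff.2 h] with q h0 h1
  exact ⟨h0, h1⟩

omit [IsProbabilityMeasure ν] hreg in
theorem measurableSet_good : MeasurableSet {X | Good u X} := by
  have : {X | Good u X} = {X | X 0 = 0} ∩ ⋂ i, (regenPath u)^[i] ⁻¹' hasRegen u 1 := by
    ext X; simp [Good]
  rw [this]
  exact ((measurable_pi_apply 0) (measurableSet_singleton _)).inter
    (.iInter fun i => (measurable_regenPath u).iterate i (measurableSet_hasRegen u 1))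

theorem ae_regenLaw_good : ∀ᵐ q ∂(regenLaw ν u), Good u q.2 ∧ q.2 ∈ stay u := by
  have hm : MeasurableSet {q : Env d × (ℕ → Site d) | Good u q.2 ∧ q.2 ∈ stay u} :=
    (measurable_snd measurableSet_good).inter (measurable_snd (measurableSet_stay u))
  rw [regenLaw, ae_map_iff (measurable_regenMap u).aemeasurable hm]
  filter_upwards [ae_good hreg] with q hq
  exact ⟨hq.regenPath_iterate 1, hq.iterate_mem_stay 0⟩

/-- Renewal with the past event `stay u` shows that the conditioned walk, recentred at its next
regeneration, is again the conditioned walk; one factor `stayProb ν u` cancels. -/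
theorem measurePreserving_regenMap :
    MeasurePreserving (regenMap u) (regenLaw ν u) (regenLaw ν u) := by
  refine ⟨measurable_regenMap u, ?_⟩
  ext D hD
  rw [Measure.map_apply (measurable_regenMap u) hD,
    regenLaw_apply hreg (measurable_regenMap u hD), regenLaw_apply hreg hD]
  congr 1
  have h := jointLaw_nxt_mul hreg (E := Set.univ) .univ (nxtDet_stay u 1)
    (measurableSet_stay_res u hD) (rightSet_res u D)
  simp only [Set.mem_univ, true_and] at h
  change _ = stayProb ν u * _ at h
  rw [mul_comm] at h
  have h' := (ENNReal.mul_right_inj (stayProb_ne_zero hreg) stayProb_ne_top).1 h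
  rw [← h']
  refine measure_congr_iff ?_
  filter_upwards [hreg] with q hq
  have := theta_nxt_mem_stay hq
  refine and_congr_right fun hs => ?_
  change regenMap u (res u 0 q) ∈ D ↔ _ ∧ _
  rw [regenMap_res hs]
  exact (and_iff_right this).symm

/-- The events `E` and `C` are decided before the regeneration `nxt u K`, while an invariant `D` can
be read from the configuration seen at that time. Renewal then gives independence. -/
theorem regenLaw_inter_of_invariant {D : Set (Env d × (ℕ → Site d))} (hD : MeasurableSet D)
    (hinv : regenMap u ⁻¹' D = D) {K : ℕ} {E : Set (Env d)} (hEm : MeasurableSet E)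
    (hE : ∀ ω ω' : Env d, (∀ x, x ⬝ᵥ u < K → ω x = ω' x) → ω ∈ E → ω' ∈ E)
    {C : Set (ℕ → Site d)} (hC : PrefixDet K C) :
    regenLaw ν u (E ×ˢ C ∩ D) = regenLaw ν u (E ×ˢ C) * regenLaw ν u D := by
  have hCm := hC.measurableSet
  set E' : Set (Env d) := {ω | keep (above u 0) ω ∈ E} with hE'
  have hE'm : MeasurableSet[siteSigma (above u K)ᶜ] E' := by
    have key : ∀ ω, ∀ x, x ⬝ᵥ u < K →
        keep (above u 0) (keep (above u K)ᶜ ω) x = keep (above u 0) ω x := by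
      intro ω x hx
      have h1 : x ∈ (above u (K : ℤ))ᶜ := by simpa [mem_above] using hx
      by_cases h0 : x ∈ above u 0
      · rw [keep_of_mem h0, keep_of_mem h0, keep_of_mem h1]
      · rw [keep_of_notMem h0, keep_of_notMem h0]
    have hm := measurable_siteSigma_of_keep (S := (above u K)ᶜ) (f := fun ω => ω ∈ E')
      (measurableSet_setOfPred.1 (measurable_keep _ hEm)) fun ω =>
        propext ⟨hE _ _ (key ω), hE _ _ fun x hx => (key ω x hx).symm⟩
    have := hm (measurableSet_singleton True)
    convert this using 1
    ext ω
    simp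
  have hgood := ae_good hreg
  have hK : ∀ᵐ q ∂(jointLaw (iid ν) 0), q.2 ∈ hasRegen u K := hgood.mono fun q h => h.hasRegen K
  have h := jointLaw_nxt_mul hK hE'm (hC.nxtDet.inter (nxtDet_stay u K))
    (measurableSet_stay_res u hD) (rightSet_res u D)
  have hb0 := stayProb_ne_zero hreg
  have hbt := stayProb_ne_top (ν := ν) (u := u)
  rw [regenLaw_apply hreg ((hEm.prod hCm).inter hD), regenLaw_apply hreg (hEm.prod hCm),
    regenLaw_apply hreg hD]
  have e1 : jointLaw (iid ν) 0 {q | q.2 ∈ stay u ∧ res u 0 q ∈ E ×ˢ C}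
      = jointLaw (iid ν) 0 {q | q.1 ∈ E' ∧ q.2 ∈ C ∩ stay u} := by
    congr 1
    ext q
    simp only [res, hE', Set.mem_ofPred_eq, Set.mem_prod, Set.mem_inter_iff]
    tauto
  have e2 : jointLaw (iid ν) 0 {q | q.2 ∈ stay u ∧ res u 0 q ∈ E ×ˢ C ∩ D}
      = jointLaw (iid ν) 0 {q | q.1 ∈ E' ∧ q.2 ∈ C ∩ stay u ∧
          theta (nxt u K q.2) q ∈ {q | q.2 ∈ stay u ∧ res u 0 q ∈ D}} := by
    refine measure_congr_iff ?_
    filter_upwards [hgood] with q hq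
    obtain ⟨j, hj⟩ := hq.exists_nxt_eq_tau K
    have hst := theta_nxt_mem_stay (hq.hasRegen K)
    change (q.2 ∈ stay u ∧ (keep (above u 0) q.1 ∈ E ∧ q.2 ∈ C) ∧ res u 0 q ∈ D) ↔
      (keep (above u 0) q.1 ∈ E ∧ (q.2 ∈ C ∧ q.2 ∈ stay u) ∧ _ ∧
        res u 0 (theta (nxt u K q.2) q) ∈ D)
    -- The time `nxt u K` is some `tau j`, so passing to it is the `j`-th iterate of `regenMap`,
    -- which preserves membership in `D`.
    have key : q.2 ∈ stay u → (res u 0 q ∈ D ↔ res u 0 (theta (nxt u K q.2) q) ∈ D) := by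
      intro hs
      rw [hj, ← iterate_regenShift u j hq.1, ← iterate_regenMap_res hs hq]
      have : ((regenMap u)^[j]) ⁻¹' D = D := by
        clear hj
        induction j with
        | zero => rfl
        | succ j ih => rw [Function.iterate_succ', Set.preimage_comp, hinv, ih]
      conv_lhs => rw [← this]
      rfl
    constructor
    · rintro ⟨a, ⟨b, c⟩, e⟩
      exact ⟨b, ⟨c, a⟩, hst, (key a).1 e⟩
    · rintro ⟨b, ⟨c, a⟩, -, e⟩
      exact ⟨a, ⟨b, c⟩, (key a).2 e⟩
  rw [e1, e2]
  calc _ = (stayProb ν u)⁻¹ * ((stayProb ν u)⁻¹ * (_ * stayProb ν u)) := by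
        rw [mul_comm _ (stayProb ν u), ← mul_assoc (stayProb ν u)⁻¹ (stayProb ν u),
          ENNReal.inv_mul_cancel hb0 hbt, one_mul]
    _ = _ := by rw [h]; ring

/-- An invariant event is independent of all products of cylinders, a generating π-system, hence of
itself, and its probability is `0` or `1`. -/
theorem ergodic_regenMap : Ergodic (regenMap u) (regenLaw ν u) := by
  refine { measurePreserving_regenMap hreg with aeconst_set := fun D hD hinv => ?_ }
  have key : (regenLaw ν u).restrict D = regenLaw ν u D • regenLaw ν u := by
    refine ext_of_generate_finite (Set.image2 (· ×ˢ ·)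
      (measurableCylinders fun _ : Site d => PMF (Site d))
      (measurableCylinders fun _ : ℕ => Site d)) ?_ ?_ ?_ ?_
    · exact (generateFrom_eq_prod generateFrom_measurableCylinders generateFrom_measurableCylinders
        ⟨fun _ => Set.univ, fun _ => univ_mem_measurableCylinders _, Set.iUnion_const _⟩
        ⟨fun _ => Set.univ, fun _ => univ_mem_measurableCylinders _, Set.iUnion_const _⟩).symm
    · exact isPiSystem_measurableCylinders.prod isPiSystem_measurableCylinders
    · rintro _ ⟨E, hE, C, hC, rfl⟩
      obtain ⟨s, S, hS, rfl⟩ := (mem_measurableCylinders _).1 hE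
      obtain ⟨N, S', hS', rfl⟩ : ∃ N S, MeasurableSet S ∧
          C = cylinder (α := fun _ : ℕ => Site d) (Iic N) S := by
        simpa [measurableCylinders_nat] using hC
      -- Chosen beyond the time horizon of the path cylinder and above all levels of the environment
      -- cylinder.
      obtain ⟨K, hK⟩ : ∃ K : ℕ, N ≤ K ∧ ∀ x ∈ s, x ⬝ᵥ u < K := by
        refine ⟨max N (∑ x ∈ s, (x ⬝ᵥ u).natAbs + 1), le_max_left _ _, fun x hx => ?_⟩
        have h1 : (x ⬝ᵥ u).natAbs ≤ ∑ x ∈ s, (x ⬝ᵥ u).natAbs :=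
          single_le_sum (f := fun x : Site d => (x ⬝ᵥ u).natAbs) (fun _ _ => Nat.zero_le _) hx
        have h2 : (∑ x ∈ s, (x ⬝ᵥ u).natAbs + 1) ≤ max N (∑ x ∈ s, (x ⬝ᵥ u).natAbs + 1) :=
          le_max_right _ _
        omega
      rw [Measure.restrict_apply ((hS.cylinder _).prod (hS'.cylinder _)), Measure.smul_apply,
        smul_eq_mul, mul_comm]
      refine regenLaw_inter_of_invariant hreg hD hinv (hS.cylinder _) (K := K) ?_ ?_
      · intro ω ω' h hω
        have : s.restrict ω' = s.restrict ω := by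
          ext1 ⟨x, hx⟩; exact (h x (hK.2 x hx)).symm
        simpa [mem_cylinder, this] using hω
      · intro X X' h hX
        have : (Iic N).restrict X' = (Iic N).restrict X := by
          ext1 ⟨i, hi⟩; exact (h i ((mem_Iic.1 hi).trans hK.1)).symm
        simpa [mem_cylinder, this] using hX
    · simp
  have h2 := congrArg (fun m => m D) key
  simp only [Measure.restrict_apply hD, Set.inter_self, Measure.smul_apply, smul_eq_mul] at h2
  rw [eventuallyConst_set']
  by_cases h0 : regenLaw ν u D = 0
  · exact Or.inl (ae_eq_empty.2 h0)
  · right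
    have h3 : regenLaw ν u D = 1 := by
      have := (ENNReal.mul_right_inj h0 (measure_ne_top _ _)).1 (h2.symm.trans (mul_one _).symm)
      exact this
    exact eventuallyEq_univ.2 ((prob_compl_eq_zero_iff hD).2 h3)

end System

/-! ### The ergodic theorem along the walk -/

theorem tendsto_average_of_shift {z : ℕ → ℝ} {L : ℝ} (r : ℕ)
    (h : Tendsto (fun n : ℕ => (n : ℝ)⁻¹ * ∑ i ∈ range n, z (i + r)) atTop (𝓝 L)) :
    Tendsto (fun n : ℕ => (n : ℝ)⁻¹ * ∑ i ∈ range n, z i) atTop (𝓝 L) := by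
  rw [← tendsto_add_atTop_iff_nat r]
  have h1 : Tendsto (fun n : ℕ => ((n + r : ℕ) : ℝ)⁻¹) atTop (𝓝 0) :=
    tendsto_inv_atTop_nhds_zero_nat.comp (tendsto_add_atTop_nat r)
  have h2 : Tendsto (fun n : ℕ => ((n + r : ℕ) : ℝ)⁻¹ * n) atTop (𝓝 1) := by
    have := (h1.mul_const (r : ℝ)).const_sub 1
    rw [zero_mul, sub_zero] at this
    refine this.congr' ?_
    filter_upwards [eventually_gt_atTop 0] with n hn
    have : ((n + r : ℕ) : ℝ) ≠ 0 := by positivity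
    field_simp
    push_cast
    ring
  have h3 := (h1.mul_const (∑ i ∈ range r, z i)).add (h2.mul h)
  rw [zero_mul, zero_add, one_mul] at h3
  refine h3.congr' ?_
  filter_upwards [eventually_gt_atTop 0] with n hn
  have hn' : (n : ℝ) ≠ 0 := by positivity
  rw [add_comm n r, sum_range_add]
  simp_rw [add_comm r]
  field_simp

theorem iterate_regenMap_snd (u : Site d) (i : ℕ) (q : Env d × (ℕ → Site d)) :
    ((regenMap u)^[i] q).2 = (regenPath u)^[i] q.2 :=
  Function.Semiconj.iterate_right (f := Prod.snd) (ga := regenMap u) (gb := regenPath u)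
    (fun _ => rfl) i q

/-- The expected length of a regeneration block. -/
noncomputable def meanLen (ν : Measure (PMF (Site d))) (u : Site d) : ℝ≥0∞ :=
  ∫⁻ q, (nxt u 1 q.2 : ℝ≥0∞) ∂(regenLaw ν u)

/-- The law of the environment and path seen from a uniformly chosen time of the `k`-th
regeneration block. -/
noncomputable def blockLaw (ν : Measure (PMF (Site d))) (u : Site d) (k : ℕ) :
    Measure (Env d × (ℕ → Site d)) :=
  (meanLen ν u)⁻¹ • Measure.sum fun m =>
    ((regenLaw ν u).restrict {q | m < nxt u 1 ((regenShift u)^[k] q).2}).map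
      fun q => theta m ((regenShift u)^[k] q)

theorem measurable_nxt_iterate (u : Site d) (k : ℕ) :
    Measurable fun q : Env d × (ℕ → Site d) => nxt u 1 ((regenShift u)^[k] q).2 :=
  (measurable_nxt u 1).comp (measurable_snd.comp ((measurable_regenShift u).iterate k))

/-- Exchanging sum and integral turns the mixture over times of a block into the expected sum over
that block, the quantity to which Birkhoff's theorem applies. -/
theorem lintegral_blockLaw (ν : Measure (PMF (Site d))) (u : Site d) (k : ℕ)
    {f : Env d × (ℕ → Site d) → ℝ≥0∞} (hf : Measurable f) :
    ∫⁻ q, f q ∂(blockLaw ν u k) = (meanLen ν u)⁻¹ *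
      ∫⁻ q, ∑ m ∈ range (nxt u 1 ((regenShift u)^[k] q).2),
        f (theta m ((regenShift u)^[k] q)) ∂(regenLaw ν u) := by
  have hm : ∀ m, Measurable fun q : Env d × (ℕ → Site d) => theta m ((regenShift u)^[k] q) :=
    fun m => (measurable_theta m).comp ((measurable_regenShift u).iterate k)
  have hs : ∀ m, MeasurableSet {q : Env d × (ℕ → Site d) |
      m < nxt u 1 ((regenShift u)^[k] q).2} := fun m =>
    measurableSet_lt measurable_const (measurable_nxt_iterate u k)
  rw [blockLaw, lintegral_smul_measure, lintegral_sum_measure, smul_eq_mul]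
  congr 1
  simp_rw [fun m => lintegral_map (μ := (regenLaw ν u).restrict
    {q | m < nxt u 1 ((regenShift u)^[k] q).2}) hf (hm m)]
  simp_rw [fun m => (lintegral_indicator (μ := regenLaw ν u) (hs m)
    (fun q => f (theta m ((regenShift u)^[k] q)))).symm]
  have hf' : ∀ m, Measurable fun q => f (theta m ((regenShift u)^[k] q)) := fun m => hf.comp (hm m)
  rw [← lintegral_tsum fun m => ((hf' m).indicator (hs m)).aemeasurable]
  refine lintegral_congr fun q => ?_
  rw [tsum_eq_sum (s := range (nxt u 1 ((regenShift u)^[k] q).2))]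
  · refine sum_congr rfl fun m hm => ?_
    rw [Set.indicator_of_mem (by simpa using hm)]
  · intro m hm
    rw [Set.indicator_of_notMem (by simpa using hm)]

section System

variable {ν : Measure (PMF (Site d))} [IsProbabilityMeasure ν] {u : Site d}
  (hreg : ∀ᵐ q ∂(jointLaw (iid ν) 0), q.2 ∈ hasRegen u 1)
include hreg

theorem lintegral_path_iterate {g : (ℕ → Site d) → ℝ≥0∞} (hg : Measurable g) (k : ℕ) :
    ∫⁻ q, g ((regenPath u)^[k] q.2) ∂(regenLaw ν u) = ∫⁻ q, g q.2 ∂(regenLaw ν u) := by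
  rw [← ((measurePreserving_regenMap hreg).iterate k).lintegral_comp (f := fun q => g q.2)
    (hg.comp measurable_snd)]
  simp_rw [iterate_regenMap_snd]

theorem one_le_meanLen : 1 ≤ meanLen ν u := by
  rw [meanLen, ← measure_univ (μ := regenLaw ν u), ← lintegral_one]
  refine lintegral_mono_ae ?_
  filter_upwards [ae_regenLaw_good hreg] with q hq
  exact_mod_cast one_le_nxt (hq.1.2 0)

theorem isProbabilityMeasure_blockLaw (hlen : meanLen ν u ≠ ∞) (k : ℕ) :
    IsProbabilityMeasure (blockLaw ν u k) := by
  constructor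
  rw [← lintegral_one, lintegral_blockLaw ν u k measurable_const]
  simp only [sum_const, card_range, nsmul_eq_mul, mul_one, iterate_regenShift_snd]
  rw [lintegral_path_iterate hreg (g := fun X => (nxt u 1 X : ℝ≥0∞))
    ((measurable_of_countable _).comp (measurable_nxt u 1)), ← meanLen]
  refine ENNReal.inv_mul_cancel ?_ hlen
  exact (zero_lt_one.trans_le (one_le_meanLen hreg)).ne'

/-- Birkhoff's theorem gives the mean of the sum over a block and the mean block length; their ratio
is the time average. The `k`-th block is used because an observable looking `k` levels down from it
still sees only sites above level `0`. -/
theorem tendsto_average_blockLaw_of_nonneg (hlen : meanLen ν u ≠ ∞)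
    {Φ : Env d × (ℕ → Site d) → ℝ} (hΦ : Measurable Φ) (h0 : ∀ q, 0 ≤ Φ q) {b : ℝ}
    (hb : ∀ q, Φ q ≤ b) {k : ℕ} (hk : ∀ q, Φ (res u (-(k : ℤ)) q) = Φ q) :
    ∀ᵐ q ∂(jointLaw (iid ν) 0), Tendsto (fun n : ℕ => (n : ℝ)⁻¹ * ∑ j ∈ range n, Φ (theta j q))
      atTop (𝓝 (∫ q, Φ q ∂(blockLaw ν u k))) := by
  set Z : Env d × (ℕ → Site d) → ℝ := fun q => ∑ m ∈ range (nxt u 1 q.2), Φ (theta m q) with hZ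
  set S := regenShift u with hS
  have hSm : Measurable S := measurable_regenShift u
  have hZm : Measurable Z := by
    have : Measurable fun p : (Env d × (ℕ → Site d)) × ℕ =>
        ∑ m ∈ range p.2, Φ (theta m p.1) :=
      measurable_from_prod_countable_left fun n =>
        Finset.measurable_sum (range n) fun m _ => (show Measurable fun q => Φ (theta m q) from
          hΦ.comp (measurable_theta m))
    exact this.comp (measurable_id.prodMk ((measurable_nxt u 1).comp measurable_snd))
  have hZ0 : ∀ q, 0 ≤ Z q := fun q => sum_nonneg fun m _ => h0 _
  have hZb : ∀ q, Z q ≤ b * nxt u 1 q.2 := fun q => by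
    refine (sum_le_sum fun m _ => hb _).trans ?_
    simp [mul_comm]
  have hlenm : Measurable fun q : Env d × (ℕ → Site d) => (nxt u 1 q.2 : ℝ) :=
    (measurable_of_countable _).comp ((measurable_nxt u 1).comp measurable_snd)
  have hlenI : Integrable (fun q : Env d × (ℕ → Site d) => (nxt u 1 q.2 : ℝ)) (regenLaw ν u) := by
    refine ⟨hlenm.aestronglyMeasurable, ?_⟩
    rw [hasFiniteIntegral_iff_ofReal (ae_of_all _ fun q => Nat.cast_nonneg _)]
    simp only [ENNReal.ofReal_natCast]
    exact hlen.lt_top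
  have hlenE : ∫ q, (nxt u 1 q.2 : ℝ) ∂(regenLaw ν u) = (meanLen ν u).toReal := by
    rw [integral_eq_lintegral_of_nonneg_ae (ae_of_all _ fun q => Nat.cast_nonneg _)
      hlenm.aestronglyMeasurable]
    simp only [ENNReal.ofReal_natCast]
    rfl
  set Y : Env d × (ℕ → Site d) → ℝ := fun q => Z (S^[k] q) with hY
  have hYm : Measurable Y := hZm.comp (hSm.iterate k)
  have hYI : Integrable Y (regenLaw ν u) := by
    have h1 : Integrable (fun q : Env d × (ℕ → Site d) => b * (nxt u 1 (S^[k] q).2 : ℝ))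
        (regenLaw ν u) := by
      have := (((measurePreserving_regenMap hreg).iterate k).integrable_comp_of_integrable
        hlenI).const_mul b
      refine this.congr (ae_of_all _ fun q => ?_)
      simp only [Function.comp, iterate_regenMap_snd, hS, iterate_regenShift_snd]
    refine h1.mono hYm.aestronglyMeasurable (ae_of_all _ fun q => ?_)
    rw [Real.norm_of_nonneg (hZ0 _), Real.norm_of_nonneg ((hZ0 _).trans (hZb _))]
    exact hZb _
  have hint : ∫ q, Φ q ∂(blockLaw ν u k)
      = (∫ q, Y q ∂(regenLaw ν u)) / (meanLen ν u).toReal := by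
    rw [integral_eq_lintegral_of_nonneg_ae (ae_of_all _ h0) hΦ.aestronglyMeasurable,
      integral_eq_lintegral_of_nonneg_ae (ae_of_all _ fun q => hZ0 _) hYm.aestronglyMeasurable,
      lintegral_blockLaw ν u k hΦ.ennreal_ofReal, ENNReal.toReal_mul, ENNReal.toReal_inv,
      div_eq_inv_mul]
    congr 3
    funext q
    simp only [hZ]
    rw [ENNReal.ofReal_sum_of_nonneg fun m _ => h0 _]
  have hE : 0 < (meanLen ν u).toReal :=
    ENNReal.toReal_pos (zero_lt_one.trans_le (one_le_meanLen hreg)).ne' hlen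
  have hB1 := ae_of_ae_map (measurable_regenMap u).aemeasurable
    (tendsto_average_of_ergodic (μ := regenLaw ν u) (ergodic_regenMap hreg) hYm hYI)
  have hB2 := ae_of_ae_map (measurable_regenMap u).aemeasurable
    (tendsto_average_of_ergodic (μ := regenLaw ν u) (ergodic_regenMap hreg) hlenm hlenI)
  filter_upwards [hB1, hB2, ae_good hreg] with q hq1 hq2 hg
  -- In the `k`-th block the level is at least `k`: by `stay u` if `k = 0`, and because each earlier
  -- block gains a level otherwise. Forgetting the environment below `0` therefore does not change
  -- the block sum.
  have hloc : ∀ q' : Env d × (ℕ → Site d), Good u q'.2 → q'.2 ∈ stay u →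
      Y (res u 0 q') = Y q' := by
    intro q' hg' hs'
    simp only [hY, hZ, hS]
    rw [iterate_regenShift_snd, iterate_regenShift_snd]
    change ∑ m ∈ range (nxt u 1 ((regenPath u)^[k] q'.2)), _ = _
    refine sum_congr rfl fun m _ => ?_
    rw [iterate_regenShift u k (q := res u 0 q') hg'.1, iterate_regenShift u k hg'.1,
      theta_theta, theta_theta]
    change Φ (theta (tau u q'.2 k + m) (res u 0 q')) = _
    rw [← hk (theta _ (res u 0 q')), res_theta_res, hk]
    have : (k : ℤ) ≤ q'.2 (tau u q'.2 k + m) ⬝ᵥ u := by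
      cases k with
      | zero => simpa using hs' _
      | succ k =>
        exact (hg'.le_level_tau (k + 1)).trans ((hg'.isRegeneration_tau k).2.2 _ (by omega))
    linarith
  -- The offset is `k` from the definition of `Y` plus `1` from pulling `regenLaw` back to the joint
  -- law. Dropping finitely many blocks does not affect the averages.
  have hqY : ∀ i, Y ((regenMap u)^[i] (regenMap u q)) = Z (S^[i + (k + 1)] q) := by
    intro i
    have hg1 : Good u (S q).2 := hg.regenPath_iterate 1
    have hs1 : (S q).2 ∈ stay u := hg.iterate_mem_stay 0
    have h1 : (regenMap u)^[i] (regenMap u q) = res u 0 (S^[i] (S q)) :=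
      iterate_regenMap_res hs1 hg1 i
    rw [h1, hloc]
    · simp only [hY]
      rw [← Function.iterate_succ_apply, ← Function.iterate_add_apply]
      congr 2
      omega
    · rw [iterate_regenShift_snd]; exact hg1.regenPath_iterate i
    · rw [iterate_regenShift_snd]; exact hg.iterate_mem_stay i
  have hsum : ∀ n, ∑ j ∈ range (tau u q.2 n), Φ (theta j q) = ∑ i ∈ range n, Z (S^[i] q) := by
    intro n
    induction n with
    | zero => simp [tau_zero]
    | succ n ih =>
      rw [tau_succ, sum_range_add, sum_range_succ, ih]
      congr 1
      simp only [hZ, hS]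
      rw [iterate_regenShift_snd, iterate_regenShift u n hg.1]
      simp_rw [theta_theta]
  rw [hint]
  refine tendsto_average_of_blocks (b := b) (fun j => ?_) hg.strictMono_tau (tau_zero u q.2) hE ?_ ?_
  · rw [abs_of_nonneg (h0 _)]; exact hb _
  · rw [← hlenE]
    have e : ∀ n, (tau u q.2 n : ℝ) = ∑ i ∈ range n, (nxt u 1 ((regenPath u)^[i] q.2) : ℝ) := by
      intro n; simp [tau]
    simp_rw [e]
    refine tendsto_average_of_shift 1 ?_
    refine hq2.congr fun n => ?_
    simp only [birkhoffSum, iterate_regenMap_snd]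
    rfl
  · simp_rw [hsum]
    refine tendsto_average_of_shift (k + 1) ?_
    refine hq1.congr fun n => ?_
    simp only [birkhoffSum, hqY]

/-- The ergodic theorem for bounded functions of the path and of the environment above level `-k`,
as seen from the walker. -/
theorem tendsto_average_blockLaw (hlen : meanLen ν u ≠ ∞)
    {Φ : Env d × (ℕ → Site d) → ℝ} (hΦ : Measurable Φ) {b : ℝ}
    (hb : ∀ q, |Φ q| ≤ b) {k : ℕ} (hk : ∀ q, Φ (res u (-(k : ℤ)) q) = Φ q) :
    ∀ᵐ q ∂(jointLaw (iid ν) 0), Tendsto (fun n : ℕ => (n : ℝ)⁻¹ * ∑ j ∈ range n, Φ (theta j q))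
      atTop (𝓝 (∫ q, Φ q ∂(blockLaw ν u k))) := by
  have := isProbabilityMeasure_blockLaw hreg hlen k
  have hI : Integrable Φ (blockLaw ν u k) :=
    Integrable.of_bound hΦ.aestronglyMeasurable b (ae_of_all _ hb)
  filter_upwards [tendsto_average_blockLaw_of_nonneg hreg hlen (Φ := fun q => Φ q + b)
    (hΦ.add measurable_const) (fun q => by linarith [neg_le_of_abs_le (hb q)]) (b := b + b)
    (fun q => by linarith [le_of_abs_le (hb q)]) (k := k) (fun q => by rw [hk])] with q hq
  rw [integral_add hI (integrable_const _)] at hq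
  simp only [integral_const, probReal_univ, smul_eq_mul, one_mul] at hq
  have h2 := hq.sub_const b
  rw [add_sub_cancel_right] at h2
  refine h2.congr' ?_
  filter_upwards [eventually_gt_atTop 0] with n hn
  have : (n : ℝ) ≠ 0 := by positivity
  rw [sum_add_distrib]
  simp only [sum_const, card_range, nsmul_eq_mul]
  field_simp
  ring

end System

/-! ### Construction of the limit law by extension -/

/-- Kolmogorov's extension theorem for sequences with values in a standard Borel space. -/
theorem exists_measure_map_frestrictLe {α : Type*} [MeasurableSpace α] [StandardBorelSpace α]
    [Nonempty α] (μ : (n : ℕ) → Measure (Π _ : Iic n, α)) [∀ n, IsProbabilityMeasure (μ n)]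
    (h : ∀ n, (μ (n + 1)).map (Preorder.frestrictLe₂ (π := fun _ : ℕ => α) (Nat.le_succ n)) = μ n) :
    ∃ m : Measure (ℕ → α), IsProbabilityMeasure m ∧
      ∀ n, m.map (Preorder.frestrictLe (π := fun _ : ℕ => α) n) = μ n := by
  have hr : ∀ n, Measurable (Preorder.frestrictLe₂ (π := fun _ : ℕ => α) (Nat.le_succ n)) :=
    fun n => Preorder.measurable_frestrictLe₂ _
  let pr : (n : ℕ) → (Π _ : Iic (n + 1), α) → (Π _ : Iic n, α) × α := fun n x =>
    (Preorder.frestrictLe₂ (π := fun _ : ℕ => α) (Nat.le_succ n) x, x ⟨n + 1, mem_Iic.2 le_rfl⟩)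
  have hpr : ∀ n, Measurable (pr n) := fun n => (hr n).prodMk (measurable_pi_apply _)
  let ρ : (n : ℕ) → Measure ((Π _ : Iic n, α) × α) := fun n => (μ (n + 1)).map (pr n)
  have hρ : ∀ n, IsProbabilityMeasure (ρ n) := fun n =>
    Measure.isProbabilityMeasure_map (hpr n).aemeasurable
  -- Disintegrating each marginal over the previous one gives transition kernels; the trajectory
  -- measure they generate has the prescribed marginals.
  let κ : (n : ℕ) → Kernel (Π _ : Iic n, α) α := fun n => (ρ n).condKernel
  have hdis : ∀ n, μ n ⊗ₘ κ n = ρ n := by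
    intro n
    have : (ρ n).fst = μ n := by
      rw [← h n, Measure.fst, Measure.map_map measurable_fst (hpr n)]
      rfl
    rw [← this]
    exact (ρ n).disintegrate _
  have key : ∀ n, Kernel.partialTraj (X := fun _ => α) κ 0 n ∘ₘ μ 0 = μ n := by
    intro n
    induction n with
    | zero => rw [Kernel.partialTraj_self, Measure.id_comp]
    | succ n ih =>
      have he := (MeasurableEquiv.piSingleton (X := fun _ => α) n).measurable
      have hI : Measurable (IicProdIoc (X := fun _ => α) n (n + 1)) := measurable_IicProdIoc
      rw [Kernel.partialTraj_succ_eq_comp (Nat.zero_le n), ← Measure.comp_assoc, ih,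
        Kernel.partialTraj_succ_self, ← Measure.map_comp _ _ hI, ← Measure.compProd_eq_comp_prod,
        Measure.compProd_map he, hdis, Measure.map_map hI (measurable_id.prodMap he),
        Measure.map_map (hI.comp (measurable_id.prodMap he)) (hpr n)]
      convert Measure.map_id
      ext x ⟨i, hi⟩
      have hi' := mem_Iic.1 hi
      by_cases hin : i ≤ n
      · simp [IicProdIoc, hin, pr]
      · obtain rfl : i = n + 1 := by omega
        simp [IicProdIoc, MeasurableEquiv.piSingleton, pr]
  refine ⟨Kernel.traj (X := fun _ => α) κ 0 ∘ₘ μ 0, inferInstance, fun n => ?_⟩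
  rw [Measure.map_comp _ _ (Preorder.measurable_frestrictLe n), Kernel.traj_map_frestrictLe, key]

instance : Nonempty (PMF (Site d)) := ⟨PMF.pure 0⟩

/-- Environment laws that are consistent on half-spaces extend to a law on all environments. -/
theorem exists_measure_map_keep (u : Site d) (m : ℕ → Measure (Env d))
    [∀ k, IsProbabilityMeasure (m k)]
    (h : ∀ k : ℕ, (m (k + 1)).map (keep (above u (-(k : ℤ))))
      = (m k).map (keep (above u (-(k : ℤ))))) :
    ∃ Q : Measure (Env d), IsProbabilityMeasure Q ∧ ∀ k : ℕ,
      Q.map (keep (above u (-(k : ℤ)))) = (m k).map (keep (above u (-(k : ℤ)))) := by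
  let G : (n : ℕ) → Env d → (Π _ : Iic n, Env d) := fun n ω i => keep (above u (-((i : ℕ) : ℤ))) ω
  have hG : ∀ n, Measurable (G n) := fun n => measurable_pi_lambda _ fun i => measurable_keep _
  have hev : ∀ (k : ℕ) (i : Iic k), Measurable fun p : (Π _ : Iic k, Env d) => p i :=
    fun _ i => measurable_pi_apply i
  have hGk : ∀ n ω, G n (keep (above u (-(n : ℤ))) ω) = G n ω := by
    intro n ω
    funext i
    have := mem_Iic.1 i.2
    exact keep_keep (above_anti u (by omega)) ω
  have : ∀ n, IsProbabilityMeasure ((m n).map (G n)) := fun n =>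
    Measure.isProbabilityMeasure_map (hG n).aemeasurable
  obtain ⟨M, hM, hMn⟩ := exists_measure_map_frestrictLe (fun n => (m n).map (G n)) (fun n => by
    have e : Preorder.frestrictLe₂ (π := fun _ : ℕ => Env d) (Nat.le_succ n) ∘ G (n + 1)
        = G n ∘ keep (above u (-(n : ℤ))) := by
      funext ω
      rw [Function.comp_apply, Function.comp_apply, hGk]
      rfl
    have hr : Measurable (Preorder.frestrictLe₂ (π := fun _ : ℕ => Env d) (Nat.le_succ n)) :=
      Preorder.measurable_frestrictLe₂ _
    rw [Measure.map_map hr (hG _), e,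
      ← Measure.map_map (hG n) (measurable_keep _), h n,
      Measure.map_map (hG n) (measurable_keep _)]
    congr 1
    funext ω
    exact hGk n ω)
  -- Each site is read from the first half-space in the sequence that contains it; almost surely all
  -- later coordinates agree with this value.
  let glue : (ℕ → Env d) → Env d := fun s x => s (-(x ⬝ᵥ u)).toNat x
  have hglue : Measurable glue := measurable_pi_lambda _ fun x =>
    (measurable_pi_apply x).comp (measurable_pi_apply _)
  refine ⟨M.map glue, Measure.isProbabilityMeasure_map hglue.aemeasurable, fun k => ?_⟩
  rw [Measure.map_map (measurable_keep _) hglue]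
  have hlast : M.map (fun s => s k) = (m k).map (keep (above u (-(k : ℤ)))) := by
    have := congrArg (Measure.map fun p : (Π _ : Iic k, Env d) => p ⟨k, mem_Iic.2 le_rfl⟩) (hMn k)
    rw [Measure.map_map (hev k _) (Preorder.measurable_frestrictLe k),
      Measure.map_map (hev k _) (hG k)] at this
    exact this
  rw [← hlast]
  refine Measure.map_congr ?_
  have hae : ∀ᵐ s ∂M, ∀ i : Iic k, keep (above u (-((i : ℕ) : ℤ))) (s k) = s i := by
    have h1 : ∀ᵐ p ∂((m k).map (G k)), ∀ i : Iic k,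
        keep (above u (-((i : ℕ) : ℤ))) (p ⟨k, mem_Iic.2 le_rfl⟩) = p i := by
      rw [ae_all_iff]
      intro i
      have hms : MeasurableSet {p : (Π _ : Iic k, Env d) |
          keep (above u (-((i : ℕ) : ℤ))) (p ⟨k, mem_Iic.2 le_rfl⟩) = p i} :=
        measurableSet_eq_fun ((measurable_keep _).comp (hev k _)) (hev k i)
      rw [ae_map_iff (hG k).aemeasurable hms]
      refine ae_of_all _ fun ω => ?_
      have hi := mem_Iic.1 i.2
      exact keep_keep (above_anti u (by change -(k : ℤ) ≤ _; omega)) ω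
    rw [← hMn k] at h1
    exact ae_of_ae_map (Preorder.measurable_frestrictLe k).aemeasurable h1
  filter_upwards [hae] with s hs
  have hk := hs ⟨k, mem_Iic.2 le_rfl⟩
  change keep _ (glue s) = s k
  rw [← hk]
  refine keep_congr fun x hx => ?_
  have hi : (-(x ⬝ᵥ u)).toNat ≤ k := by rw [mem_above] at hx; omega
  have := hs ⟨_, mem_Iic.2 hi⟩
  change s _ x = _
  rw [← this]
  exact keep_of_mem (by rw [mem_above]; change -(((-(x ⬝ᵥ u)).toNat : ℕ) : ℤ) ≤ _; omega) _

/-- `Ψ` only depends on the environment above level `-k`. -/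
def LocalAbove {β : Type*} (u : Site d) (k : ℕ) (Ψ : Env d → β) : Prop :=
  ∀ ω, Ψ (keep (above u (-(k : ℤ))) ω) = Ψ ω

section System

variable {ν : Measure (PMF (Site d))} [IsProbabilityMeasure ν] {u : Site d}
  (hreg : ∀ᵐ q ∂(jointLaw (iid ν) 0), q.2 ∈ hasRegen u 1)
include hreg

/-- Consistency needs no computation: on events above level `-k` the block laws for `k` and `k + 1`
are both almost sure limits of the same averages. -/
theorem exists_limitLaw (hlen : meanLen ν u ≠ ∞) :
    ∃ Q : Measure (Env d), IsProbabilityMeasure Q ∧ ∀ k : ℕ,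
      Q.map (keep (above u (-(k : ℤ))))
        = ((blockLaw ν u k).map Prod.fst).map (keep (above u (-(k : ℤ)))) := by
  have hp := isProbabilityMeasure_blockLaw hreg hlen
  have : ∀ k, IsProbabilityMeasure ((blockLaw ν u k).map Prod.fst) := fun k =>
    Measure.isProbabilityMeasure_map measurable_fst.aemeasurable
  refine exists_measure_map_keep u (fun k => (blockLaw ν u k).map Prod.fst) fun k => ?_
  have hkm := measurable_keep (above u (-(k : ℤ)))
  ext A hA
  rw [Measure.map_apply hkm hA, Measure.map_apply measurable_fst (hkm hA),
    Measure.map_apply hkm hA, Measure.map_apply measurable_fst (hkm hA)]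
  set D : Set (Env d × (ℕ → Site d)) := Prod.fst ⁻¹' (keep (above u (-(k : ℤ))) ⁻¹' A)
  have hD : MeasurableSet D := measurable_fst (hkm hA)
  have hloc : ∀ l : ℕ, k ≤ l → ∀ q, D.indicator (fun _ => (1 : ℝ)) (res u (-(l : ℤ)) q)
      = D.indicator (fun _ => (1 : ℝ)) q := by
    intro l hl q
    have : res u (-(l : ℤ)) q ∈ D ↔ q ∈ D := by
      change keep _ (keep _ q.1) ∈ A ↔ keep _ q.1 ∈ A
      rw [keep_keep (above_anti u (by omega))]
    by_cases hq : q ∈ D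
    · rw [Set.indicator_of_mem hq, Set.indicator_of_mem (this.2 hq)]
    · rw [Set.indicator_of_notMem hq, Set.indicator_of_notMem (fun h => hq (this.1 h))]
  have hb : ∀ q, |D.indicator (fun _ => (1 : ℝ)) q| ≤ 1 := fun q => by
    by_cases hq : q ∈ D
    · rw [Set.indicator_of_mem hq]; simp
    · rw [Set.indicator_of_notMem hq]; simp
  have hm : Measurable (D.indicator fun _ => (1 : ℝ)) := measurable_const.indicator hD
  obtain ⟨q, h1, h2⟩ := ((tendsto_average_blockLaw hreg hlen hm hb (hloc k le_rfl)).and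
    (tendsto_average_blockLaw hreg hlen hm hb (hloc (k + 1) (Nat.le_succ k)))).exists
  have h3 := tendsto_nhds_unique h1 h2
  rw [integral_indicator_const _ hD, integral_indicator_const _ hD] at h3
  simp only [smul_eq_mul, mul_one] at h3
  exact ((measureReal_eq_measureReal_iff).1 h3).symm

/-- The invariant environment law: on half-spaces it is the law of the environment seen from a
uniformly chosen time of a regeneration block. -/
theorem exists_limitLaw_tendsto (hlen : meanLen ν u ≠ ∞) :
    ∃ Q : Measure (Env d), IsProbabilityMeasure Q ∧ ∀ (k : ℕ) (Ψ : Env d → ℝ), Measurable Ψ →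
      LocalAbove u k Ψ → (∃ b, ∀ ω, |Ψ ω| ≤ b) →
      ∀ᵐ q ∂(jointLaw (iid ν) 0), Tendsto
        (fun n : ℕ => (n : ℝ)⁻¹ * ∑ j ∈ range n, Ψ (theta j q).1) atTop (𝓝 (∫ ω, Ψ ω ∂Q)) := by
  obtain ⟨Q, hQ, hk⟩ := exists_limitLaw hreg hlen
  refine ⟨Q, hQ, fun k Ψ hΨ hloc ⟨b, hb⟩ => ?_⟩
  have hkm := measurable_keep (above u (-(k : ℤ)))
  have e : ∫ ω, Ψ ω ∂Q = ∫ q, Ψ q.1 ∂(blockLaw ν u k) := by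
    have h1 : ∀ m : Measure (Env d), ∫ ω, Ψ ω ∂m
        = ∫ ω, Ψ ω ∂(m.map (keep (above u (-(k : ℤ))))) := by
      intro m
      rw [integral_map hkm.aemeasurable hΨ.aestronglyMeasurable]
      exact integral_congr_ae (ae_of_all _ fun ω => (hloc ω).symm)
    rw [h1 Q, hk k, ← h1, integral_map measurable_fst.aemeasurable hΨ.aestronglyMeasurable]
  rw [e]
  exact tendsto_average_blockLaw hreg hlen (Φ := fun q => Ψ q.1) (hΨ.comp measurable_fst)
    (fun q => hb q.1) (fun q => hloc q.1)

end System

/-! ### Absolute continuity, path marginal and invariance of the limit law -/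

/-- `Q` describes the long-time averages of local functions of the environment seen from the
walker, when the environment has law `μ`. -/
def IsLimitLaw (μ : Measure (Env d)) (u : Site d) (Q : Measure (Env d)) : Prop :=
  ∀ (k : ℕ) (Ψ : Env d → ℝ), Measurable Ψ → LocalAbove u k Ψ → (∃ b, ∀ ω, |Ψ ω| ≤ b) →
    ∀ᵐ q ∂(jointLaw μ 0), Tendsto
      (fun n : ℕ => (n : ℝ)⁻¹ * ∑ j ∈ range n, Ψ (theta j q).1) atTop (𝓝 (∫ ω, Ψ ω ∂Q))

theorem tendsto_average_shift {z : ℕ → ℝ} {L : ℝ}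
    (h : Tendsto (fun n : ℕ => (n : ℝ)⁻¹ * ∑ i ∈ range n, z i) atTop (𝓝 L)) :
    Tendsto (fun n : ℕ => (n : ℝ)⁻¹ * ∑ i ∈ range n, z (i + 1)) atTop (𝓝 L) := by
  have h1 := h.comp (tendsto_add_atTop_nat 1)
  have h2 : Tendsto (fun n : ℕ => 1 + (n : ℝ)⁻¹) atTop (𝓝 (1 + 0)) :=
    tendsto_const_nhds.add tendsto_inv_atTop_nhds_zero_nat
  have h3 := (h2.mul h1).sub (tendsto_inv_atTop_nhds_zero_nat.mul_const (z 0))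
  rw [add_zero, one_mul, zero_mul, sub_zero] at h3
  refine h3.congr' ?_
  filter_upwards [eventually_gt_atTop 0] with n hn
  have : (n : ℝ) ≠ 0 := by positivity
  simp only [Function.comp]
  rw [sum_range_succ']
  push_cast
  field_simp
  ring

theorem tendsto_integral_average {α : Type*} [MeasurableSpace α] {μ : Measure α}
    [IsProbabilityMeasure μ] {f : ℕ → α → ℝ} (hf : ∀ j, Measurable (f j)) {b : ℝ}
    (hb : ∀ j x, |f j x| ≤ b) {c : ℝ}
    (h : ∀ᵐ x ∂μ, Tendsto (fun n : ℕ => (n : ℝ)⁻¹ * ∑ j ∈ range n, f j x) atTop (𝓝 c)) :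
    Tendsto (fun n : ℕ => (n : ℝ)⁻¹ * ∑ j ∈ range n, ∫ x, f j x ∂μ) atTop (𝓝 c) := by
  have hI : ∀ j, Integrable (f j) μ := fun j =>
    Integrable.of_bound (hf j).aestronglyMeasurable b (ae_of_all _ (hb j))
  have key := tendsto_integral_of_dominated_convergence (μ := μ) (fun _ => b)
    (F := fun (n : ℕ) x => (n : ℝ)⁻¹ * ∑ j ∈ range n, f j x) (f := fun _ => c)
    (fun n => ((Finset.measurable_sum (range n) fun j _ => hf j).const_mul _).aestronglyMeasurable)
    (integrable_const _) (fun n => ae_of_all _ fun x => ?_) h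
  · simp only [integral_const, probReal_univ, smul_eq_mul, one_mul] at key
    refine key.congr fun n => ?_
    rw [integral_const_mul, integral_finsetSum _ fun j _ => hI j]
  · rw [norm_mul, norm_inv, Real.norm_natCast, Real.norm_eq_abs]
    have hb0 : 0 ≤ b := (abs_nonneg _).trans (hb 0 x)
    rcases Nat.eq_zero_or_pos n with rfl | hn
    · simpa using hb0
    · have hn' : (0 : ℝ) < n := by exact_mod_cast hn
      rw [inv_mul_le_iff₀ hn']
      refine (abs_sum_le_sum_abs _ _).trans ((sum_le_sum fun j _ => hb j x).trans ?_)
      simp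

/-- Two finite measures on environments that agree on local events are equal. -/
theorem env_measure_ext (u : Site d) {m m' : Measure (Env d)} [IsFiniteMeasure m]
    (h : ∀ (k : ℕ) (A : Set (Env d)), MeasurableSet A → LocalAbove u k (· ∈ A) → m A = m' A) :
    m = m' := by
  refine ext_of_generate_finite (measurableCylinders fun _ : Site d => PMF (Site d))
    generateFrom_measurableCylinders.symm isPiSystem_measurableCylinders ?_
    (h 0 _ .univ fun _ => rfl)
  intro E hE
  obtain ⟨s, S, hS, rfl⟩ := (mem_measurableCylinders _).1 hE
  refine h (∑ x ∈ s, (x ⬝ᵥ u).natAbs) _ (hS.cylinder _) fun ω => ?_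
  have : s.restrict (keep (above u (-((∑ x ∈ s, (x ⬝ᵥ u).natAbs : ℕ) : ℤ))) ω)
      = s.restrict ω := by
    ext1 ⟨x, hx⟩
    refine keep_of_mem ?_ ω
    have h1 : (x ⬝ᵥ u).natAbs ≤ ∑ x ∈ s, (x ⬝ᵥ u).natAbs :=
      single_le_sum (f := fun x : Site d => (x ⬝ᵥ u).natAbs) (fun _ _ => Nat.zero_le _) hx
    change -((∑ x ∈ s, (x ⬝ᵥ u).natAbs : ℕ) : ℤ) ≤ x ⬝ᵥ u
    omega
  exact congrArg (· ∈ S) this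

/-- By the Markov property at time `j`, averaging the quenched probability of `D` in the environment
seen then gives the probability that the recentred pair lies in `D`. This makes joint events
accessible to limits of environment observables. -/
theorem integral_quenchedLaw_theta (μ : Measure (Env d)) [IsProbabilityMeasure μ] (z : Site d)
    (j : ℕ) {D : Set (Env d × (ℕ → Site d))} (hD : MeasurableSet D) :
    ∫ q, (quenchedLaw 0 (theta j q).1).real (Prod.mk (theta j q).1 ⁻¹' D) ∂(jointLaw μ z)
      = (jointLaw μ z).real (theta j ⁻¹' D) := by
  have hfst : Measurable fun q : Env d × (ℕ → Site d) => (theta j q).1 := (measurable_theta j).fst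
  have hms := measurable_quenchedLaw_section (0 : Site d) hD
  have : IsProbabilityMeasure ((jointLaw μ z).map fun q => (theta j q).1) :=
    Measure.isProbabilityMeasure_map hfst.aemeasurable
  simp only [measureReal_def]
  rw [integral_toReal (f := fun q => quenchedLaw 0 (theta j q).1 (Prod.mk (theta j q).1 ⁻¹' D))
    (hms.comp hfst).aemeasurable (ae_of_all _ fun q => measure_lt_top _ _),
    ← Measure.map_apply (measurable_theta j) hD, jointLaw_map_theta, jointLaw_apply _ _ hD,
    lintegral_map hms hfst]

theorem LocalAbove.indicator {u : Site d} {k : ℕ} {A : Set (Env d)} (h : LocalAbove u k (· ∈ A)) :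
    LocalAbove u k (A.indicator fun _ => (1 : ℝ)) := by
  classical
  intro ω
  have := h ω
  simp only [Set.indicator_apply, eq_iff_iff] at this ⊢
  simp only [this]

theorem abs_indicator_one_le {α : Type*} (A : Set α) (x : α) :
    |A.indicator (fun _ => (1 : ℝ)) x| ≤ 1 := by
  by_cases hx : x ∈ A
  · rw [Set.indicator_of_mem hx]; simp
  · rw [Set.indicator_of_notMem hx]; simp

theorem IsLimitLaw.tendsto_integral {μ : Measure (Env d)} [IsProbabilityMeasure μ]
    {u : Site d} {Q : Measure (Env d)} (hQ : IsLimitLaw μ u Q) {k : ℕ} {Ψ : Env d → ℝ} (hΨ : Measurable Ψ)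
    (hk : LocalAbove u k Ψ) {b : ℝ} (hb : ∀ ω, |Ψ ω| ≤ b) :
    Tendsto (fun n : ℕ => (n : ℝ)⁻¹ * ∑ j ∈ range n,
      ∫ q, Ψ (theta j q).1 ∂(jointLaw μ 0)) atTop (𝓝 (∫ ω, Ψ ω ∂Q)) :=
  tendsto_integral_average (fun j => hΨ.comp (measurable_theta j).fst) (fun _ _ => hb _)
    (hQ k Ψ hΨ hk ⟨b, hb⟩)

theorem IsLimitLaw.tendsto_measureReal {μ : Measure (Env d)} [IsProbabilityMeasure μ]
    {u : Site d} {Q : Measure (Env d)} (hQ : IsLimitLaw μ u Q) {k : ℕ} {A : Set (Env d)} (hA : MeasurableSet A)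
    (hk : LocalAbove u k (· ∈ A)) :
    Tendsto (fun n : ℕ => (n : ℝ)⁻¹ * ∑ j ∈ range n,
      (jointLaw μ 0).real {q | (theta j q).1 ∈ A}) atTop (𝓝 (Q.real A)) := by
  have h := hQ.tendsto_integral (measurable_const.indicator hA) hk.indicator
    (abs_indicator_one_le A)
  rw [integral_indicator_const _ hA, smul_eq_mul, mul_one] at h
  refine h.congr fun n => ?_
  congr 1
  refine sum_congr rfl fun j _ => ?_
  have hj : MeasurableSet {q : Env d × (ℕ → Site d) | (theta j q).1 ∈ A} :=
    (measurable_theta j).fst hA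
  have := integral_indicator_const (μ := jointLaw μ 0) (1 : ℝ) hj
  rw [smul_eq_mul, mul_one] at this
  rw [← this]
  rfl

section Limit

variable {ν : Measure (PMF (Site d))} [IsProbabilityMeasure ν] {u : Site d} {Q : Measure (Env d)}
  (hQ : IsLimitLaw (iid ν) u Q)
include hQ

omit hQ in
theorem ae_forall_theta_notMem {A : Set (Env d)} (hA : MeasurableSet A) (h0 : iid ν A = 0) :
    ∀ᵐ q ∂(jointLaw (iid ν) 0), ∀ j, (theta j q).1 ∉ A := by
  have h1 : ∀ᵐ ω ∂(iid ν), ∀ x, shift x ω ∉ A := by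
    rw [ae_all_iff]
    intro x
    have : (iid ν).map (shift x) A = 0 := by rw [infinitePi_map_shift]; exact h0
    rw [Measure.map_apply (measurable_shift x) hA] at this
    exact measure_eq_zero_iff_ae_notMem.1 this
  rw [← jointLaw_fst (iid ν) 0] at h1
  filter_upwards [ae_of_ae_map measurable_fst.aemeasurable h1] with q hq j
  exact hq _

/-- By stationarity and countability of the sites, almost surely no shift of the environment lies in
a null event, so its time averages vanish identically. -/
theorem IsLimitLaw.measure_eq_zero [IsProbabilityMeasure Q] {k : ℕ} {A : Set (Env d)}
    (hA : MeasurableSet A) (hk : LocalAbove u k (· ∈ A)) (h0 : iid ν A = 0) : Q A = 0 := by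
  have h1 := hQ.tendsto_measureReal hA hk
  have h2 : ∀ j, (jointLaw (iid ν) 0).real {q | (theta j q).1 ∈ A} = 0 := by
    intro j
    rw [measureReal_eq_zero_iff]
    exact measure_eq_zero_iff_ae_notMem.2
      ((ae_forall_theta_notMem hA h0).mono fun q hq => hq j)
  simp only [h2, sum_const_zero, mul_zero] at h1
  have := tendsto_nhds_unique h1 tendsto_const_nhds
  rwa [measureReal_eq_zero_iff] at this

theorem IsLimitLaw.integral_quenchedLaw {k : ℕ} {D : Set (Env d × (ℕ → Site d))}
    (hD : MeasurableSet D)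
    (hk : LocalAbove u k fun ω => (quenchedLaw 0 ω).real (Prod.mk ω ⁻¹' D)) :
    Tendsto (fun n : ℕ => (n : ℝ)⁻¹ * ∑ j ∈ range n, (jointLaw (iid ν) 0).real (theta j ⁻¹' D))
      atTop (𝓝 (∫ ω, (quenchedLaw 0 ω).real (Prod.mk ω ⁻¹' D) ∂Q)) := by
  have h := hQ.tendsto_integral (measurable_quenchedLaw_section 0 hD).ennreal_toReal hk (b := 1)
    (fun ω => by
      rw [abs_of_nonneg ENNReal.toReal_nonneg]
      exact measureReal_le_one)
  refine h.congr fun n => ?_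
  congr 1
  exact sum_congr rfl fun j _ => integral_quenchedLaw_theta _ _ j hD

/-- The law of the walk under the invariant law is that of the walk seen from a uniformly chosen
time of a regeneration block. -/
theorem IsLimitLaw.averagedLaw_eq [IsProbabilityMeasure Q]
    (hreg : ∀ᵐ q ∂(jointLaw (iid ν) 0), q.2 ∈ hasRegen u 1) (hlen : meanLen ν u ≠ ∞) :
    averagedLaw Q 0 = (blockLaw ν u 0).map Prod.snd := by
  have := isProbabilityMeasure_blockLaw hreg hlen 0
  have : IsProbabilityMeasure (averagedLaw Q 0) := by unfold averagedLaw; infer_instance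
  refine path_measure_ext fun x n => ?_
  set D : Set (Env d × (ℕ → Site d)) := Prod.snd ⁻¹' cyl x n with hD
  have hDm : MeasurableSet D := measurable_snd (measurableSet_cyl x n)
  have hk : LocalAbove u (∑ i ∈ range n, (x i ⬝ᵥ u).natAbs)
      fun ω => (quenchedLaw 0 ω).real (Prod.mk ω ⁻¹' D) := by
    intro ω
    change (quenchedLaw 0 _).real (cyl x n) = (quenchedLaw 0 ω).real (cyl x n)
    rw [measureReal_def, measureReal_def, quenchedLaw_cyl, quenchedLaw_cyl]
    congr 2
    refine wt_congr fun i hi => keep_of_mem ?_ ω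
    have h1 : (x i ⬝ᵥ u).natAbs ≤ ∑ i ∈ range n, (x i ⬝ᵥ u).natAbs :=
      single_le_sum (f := fun i => (x i ⬝ᵥ u).natAbs) (fun _ _ => Nat.zero_le _) (mem_range.2 hi)
    rw [mem_above]
    omega
  have h1 := hQ.integral_quenchedLaw hDm hk
  have h2 := tendsto_integral_average (fun j => (measurable_const.indicator hDm).comp
    (measurable_theta j)) (fun j q => abs_indicator_one_le D (theta j q))
    -- A pure path event ignores the environment, so block `0` suffices. The same Cesàro averages
    -- converge to the probability of `D` under `Q` and under the block law.
    (tendsto_average_blockLaw hreg hlen (Φ := D.indicator fun _ => (1 : ℝ))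
    (measurable_const.indicator hDm) (abs_indicator_one_le D) (k := 0) (fun q => rfl))
  have h3 : ∀ j, ∫ q, D.indicator (fun _ => (1 : ℝ)) (theta j q) ∂(jointLaw (iid ν) 0)
      = (jointLaw (iid ν) 0).real (theta j ⁻¹' D) := by
    intro j
    have := integral_indicator_const (μ := jointLaw (iid ν) 0) (1 : ℝ) (measurable_theta j hDm)
    rw [smul_eq_mul, mul_one] at this
    exact this
  simp only [Function.comp, h3, integral_indicator_const _ hDm, smul_eq_mul, mul_one] at h2
  have h4 := tendsto_nhds_unique h1 h2
  rw [averagedLaw, Measure.snd, Measure.map_apply measurable_snd (measurableSet_cyl x n),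
    Measure.map_apply measurable_snd (measurableSet_cyl x n)]
  change jointLaw Q 0 D = blockLaw ν u 0 D
  have h5 := integral_quenchedLaw_theta Q 0 0 hDm
  have h6 : ∫ q, (quenchedLaw 0 (theta 0 q).1).real (Prod.mk (theta 0 q).1 ⁻¹' D) ∂(jointLaw Q 0)
      = ∫ q, (quenchedLaw 0 q.1).real (Prod.mk q.1 ⁻¹' D) ∂(jointLaw Q 0) := by
    refine integral_congr_ae ?_
    filter_upwards [jointLaw_start Q 0] with q hq
    rw [theta_zero hq]
  have h7 : theta 0 ⁻¹' D =ᵐ[jointLaw Q 0] D := by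
    refine eventuallyEq_set.2 ?_
    filter_upwards [jointLaw_start Q 0] with q hq
    rw [Set.mem_preimage, theta_zero hq]
  have h8 : ∫ q, (quenchedLaw 0 q.1).real (Prod.mk q.1 ⁻¹' D) ∂(jointLaw Q 0)
      = ∫ ω, (quenchedLaw 0 ω).real (Prod.mk ω ⁻¹' D) ∂Q := by
    have hm : Measurable fun ω => (quenchedLaw 0 ω).real (Prod.mk ω ⁻¹' D) :=
      (measurable_quenchedLaw_section 0 hDm).ennreal_toReal
    conv_rhs => rw [← jointLaw_fst Q 0, Measure.fst]
    rw [integral_map measurable_fst.aemeasurable hm.aestronglyMeasurable]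
  rw [h6, h8, h4, measureReal_congr h7] at h5
  exact (measureReal_eq_measureReal_iff).1 h5.symm

/-- The transition probability into `A` need not be local, as a jump may go arbitrarily far. Split
by the first jump it is a sum of local functions; each finite partial sum has a limiting average at
most that of visits to `A` one step later. Only an inequality survives. -/
theorem IsLimitLaw.comp_envKernel_le [IsProbabilityMeasure Q] {k : ℕ} {A : Set (Env d)}
    (hA : MeasurableSet A) (hk : LocalAbove u k (· ∈ A)) :
    (envKernel d ∘ₘ Q) A ≤ Q A := by
  let c : Site d → Set (ℕ → Site d) := fun z => cyl (fun i => if i = 0 then 0 else z) 1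
  have hc : ∀ {z X}, X ∈ c z ↔ X 0 = 0 ∧ X 1 = z := by
    intro z X
    constructor
    · intro h
      exact ⟨by simpa using h 0 (by omega), by simpa using h 1 le_rfl⟩
    · rintro ⟨h0, h1⟩ i hi
      obtain rfl | rfl : i = 0 ∨ i = 1 := by omega
      · simpa using h0
      · simpa using h1
  let D : Site d → Set (Env d × (ℕ → Site d)) := fun z => {q | q.2 ∈ c z ∧ shift z q.1 ∈ A}
  have hD : ∀ z, MeasurableSet (D z) := fun z =>
    (measurable_snd (measurableSet_cyl _ 1)).inter
      (measurable_fst ((measurable_shift z) hA))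
  have hloc : ∀ z, LocalAbove u (k + (z ⬝ᵥ u).natAbs)
      fun ω => (quenchedLaw 0 ω).real (Prod.mk ω ⁻¹' D z) := by
    intro z ω
    have hk' : ∀ ω, keep (above u (-(k : ℤ))) ω ∈ A ↔ ω ∈ A := fun ω => iff_of_eq (hk ω)
    have h1 : shift z (keep (above u (-((k + (z ⬝ᵥ u).natAbs : ℕ) : ℤ))) ω) ∈ A
        ↔ shift z ω ∈ A := by
      rw [← hk', ← hk' (shift z ω), ← shift_keep, ← shift_keep,
        keep_keep (above_anti u (by omega))]
    have h2 : quenchedLaw 0 (keep (above u (-((k + (z ⬝ᵥ u).natAbs : ℕ) : ℤ))) ω) (c z)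
        = quenchedLaw 0 ω (c z) := by
      rw [quenchedLaw_cyl, quenchedLaw_cyl]
      congr 1
      refine wt_congr fun i hi => keep_of_mem ?_ ω
      obtain rfl : i = 0 := by omega
      rw [mem_above, if_pos rfl, zero_dotProduct]
      omega
    change (quenchedLaw 0 _ {X | X ∈ c z ∧ shift z _ ∈ A}).toReal
      = (quenchedLaw 0 ω {X | X ∈ c z ∧ shift z ω ∈ A}).toReal
    by_cases h : shift z ω ∈ A
    · simp only [h1, h, and_true]
      exact congrArg _ h2
    · simp only [h1, h, and_false, Set.ofPred_false, measure_empty]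
  rw [Measure.bind_apply hA (Kernel.aemeasurable _)]
  calc ∫⁻ ω, envKernel d ω A ∂Q
      ≤ ∫⁻ ω, ∑' z, quenchedLaw 0 ω (Prod.mk ω ⁻¹' D z) ∂Q := by
        refine lintegral_mono fun ω => ?_
        rw [envKernel_apply ω hA]
        refine le_trans (measure_mono_ae ?_) (measure_iUnion_le _)
        filter_upwards [quenchedLaw_start 0 ω] with X hX hXA
        exact Set.mem_iUnion.2 ⟨X 1, hc.2 ⟨hX, rfl⟩, hXA⟩
    _ = ∑' z, ∫⁻ ω, quenchedLaw 0 ω (Prod.mk ω ⁻¹' D z) ∂Q :=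
        lintegral_tsum fun z => (measurable_quenchedLaw_section 0 (hD z)).aemeasurable
    _ ≤ Q A := ?_
  rw [ENNReal.tsum_eq_iSup_sum]
  refine iSup_le fun Z => ?_
  have h1 := tendsto_finsetSum Z fun z _ => hQ.integral_quenchedLaw (hD z) (hloc z)
  have h2 := tendsto_average_shift (hQ.tendsto_measureReal hA hk)
  have h3 : ∑ z ∈ Z, ∫ ω, (quenchedLaw 0 ω).real (Prod.mk ω ⁻¹' D z) ∂Q ≤ Q.real A := by
    refine le_of_tendsto_of_tendsto' h1 h2 fun n => ?_
    rw [← mul_sum, sum_comm]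
    refine mul_le_mul_of_nonneg_left (sum_le_sum fun j _ => ?_) (by positivity)
    have hd : Set.PairwiseDisjoint (Z : Set (Site d)) fun z => theta j ⁻¹' D z := by
      intro z _ z' _ hz
      refine Set.disjoint_left.2 fun q hq hq' => hz ?_
      rw [← (hc.1 hq.1).2, ← (hc.1 hq'.1).2]
    rw [← measureReal_biUnion_finset hd fun z _ => measurable_theta j (hD z)]
    refine measureReal_mono fun q hq => ?_
    obtain ⟨z, -, hz⟩ := Set.mem_iUnion₂.1 hq
    change (theta (j + 1) q).1 ∈ A
    rw [← theta_theta 1 j]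
    change shift ((theta j q).2 1) (theta j q).1 ∈ A
    rw [(hc.1 hz.1).2]
    exact hz.2
  have h4 : ∀ z, ∫⁻ ω, quenchedLaw 0 ω (Prod.mk ω ⁻¹' D z) ∂Q
      = ENNReal.ofReal (∫ ω, (quenchedLaw 0 ω).real (Prod.mk ω ⁻¹' D z) ∂Q) := by
    intro z
    have hfin : ∫⁻ ω, quenchedLaw 0 ω (Prod.mk ω ⁻¹' D z) ∂Q ≠ ∞ := by
      have : ∫⁻ ω, quenchedLaw 0 ω (Prod.mk ω ⁻¹' D z) ∂Q ≤ ∫⁻ _, 1 ∂Q :=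
        lintegral_mono fun ω => prob_le_one
      rw [lintegral_one, measure_univ] at this
      exact (this.trans_lt ENNReal.one_lt_top).ne
    simp only [measureReal_def]
    rw [integral_toReal (measurable_quenchedLaw_section 0 (hD z)).aemeasurable
      (ae_of_all _ fun ω => measure_lt_top _ _), ENNReal.ofReal_toReal hfin]
  simp_rw [h4]
  rw [← ENNReal.ofReal_sum_of_nonneg fun z _ => integral_nonneg fun ω => measureReal_nonneg]
  refine (ENNReal.ofReal_le_ofReal h3).trans ?_
  rw [ofReal_measureReal]

/-- The one-sided bound for an event and for its complement forces equality between two probability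
measures. -/
theorem IsLimitLaw.invariant [IsProbabilityMeasure Q] : Kernel.Invariant (envKernel d) Q := by
  have : IsMarkovKernel (envKernel d) := by
    unfold envKernel
    exact Kernel.IsMarkovKernel.map _ measurable_shift_step
  refine env_measure_ext u fun k A hA hk => le_antisymm (hQ.comp_envKernel_le hA hk) ?_
  have hc : LocalAbove u k (· ∈ Aᶜ) := fun ω => by
    have := hk ω
    simp only [eq_iff_iff, Set.mem_compl_iff] at this ⊢
    exact not_congr this
  have h1 := hQ.comp_envKernel_le hA.compl hc
  change _ ≤ (envKernel d ∘ₘ Q) A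
  rw [prob_compl_eq_one_sub hA, prob_compl_eq_one_sub hA] at h1
  exact (ENNReal.sub_le_sub_iff_left prob_le_one ENNReal.one_ne_top).1 h1

end Limit

/-! ### Uniqueness and ergodicity -/

/-- A path that tends to `∞` in direction `u` has a time after a given level is reached for good
from which it never backtracks. -/
theorem exists_future_min {u : Site d} {X : ℕ → Site d}
    (h : Tendsto (fun n => X n ⬝ᵥ u) atTop atTop) (L : ℤ) :
    ∃ n, L ≤ X n ⬝ᵥ u ∧ ∀ m, X n ⬝ᵥ u ≤ X (n + m) ⬝ᵥ u := by
  obtain ⟨n₀, hn₀⟩ := eventually_atTop.1 (h.eventually_ge_atTop L)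
  obtain ⟨m, hm⟩ : ∃ m, ∀ l, (X (n₀ + m) ⬝ᵥ u - L).toNat ≤ (X (n₀ + l) ⬝ᵥ u - L).toNat := by
    have := WellFounded.has_min (wellFounded_lt (α := ℕ))
      (Set.range fun m => (X (n₀ + m) ⬝ᵥ u - L).toNat) ⟨_, 0, rfl⟩
    obtain ⟨_, ⟨m, rfl⟩, hm⟩ := this
    exact ⟨m, fun l => not_lt.1 (hm _ ⟨l, rfl⟩)⟩
  refine ⟨n₀ + m, hn₀ _ (by omega), fun l => ?_⟩
  have h1 := hm (m + l)
  have h2 := hn₀ (n₀ + m) (by omega)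
  have h3 := hn₀ (n₀ + (m + l)) (by omega)
  rw [← add_assoc] at h1 h3
  omega

theorem LocalAbove.shift_keep {β : Type*} {u : Site d} {k : ℕ} {Ψ : Env d → β}
    (hΨ : LocalAbove u k Ψ) {z : Site d} {ℓ : ℤ} (h : ℓ ≤ z ⬝ᵥ u - k) (ω : Env d) :
    Ψ (shift z (keep (above u ℓ) ω)) = Ψ (shift z ω) := by
  rw [← hΨ, ← RWRE.shift_keep, keep_keep (above_anti u (by omega)), RWRE.shift_keep, hΨ]

/-- Almost sure averages of local functions pass to environment laws that are close to `μ` far in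
the direction of transience. -/
theorem ae_tendsto_average_of_close {μ Q' : Measure (Env d)} [IsProbabilityMeasure μ]
    [IsProbabilityMeasure Q'] (hμ : ∀ z, μ.map (shift z) = μ) {u : Site d}
    (htr : ∀ᵐ q ∂(jointLaw Q' 0), Tendsto (fun n => q.2 n ⬝ᵥ u) atTop atTop)
    (hclose : ∀ ε : ℝ≥0∞, 0 < ε → ∃ L : ℕ, ∀ A, MeasurableSet[siteSigma (above u L)] A →
      μ A = 0 → Q' A ≤ ε)
    {k : ℕ} {Ψ : Env d → ℝ} (hΨ : Measurable Ψ) (hk : LocalAbove u k Ψ) {c : ℝ}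
    (h : ∀ᵐ q ∂(jointLaw μ 0), Tendsto
      (fun n : ℕ => (n : ℝ)⁻¹ * ∑ j ∈ range n, Ψ (theta j q).1) atTop (𝓝 c)) :
    ∀ᵐ q ∂(jointLaw Q' 0), Tendsto
      (fun n : ℕ => (n : ℝ)⁻¹ * ∑ j ∈ range n, Ψ (theta j q).1) atTop (𝓝 c) := by
  set N : Set (Env d × (ℕ → Site d)) := {q | ¬ Tendsto
    (fun n : ℕ => (n : ℝ)⁻¹ * ∑ j ∈ range n, Ψ (theta j q).1) atTop (𝓝 c)} with hN
  have hNm : MeasurableSet N := by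
    refine (measurableSet_tendsto (𝓝 c) fun n => ?_).compl
    exact (Finset.measurable_sum (range n) fun j _ =>
      (show Measurable fun q : Env d × (ℕ → Site d) => Ψ (theta j q).1 from
        hΨ.comp (measurable_theta j).fst)).const_mul _
  have hNθ : ∀ n q, q ∈ N → theta n q ∈ N := by
    intro n q hq hT
    refine hq (tendsto_average_of_shift n ?_)
    simp only [theta_theta, add_comm n] at hT
    exact hT
  set NS : Set (Env d × (ℕ → Site d)) := N ∩ {q | q.2 ∈ stay u} with hNS
  have hNSm : MeasurableSet NS := hNm.inter (measurable_snd (measurableSet_stay u))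
  -- Environments in which the walk may fail to average while never going below its starting level.
  -- Such paths use sites above `0` and `Ψ` looks `k` further down, so `H` is local above `-k`; it
  -- is `μ`-null.
  set H : Set (Env d) := {ω | quenchedLaw 0 ω (Prod.mk ω ⁻¹' NS) ≠ 0} with hH
  have hHm : MeasurableSet H :=
    (measurable_quenchedLaw_section 0 hNSm) (measurableSet_singleton 0).compl
  have hHμ : μ H = 0 := by
    have h1 : jointLaw μ 0 NS = 0 :=
      measure_mono_null Set.inter_subset_left h
    rw [jointLaw_apply _ _ hNSm, lintegral_eq_zero_iff (measurable_quenchedLaw_section 0 hNSm)] at h1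
    exact h1
  have hHk : LocalAbove u k (· ∈ H) := by
    intro ω
    have e1 : ∀ X ∈ stay u, (keep (above u (-(k : ℤ))) ω, X) ∈ N ↔ (ω, X) ∈ N := by
      intro X hX
      have : ∀ j, Ψ (theta j (keep (above u (-(k : ℤ))) ω, X)).1 = Ψ (theta j (ω, X)).1 :=
        fun j => hk.shift_keep (by have := hX j; change -(k : ℤ) ≤ X j ⬝ᵥ u - k; omega) ω
      simp only [hN, Set.mem_ofPred_eq, this]
    have e2 : Prod.mk (keep (above u (-(k : ℤ))) ω) ⁻¹' NS = Prod.mk ω ⁻¹' NS := by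
      ext X
      constructor
      · exact fun hX => ⟨(e1 X hX.2).1 hX.1, hX.2⟩
      · exact fun hX => ⟨(e1 X hX.2).2 hX.1, hX.2⟩
    change (quenchedLaw 0 _ _ ≠ 0) = (quenchedLaw 0 _ _ ≠ 0)
    rw [e2, quenchedLaw_congr_of_stay (V := above u (-(k : ℤ))) (ω := keep (above u (-(k : ℤ))) ω)
      (ω' := ω) (fun x hx => keep_of_mem hx ω) 0 (measurable_prodMk_left hNSm)
      (fun X hX i => by have : 0 ≤ X i ⬝ᵥ u := hX.2 i; change -(k : ℤ) ≤ X i ⬝ᵥ u; omega)]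
  -- A transient path has a point at level at least `L + k` below which it never returns. Failure of
  -- averaging is inherited there, so almost surely the environment seen from it lies in `H`. The
  -- event on the right looks only above level `L`.
  have key : ∀ L : ℕ, jointLaw Q' 0 N ≤ Q' {ω | ∃ x : Site d, (L : ℤ) + k ≤ x ⬝ᵥ u ∧
      shift x ω ∈ H} := by
    intro L
    set G : Set (Env d) := {ω | ∃ x : Site d, (L : ℤ) + k ≤ x ⬝ᵥ u ∧ shift x ω ∈ H} with hG
    have hbad : ∀ n, jointLaw Q' 0 {q | theta n q ∈ NS ∧ (theta n q).1 ∉ H} = 0 := by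
      intro n
      have hD : MeasurableSet (NS ∩ {q | q.1 ∉ H}) := hNSm.inter (measurable_fst hHm.compl)
      have hfst : Measurable fun q : Env d × (ℕ → Site d) => (theta n q).1 :=
        (measurable_theta n).fst
      have : IsProbabilityMeasure ((jointLaw Q' 0).map fun q => (theta n q).1) :=
        Measure.isProbabilityMeasure_map hfst.aemeasurable
      change jointLaw Q' 0 (theta n ⁻¹' (NS ∩ {q | q.1 ∉ H})) = 0
      rw [← Measure.map_apply (measurable_theta n) hD, jointLaw_map_theta, jointLaw_apply _ _ hD]
      refine lintegral_eq_zero_of_ae_eq_zero (ae_of_all _ fun ω => ?_)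
      by_cases hω : ω ∈ H
      · refine measure_mono_null (t := ∅) (fun X hX => hX.2 hω) measure_empty
      · exact measure_mono_null (fun X hX => hX.1) (not_not.1 hω)
    have hfstG : jointLaw Q' 0 {q | q.1 ∈ G} ≤ Q' G := by
      conv_rhs => rw [← jointLaw_fst Q' 0]
      exact Measure.le_map_apply measurable_fst.aemeasurable G
    have hbad' : jointLaw Q' 0 (⋃ n, {q | theta n q ∈ NS ∧ (theta n q).1 ∉ H}) = 0 :=
      measure_iUnion_null hbad
    calc jointLaw Q' 0 N
        ≤ jointLaw Q' 0 ((⋃ n, {q | theta n q ∈ NS ∧ (theta n q).1 ∉ H}) ∪ {q | q.1 ∈ G}) := by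
          refine measure_mono_ae ?_
          filter_upwards [htr] with q hq hqN
          obtain ⟨n, hn, hmin⟩ := exists_future_min hq (L + k)
          by_cases hH' : (theta n q).1 ∈ H
          · exact Or.inr ⟨q.2 n, hn, hH'⟩
          · refine Or.inl (Set.mem_iUnion.2 ⟨n, ⟨hNθ n q hqN, fun m => ?_⟩, hH'⟩)
            change 0 ≤ (q.2 (n + m) - q.2 n) ⬝ᵥ u
            rw [sub_dotProduct]
            linarith [hmin m]
      _ ≤ 0 + Q' G := (measure_union_le _ _).trans (by rw [hbad']; gcongr)
      _ = Q' G := zero_add _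
  refine measure_eq_zero_iff_ae_notMem.1 (le_antisymm ?_ zero_le) |>.mono fun q hq => not_not.1 hq
  refine le_of_forall_gt_imp_ge_of_dense fun ε hε => ?_
  obtain ⟨L, hL⟩ := hclose ε hε
  refine (key L).trans (hL _ ?_ ?_)
  · have hGm : MeasurableSet {ω : Env d | ∃ x : Site d, (L : ℤ) + k ≤ x ⬝ᵥ u ∧ shift x ω ∈ H} := by
      have : {ω : Env d | ∃ x : Site d, (L : ℤ) + k ≤ x ⬝ᵥ u ∧ shift x ω ∈ H}
          = ⋃ x : Site d, ⋃ _ : (L : ℤ) + k ≤ x ⬝ᵥ u, shift x ⁻¹' H := by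
        ext ω; simp
      rw [this]
      exact .iUnion fun x => .iUnion fun _ => measurable_shift x hHm
    have := measurable_siteSigma_of_keep (S := above u L)
      (f := (· ∈ {ω : Env d | ∃ x : Site d, (L : ℤ) + k ≤ x ⬝ᵥ u ∧ shift x ω ∈ H}))
      (measurable_mem.2 hGm) fun ω => by
        simp only [Set.mem_ofPred_eq, eq_iff_iff]
        refine exists_congr fun x => and_congr_right fun hx => ?_
        exact iff_of_eq (hHk.shift_keep (by omega) ω)
    exact (@measurable_mem _ _ (siteSigma (above u L))).1 this
  · have : {ω : Env d | ∃ x : Site d, (L : ℤ) + k ≤ x ⬝ᵥ u ∧ shift x ω ∈ H}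
        ⊆ ⋃ x : Site d, shift x ⁻¹' H := fun ω ⟨x, _, hx⟩ => Set.mem_iUnion.2 ⟨x, hx⟩
    refine measure_mono_null this (measure_iUnion_null fun x => ?_)
    rw [← Measure.map_apply (measurable_shift x) hHm, hμ, hHμ]

theorem jointLaw_map_theta_one_fst (Q : Measure (Env d)) [IsProbabilityMeasure Q] :
    (jointLaw Q 0).map (fun q => (theta 1 q).1) = envKernel d ∘ₘ Q := by
  ext A hA
  have hfst : Measurable fun q : Env d × (ℕ → Site d) => (theta 1 q).1 := (measurable_theta 1).fst
  rw [Measure.map_apply hfst hA, Measure.bind_apply hA (Kernel.aemeasurable _),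
    jointLaw_apply _ _ (hfst hA)]
  simp_rw [envKernel_apply _ hA]
  rfl

/-- Seen from the walker the environment is a Markov chain with kernel `envKernel d`, so an
invariant starting law is its law at every time. -/
theorem jointLaw_map_theta_fst_of_invariant {Q : Measure (Env d)} [IsProbabilityMeasure Q]
    (hQ : Kernel.Invariant (envKernel d) Q) (j : ℕ) :
    (jointLaw Q 0).map (fun q => (theta j q).1) = Q := by
  have hfst : ∀ j, Measurable fun q : Env d × (ℕ → Site d) => (theta j q).1 :=
    fun j => (measurable_theta j).fst
  induction j with
  | zero =>
    conv_rhs => rw [← jointLaw_fst Q 0, Measure.fst]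
    refine Measure.map_congr ?_
    filter_upwards [jointLaw_start Q 0] with q hq
    rw [theta_zero hq]
  | succ j ih =>
    have h1 : (fun q : Env d × (ℕ → Site d) => (theta (j + 1) q).1)
        = (fun q => (theta 1 q).1) ∘ theta j := by
      funext q
      simp [theta_theta]
    rw [h1, ← Measure.map_map (hfst 1) (measurable_theta j), jointLaw_map_theta, ih,
      jointLaw_map_theta_one_fst]
    exact hQ

/-- An invariant law under which the averages are those of `Q` is `Q`. -/
theorem eq_of_invariant {u : Site d} {Q Q' : Measure (Env d)} [IsProbabilityMeasure Q]
    [IsProbabilityMeasure Q'] (hinv : Kernel.Invariant (envKernel d) Q') (h : IsLimitLaw Q' u Q) :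
    Q' = Q := by
  refine env_measure_ext u fun k A hA hk => ?_
  have h1 := h.tendsto_measureReal hA hk
  have h2 : ∀ j, (jointLaw Q' 0).real {q | (theta j q).1 ∈ A} = Q'.real A := by
    intro j
    have hfst : Measurable fun q : Env d × (ℕ → Site d) => (theta j q).1 := (measurable_theta j).fst
    conv_rhs => rw [← jointLaw_map_theta_fst_of_invariant hinv j]
    rw [measureReal_def, measureReal_def, Measure.map_apply hfst hA]
    rfl
  simp only [h2, sum_const, card_range, nsmul_eq_mul] at h1
  have h3 : Tendsto (fun n : ℕ => (n : ℝ)⁻¹ * (n * Q'.real A)) atTop (𝓝 (Q'.real A)) := by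
    refine tendsto_const_nhds.congr' ?_
    filter_upwards [eventually_gt_atTop 0] with n hn
    have : (n : ℝ) ≠ 0 := by positivity
    field_simp
  exact (measureReal_eq_measureReal_iff).1 (tendsto_nhds_unique h3 h1)

/-- An invariant law that describes its own averages is ergodic. -/
theorem ergodicFor_of_isLimitLaw {u : Site d} {Q : Measure (Env d)} [IsProbabilityMeasure Q]
    (hinv : Kernel.Invariant (envKernel d) Q) (h : IsLimitLaw Q u Q) :
    ErgodicFor (envKernel d) Q := by
  have : IsMarkovKernel (envKernel d) := by
    unfold envKernel
    exact Kernel.IsMarkovKernel.map _ measurable_shift_step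
  intro A hA hAinv
  by_cases hQA : Q A = 0
  · exact Or.inl hQA
  refine Or.inr ?_
  have hprob := cond_isProbabilityMeasure (μ := Q) hQA
  have hac : Q[|A] ≪ Q := cond_absolutelyContinuous
  -- From `A` the chain stays in `A`, and from `Aᶜ` it does not enter `A`. The mass transported from
  -- `A` into `B` is thus all the mass that reaches `A ∩ B`, so `Q` conditioned on `A` is invariant.
  have hrestr : ∀ B, MeasurableSet B → ∫⁻ ω in A, envKernel d ω B ∂Q = Q (A ∩ B) := by
    intro B hB
    have h1 : ∫⁻ ω in A, envKernel d ω B ∂Q = ∫⁻ ω in A, envKernel d ω (A ∩ B) ∂Q := by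
      refine setLIntegral_congr_fun_ae hA ?_
      filter_upwards [hAinv] with ω hω hωA
      rw [Set.indicator_of_mem hωA] at hω
      have h0 : envKernel d ω Aᶜ = 0 := (prob_compl_eq_zero_iff hA).2 hω
      refine measure_congr_iff ?_
      filter_upwards [measure_eq_zero_iff_ae_notMem.1 h0] with x hx
      exact ⟨fun hxB => ⟨not_not.1 hx, hxB⟩, fun hxB => hxB.2⟩
    have h2 : ∫⁻ ω in Aᶜ, envKernel d ω (A ∩ B) ∂Q = 0 := by
      refine (setLIntegral_congr_fun_ae hA.compl (g := fun _ => 0) ?_).trans (by simp)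
      filter_upwards [hAinv] with ω hω hωA
      rw [Set.indicator_of_notMem hωA] at hω
      exact measure_mono_null Set.inter_subset_left hω
    have h3 : ∫⁻ ω, envKernel d ω (A ∩ B) ∂Q = Q (A ∩ B) := by
      rw [← Measure.bind_apply (hA.inter hB) (Kernel.aemeasurable _)]
      exact congrArg (fun m : Measure (Env d) => m (A ∩ B)) hinv
    rw [h1, ← h3, ← lintegral_add_compl (μ := Q) _ hA, h2, add_zero]
  have hinv' : Kernel.Invariant (envKernel d) Q[|A] := by
    refine Measure.ext fun B hB => ?_
    rw [Measure.bind_apply hB (Kernel.aemeasurable _), cond_apply hA, ProbabilityTheory.cond,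
      lintegral_smul_measure, hrestr B hB, smul_eq_mul]
  -- Almost sure limits under `Q` persist under a law absolutely continuous with respect to it, so
  -- the conditioned law must equal `Q` and gives no mass to `Aᶜ`.
  have h' : IsLimitLaw Q[|A] u Q := fun k Ψ hΨ hk hb =>
    (Measure.AbsolutelyContinuous.compProd_left hac (quenched 0)).ae_le (h k Ψ hΨ hk hb)
  have hQ := eq_of_invariant hinv' h'
  rw [← hQ, cond_apply hA, Set.inter_compl_self, measure_empty, mul_zero]

/-! ### Bounded steps and closeness to the i.i.d. law ahead -/

theorem quenchedLaw_jump_ne_zero (z : Site d) (ω : Env d) :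
    ∀ᵐ X ∂(quenchedLaw z ω), ∀ n, ω (X n) (X (n + 1) - X n) ≠ 0 := by
  rw [ae_all_iff]
  intro n
  have hdet : PrefixDet (n + 1) {X : ℕ → Site d | ω (X n) (X (n + 1) - X n) = 0} := by
    intro X X' h hX
    change ω (X' n) (X' (n + 1) - X' n) = 0
    rw [← h n (by omega), ← h (n + 1) le_rfl]
    exact hX
  have h0 : quenchedLaw z ω {X : ℕ → Site d | ω (X n) (X (n + 1) - X n) = 0} = 0 := by
    rw [measure_prefix _ (n + 1) hdet.measurableSet, ENNReal.tsum_eq_zero]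
    intro p
    by_cases hp : ω (ext (n + 1) p n) (ext (n + 1) p (n + 1) - ext (n + 1) p n) = 0
    · refine measure_mono_null Set.inter_subset_left ?_
      rw [quenchedLaw_cyl, wt, prod_range_succ, hp, mul_zero, ite_self]
    · refine measure_mono_null (t := ∅) (fun X hX => hp ?_) measure_empty
      rw [← hX.1 n (by omega), ← hX.1 (n + 1) le_rfl]
      exact hX.2
  exact measure_eq_zero_iff_ae_notMem.1 h0

/-- The level of the path changes by at most `c` in one step. -/
def BddStep (u : Site d) (c : ℕ) (X : ℕ → Site d) : Prop :=
  ∀ n, |X (n + 1) ⬝ᵥ u - X n ⬝ᵥ u| ≤ c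

theorem BddStep.abs_sub_le {u : Site d} {c : ℕ} {X : ℕ → Site d} (h : BddStep u c X) (n m : ℕ) :
    |X (n + m) ⬝ᵥ u - X n ⬝ᵥ u| ≤ c * m := by
  induction m with
  | zero => simp
  | succ m ih =>
    have h1 := h (n + m)
    have h2 := abs_add_le (X (n + m + 1) ⬝ᵥ u - X (n + m) ⬝ᵥ u) (X (n + m) ⬝ᵥ u - X n ⬝ᵥ u)
    rw [sub_add_sub_cancel] at h2
    rw [← add_assoc]
    push_cast
    linarith

theorem measurableSet_bddStep (u : Site d) (c : ℕ) : MeasurableSet {X | BddStep u c X} := by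
  have : {X | BddStep u c X} = ⋂ n, {X | |X (n + 1) ⬝ᵥ u - X n ⬝ᵥ u| ≤ c} := by
    ext X; simp [BddStep]
  rw [this]
  refine .iInter fun n => ?_
  have h : Measurable fun X : ℕ → Site d => (X (n + 1) ⬝ᵥ u, X n ⬝ᵥ u) :=
    (measurable_level u (n + 1)).prodMk (measurable_level u n)
  exact h (Set.to_countable {p : ℤ × ℤ | |p.1 - p.2| ≤ c}).measurableSet

theorem abs_dotProduct_le {M : ℝ} {z : Site d} (hz : euclNorm z ≤ M) (u : Site d) :
    |z ⬝ᵥ u| ≤ (⌈M⌉₊ * ∑ i, (u i).natAbs : ℕ) := by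
  have h1 : ∀ i, |z i| ≤ (⌈M⌉₊ : ℤ) := by
    intro i
    have h2 : |((z i : ℤ) : ℝ)| ≤ M := by
      refine le_trans ?_ hz
      rw [← Real.sqrt_sq_eq_abs]
      exact Real.sqrt_le_sqrt (single_le_sum (f := fun i => ((z i : ℤ) : ℝ) ^ 2)
        (fun _ _ => sq_nonneg _) (mem_univ i))
    have h3 := h2.trans (Nat.le_ceil M)
    exact_mod_cast h3
  rw [dotProduct]
  push_cast
  rw [mul_sum]
  refine (abs_sum_le_sum_abs _ _).trans (sum_le_sum fun i _ => ?_)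
  rw [abs_mul]
  exact mul_le_mul_of_nonneg_right (h1 i) (abs_nonneg _)

theorem ae_bddStep {μ : Measure (Env d)} [IsProbabilityMeasure μ] {M : ℝ}
    (h : ∀ x z : Site d, M < euclNorm z → ∀ᵐ ω ∂μ, ω x z = 0) (u : Site d) :
    ∀ᵐ q ∂(jointLaw μ 0), BddStep u (⌈M⌉₊ * ∑ i, (u i).natAbs) q.2 := by
  have h1 : ∀ᵐ ω ∂μ, ∀ x z : Site d, M < euclNorm z → ω x z = 0 := by
    simp only [ae_all_iff]
    exact h
  have hms : MeasurableSet {q : Env d × (ℕ → Site d) | BddStep u (⌈M⌉₊ * ∑ i, (u i).natAbs) q.2} :=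
    measurable_snd (measurableSet_bddStep u _)
  rw [jointLaw, Measure.ae_compProd_iff hms]
  filter_upwards [h1] with ω hω
  filter_upwards [quenchedLaw_jump_ne_zero 0 ω] with X hX n
  rw [← sub_dotProduct]
  exact abs_dotProduct_le (not_lt.1 fun hlt => hX n (hω _ _ hlt)) u

theorem bddStep_regenPath {u : Site d} {c : ℕ} {X : ℕ → Site d} (h : BddStep u c X) :
    BddStep u c (regenPath u X) := by
  intro n
  simp only [regenPath, sub_dotProduct, sub_sub_sub_cancel_right]
  exact h _

/-- Chebyshev's trade of powers: above the threshold `b`, a lower power of `t` costs the factor `b ^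
(s - p)` against the `p`-th power. -/
theorem rpow_le_rpow_mul {b t : ℝ≥0∞} (hbt : b ≤ t) (hb : b ≠ 0) (ht : t ≠ ∞) {s p : ℝ}
    (hs : s ≤ p) : t ^ s ≤ b ^ (s - p) * t ^ p := by
  have ht0 : t ≠ 0 := fun h => hb (le_antisymm (h ▸ hbt) zero_le)
  have h1 : t ^ s = t ^ (s - p) * t ^ p := by
    rw [← ENNReal.rpow_add _ _ ht0 ht, sub_add_cancel]
  rw [h1]
  gcongr ?_ * _
  rw [← neg_sub, ENNReal.rpow_neg, ENNReal.rpow_neg]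
  exact ENNReal.inv_le_inv.2 (ENNReal.rpow_le_rpow hbt (by linarith))

/-- Times that lie well below the past maximum sit in long regeneration blocks. -/
theorem sum_backtrack_le {u : Site d} {c ℓ : ℕ} (hℓ : 1 ≤ ℓ) {X : ℕ → Site d} (hg : Good u X)
    (hc : BddStep u c X) (n : ℕ) [DecidablePred fun j => ∃ m < j, X j ⬝ᵥ u + ℓ ≤ X m ⬝ᵥ u] :
    ∑ j ∈ range n, (if ∃ m < j, X j ⬝ᵥ u + ℓ ≤ X m ⬝ᵥ u then 1 else 0)
      ≤ ∑ i ∈ range n, (if ℓ ≤ c * nxt u 1 ((regenPath u)^[i] X)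
          then nxt u 1 ((regenPath u)^[i] X) else 0) := by
  have h1 : ∀ n, ∑ j ∈ range (tau u X n), (if ∃ m < j, X j ⬝ᵥ u + ℓ ≤ X m ⬝ᵥ u then 1 else 0)
      ≤ ∑ i ∈ range n, (if ℓ ≤ c * nxt u 1 ((regenPath u)^[i] X)
          then nxt u 1 ((regenPath u)^[i] X) else 0) := by
    intro n
    induction n with
    | zero => simp [tau_zero]
    | succ n ih =>
      rw [tau_succ, sum_range_add, sum_range_succ]
      refine add_le_add ih ?_
      split_ifs with hlong
      · refine (sum_le_card_nsmul _ _ 1 fun j _ => ?_).trans (by simp)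
        split_ifs <;> simp
      · refine (sum_eq_zero fun j hj => if_neg ?_).le
        rintro ⟨m, hm, hlev⟩
        refine hlong ?_
        have hj' := mem_range.1 hj
        -- A regeneration between `m` and the backtracked time would separate their levels the wrong
        -- way, so both lie in one block; a drop of `ℓ` at speed at most `c` then needs length `ℓ /
        -- c`.
        have hτm : tau u X n ≤ m := by
          by_contra hlt
          cases n with
          | zero => simp [tau_zero] at hlt
          | succ n =>
            have hr := hg.isRegeneration_tau n
            have h2 := hr.2.1 m (by omega)
            have h3 := hr.2.2 (tau u X (n + 1) + j) (by omega)
            omega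
        obtain ⟨e, rfl⟩ := Nat.exists_eq_add_of_le hτm
        obtain ⟨f, hf⟩ := Nat.exists_eq_add_of_lt hm
        have h4 := hc.abs_sub_le (tau u X n + e) (f + 1)
        rw [← add_assoc, ← hf, abs_le] at h4
        have h5 : c * (f + 1) ≤ c * nxt u 1 ((regenPath u)^[n] X) :=
          Nat.mul_le_mul_left c (by omega)
        have h6 : ((c * (f + 1) : ℕ) : ℤ) ≤ (c * nxt u 1 ((regenPath u)^[n] X) : ℕ) := by
          exact_mod_cast h5
        push_cast at h4 h6
        have : (ℓ : ℤ) ≤ (c * nxt u 1 ((regenPath u)^[n] X) : ℕ) := by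
          push_cast
          linarith [h4.1]
        exact_mod_cast this
  exact (sum_le_sum_of_subset (range_subset_range.2 hg.strictMono_tau.le_apply)).trans (h1 n)

section System

variable {ν : Measure (PMF (Site d))} [IsProbabilityMeasure ν] {u : Site d}
  (hreg : ∀ᵐ q ∂(jointLaw (iid ν) 0), q.2 ∈ hasRegen u 1)
include hreg

theorem lintegral_regenLaw_snd_le {g : (ℕ → Site d) → ℝ≥0∞} (hg : Measurable g) :
    ∫⁻ q, g q.2 ∂(regenLaw ν u) ≤ (stayProb ν u)⁻¹ * ∫⁻ q, g q.2 ∂(jointLaw (iid ν) 0) := by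
  have h1 : (regenLaw ν u).map Prod.snd ≤ (stayProb ν u)⁻¹ • (jointLaw (iid ν) 0).map Prod.snd := by
    refine Measure.le_iff.2 fun D hD => ?_
    rw [Measure.map_apply measurable_snd hD, regenLaw_apply hreg (measurable_snd hD),
      Measure.smul_apply, Measure.map_apply measurable_snd hD, smul_eq_mul]
    gcongr
    exact fun q hq => hq.2
  rw [← lintegral_map hg measurable_snd, ← lintegral_map hg measurable_snd, ← smul_eq_mul,
    ← lintegral_smul_measure]
  exact lintegral_mono' h1 le_rfl

/-- The initial block has the unconditioned law and later blocks the conditioned one, whose density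
is at most `(stayProb ν u)⁻¹`; this factor covers both cases. -/
theorem lintegral_jointLaw_iterate_le {g : (ℕ → Site d) → ℝ≥0∞} (hg : Measurable g) (i : ℕ) :
    ∫⁻ q, g ((regenPath u)^[i] q.2) ∂(jointLaw (iid ν) 0)
      ≤ (stayProb ν u)⁻¹ * ∫⁻ q, g q.2 ∂(jointLaw (iid ν) 0) := by
  cases i with
  | zero =>
    refine le_mul_of_one_le_left zero_le ?_
    exact ENNReal.one_le_inv.2 prob_le_one
  | succ i =>
    refine le_trans (le_of_eq ?_) (lintegral_regenLaw_snd_le hreg hg)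
    rw [← lintegral_path_iterate hreg hg i, regenLaw, lintegral_map _ (measurable_regenMap u)]
    · rfl
    · exact hg.comp (((measurable_regenPath u).iterate i).comp measurable_snd)

/-- The averaged probability of lying well below the past maximum. -/
theorem sum_jointLaw_backtrack_le {c : ℕ}
    (hc : ∀ᵐ q ∂(jointLaw (iid ν) 0), BddStep u c q.2) {p : ℝ} (hp : 1 ≤ p) {ℓ : ℕ} (hℓ : 1 ≤ ℓ)
    (n : ℕ) :
    ∑ j ∈ range n, jointLaw (iid ν) 0 {q | ∃ m < j, q.2 j ⬝ᵥ u + ℓ ≤ q.2 m ⬝ᵥ u}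
      ≤ n * ((stayProb ν u)⁻¹ * (((ℓ : ℝ≥0∞) / c) ^ (1 - p) *
        ∫⁻ q, (nxt u 1 q.2 : ℝ≥0∞) ^ p ∂(jointLaw (iid ν) 0))) := by
  classical
  have hm : ∀ j, MeasurableSet {q : Env d × (ℕ → Site d) |
      ∃ m < j, q.2 j ⬝ᵥ u + ℓ ≤ q.2 m ⬝ᵥ u} := by
    intro j
    have : {q : Env d × (ℕ → Site d) | ∃ m < j, q.2 j ⬝ᵥ u + ℓ ≤ q.2 m ⬝ᵥ u}
        = ⋃ m, ⋃ _ : m < j, {q | q.2 j ⬝ᵥ u + ℓ ≤ q.2 m ⬝ᵥ u} := by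
      ext q; simp
    rw [this]
    refine .iUnion fun m => .iUnion fun _ => ?_
    exact measurableSet_le (((measurable_level u j).comp measurable_snd).add measurable_const)
      ((measurable_level u m).comp measurable_snd)
  let g : (ℕ → Site d) → ℝ≥0∞ := fun X => ((if ℓ ≤ c * nxt u 1 X then nxt u 1 X else 0 : ℕ) : ℝ≥0∞)
  have hgm : Measurable g :=
    (measurable_of_countable fun T : ℕ => ((if ℓ ≤ c * T then T else 0 : ℕ) : ℝ≥0∞)).comp
      (measurable_nxt u 1)
  have hgle : ∀ X, g X ≤ ((ℓ : ℝ≥0∞) / c) ^ (1 - p) * (nxt u 1 X : ℝ≥0∞) ^ p := by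
    intro X
    by_cases h : ℓ ≤ c * nxt u 1 X
    · have h1 := rpow_le_rpow_mul (b := (ℓ : ℝ≥0∞) / c) (t := nxt u 1 X)
        (ENNReal.div_le_of_le_mul (by rw [mul_comm]; exact_mod_cast h))
        (ENNReal.div_ne_zero.2 ⟨by exact_mod_cast (by omega : ℓ ≠ 0), ENNReal.natCast_ne_top c⟩)
        (ENNReal.natCast_ne_top _) hp
      rw [ENNReal.rpow_one] at h1
      simpa only [g, if_pos h] using h1
    · simp [g, if_neg h]
  calc ∑ j ∈ range n, jointLaw (iid ν) 0 {q | ∃ m < j, q.2 j ⬝ᵥ u + ℓ ≤ q.2 m ⬝ᵥ u}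
      = ∫⁻ q, ∑ j ∈ range n, (if ∃ m < j, q.2 j ⬝ᵥ u + ℓ ≤ q.2 m ⬝ᵥ u then 1 else 0)
          ∂(jointLaw (iid ν) 0) := by
        have : ∀ j, jointLaw (iid ν) 0 {q | ∃ m < j, q.2 j ⬝ᵥ u + ℓ ≤ q.2 m ⬝ᵥ u}
            = ∫⁻ q, (if ∃ m < j, q.2 j ⬝ᵥ u + ℓ ≤ q.2 m ⬝ᵥ u then 1 else 0)
              ∂(jointLaw (iid ν) 0) := by
          intro j
          rw [← lintegral_indicator_one (hm j)]
          refine lintegral_congr fun q => ?_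
          rw [Set.indicator_apply]
          rfl
        rw [lintegral_finsetSum _ fun j _ => Measurable.ite (hm j) measurable_const
          measurable_const]
        exact sum_congr rfl fun j _ => this j
    _ ≤ ∫⁻ q, ∑ i ∈ range n, g ((regenPath u)^[i] q.2) ∂(jointLaw (iid ν) 0) := by
        refine lintegral_mono_ae ?_
        filter_upwards [ae_good hreg, hc] with q hg hq
        have := sum_backtrack_le hℓ hg hq n
        simp only [g]
        exact_mod_cast this
    _ = ∑ i ∈ range n, ∫⁻ q, g ((regenPath u)^[i] q.2) ∂(jointLaw (iid ν) 0) :=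
        lintegral_finsetSum _ fun i _ =>
          hgm.comp (((measurable_regenPath u).iterate i).comp measurable_snd)
    _ ≤ ∑ i ∈ range n, ((stayProb ν u)⁻¹ * (((ℓ : ℝ≥0∞) / c) ^ (1 - p) *
        ∫⁻ q, (nxt u 1 q.2 : ℝ≥0∞) ^ p ∂(jointLaw (iid ν) 0))) := by
        refine sum_le_sum fun i _ => (lintegral_jointLaw_iterate_le hreg hgm i).trans ?_
        gcongr
        have hpm : Measurable fun q : Env d × (ℕ → Site d) => (nxt u 1 q.2 : ℝ≥0∞) ^ p :=
          (measurable_of_countable fun T : ℕ => (T : ℝ≥0∞) ^ p).comp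
            ((measurable_nxt u 1).comp measurable_snd)
        rw [← lintegral_const_mul _ hpm]
        exact lintegral_mono fun q => hgle q.2
    _ = _ := by simp

omit hreg in
/-- Environments seen from a time that does not lie well below the past maximum are fresh. -/
theorem jointLaw_theta_mem_le {c : ℕ} (hc : ∀ᵐ q ∂(jointLaw (iid ν) 0), BddStep u c q.2) {ℓ : ℕ}
    {A : Set (Env d)} (hA : MeasurableSet[siteSigma (above u ℓ)] A) (j : ℕ) :
    jointLaw (iid ν) 0 {q | (theta j q).1 ∈ A}
      ≤ iid ν A + jointLaw (iid ν) 0 {q | ∃ m < j, q.2 j ⬝ᵥ u + ℓ ≤ q.2 m ⬝ᵥ u} := by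
  have hAm : MeasurableSet A := siteSigma_le _ _ hA
  -- The sites used before time `j` lie below the region inspected by `A`. The second condition,
  -- automatic for bounded steps, only supplies the deterministic level `L` that the renewal lemma
  -- asks for.
  set S : Set (ℕ → Site d) := {X | (∀ m < j, X m ⬝ᵥ u < X j ⬝ᵥ u + ℓ) ∧
    -((c : ℤ) * j) + ℓ ≤ X j ⬝ᵥ u + ℓ} with hS
  have hSdet : PrefixDet j S := by
    intro X X' h hX
    refine ⟨fun m hm => ?_, ?_⟩
    · rw [← h m hm.le, ← h j le_rfl]; exact hX.1 m hm
    · rw [← h j le_rfl]; exact hX.2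
  have hF : MeasurableSet {q : Env d × (ℕ → Site d) | q.1 ∈ A} := measurable_fst hAm
  have key := jointLaw_renewal ν (ℓ := ℓ) (L := -((c : ℤ) * j) + ℓ) hSdet (fun X hX => hX)
    (E := Set.univ) (@MeasurableSet.univ _ (siteSigma _)) hF (fun ω => by
      have h1 := keep_mem_iff hA ω
      by_cases hω : ω ∈ A
      · rw [show Prod.mk (keep (above u ℓ) ω) ⁻¹' {q : Env d × (ℕ → Site d) | q.1 ∈ A} = Set.univ
            from Set.eq_univ_of_forall fun X => h1.2 hω,
          show Prod.mk ω ⁻¹' {q : Env d × (ℕ → Site d) | q.1 ∈ A} = Set.univ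
            from Set.eq_univ_of_forall fun X => hω, measure_univ, measure_univ]
      · rw [show Prod.mk (keep (above u ℓ) ω) ⁻¹' {q : Env d × (ℕ → Site d) | q.1 ∈ A} = ∅
            from Set.eq_empty_of_forall_notMem fun X hX => hω (h1.1 hX),
          show Prod.mk ω ⁻¹' {q : Env d × (ℕ → Site d) | q.1 ∈ A} = ∅
            from Set.eq_empty_of_forall_notMem fun X hX => hω hX, measure_empty, measure_empty])
  have hFA : jointLaw (iid ν) 0 {q | q.1 ∈ A} = iid ν A := by
    conv_rhs => rw [← jointLaw_fst (iid ν) 0, Measure.fst_apply hAm]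
    rfl
  calc jointLaw (iid ν) 0 {q | (theta j q).1 ∈ A}
      ≤ jointLaw (iid ν) 0 ({q | q.1 ∈ Set.univ ∧ q.2 ∈ S ∧ theta j q ∈ {q | q.1 ∈ A}} ∪
          {q | ∃ m < j, q.2 j ⬝ᵥ u + ℓ ≤ q.2 m ⬝ᵥ u}) := by
        refine measure_mono_ae ?_
        filter_upwards [hc, jointLaw_start (iid ν) 0] with q hq h0 hqA
        by_cases hb : ∃ m < j, q.2 j ⬝ᵥ u + ℓ ≤ q.2 m ⬝ᵥ u
        · exact Or.inr hb
        · refine Or.inl ⟨trivial, ⟨fun m hm => not_le.1 fun hle => hb ⟨m, hm, hle⟩, ?_⟩, hqA⟩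
          have := hq.abs_sub_le 0 j
          rw [zero_add, h0, zero_dotProduct, sub_zero, abs_le] at this
          linarith [this.1]
    _ ≤ _ := measure_union_le _ _
    _ ≤ _ := by
        gcongr
        rw [key, hFA]
        exact mul_le_of_le_one_left zero_le prob_le_one

/-- The invariant law is close to the original one far in the direction `u`. -/
theorem IsLimitLaw.measureReal_sub_le {Q : Measure (Env d)} [IsProbabilityMeasure Q]
    (hQ : IsLimitLaw (iid ν) u Q) {c : ℕ} (hc0 : c ≠ 0)
    (hc : ∀ᵐ q ∂(jointLaw (iid ν) 0), BddStep u c q.2) {p : ℝ} (hp : 1 ≤ p)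
    (hmom : ∫⁻ q, (nxt u 1 q.2 : ℝ≥0∞) ^ p ∂(jointLaw (iid ν) 0) ≠ ∞) {ℓ : ℕ} (hℓ : 1 ≤ ℓ)
    {A : Set (Env d)} (hA : MeasurableSet[siteSigma (above u ℓ)] A) :
    Q.real A - (iid ν).real A ≤ ((stayProb ν u)⁻¹ * ((c : ℝ≥0∞) ^ (p - 1) *
        ∫⁻ q, (nxt u 1 q.2 : ℝ≥0∞) ^ p ∂(jointLaw (iid ν) 0))).toReal * (ℓ : ℝ) ^ (1 - p) := by
  set m := ∫⁻ q, (nxt u 1 q.2 : ℝ≥0∞) ^ p ∂(jointLaw (iid ν) 0)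
  have hAm : MeasurableSet A := siteSigma_le _ _ hA
  have hℓ0 : (ℓ : ℝ≥0∞) ≠ 0 := by exact_mod_cast (by omega : ℓ ≠ 0)
  have hc0' : (c : ℝ≥0∞) ≠ 0 := by exact_mod_cast hc0
  have hk : LocalAbove u 0 (· ∈ A) := fun ω => by
    refine propext ?_
    change keep _ ω ∈ A ↔ ω ∈ A
    rw [← keep_mem_iff hA, keep_keep (above_anti u (by simp)), keep_mem_iff hA]
  have h1 := hQ.tendsto_measureReal hAm hk
  set B := (stayProb ν u)⁻¹ * (((ℓ : ℝ≥0∞) / c) ^ (1 - p) * m) with hB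
  have hBtop : B ≠ ∞ := by
    refine ENNReal.mul_ne_top (ENNReal.inv_ne_top.2 (stayProb_ne_zero hreg))
      (ENNReal.mul_ne_top ?_ hmom)
    refine ENNReal.rpow_ne_top_of_ne_zero (ENNReal.div_ne_zero.2 ⟨hℓ0, ENNReal.natCast_ne_top c⟩)
      (ENNReal.div_ne_top (ENNReal.natCast_ne_top ℓ) hc0')
  have h2 : ∀ᶠ n : ℕ in atTop, (n : ℝ)⁻¹ * ∑ j ∈ range n,
      (jointLaw (iid ν) 0).real {q | (theta j q).1 ∈ A} ≤ (iid ν).real A + B.toReal := by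
    filter_upwards [eventually_gt_atTop 0] with n hn
    have hn' : (0 : ℝ) < n := by exact_mod_cast hn
    rw [inv_mul_le_iff₀ hn']
    have h3 : ∑ j ∈ range n, jointLaw (iid ν) 0 {q | (theta j q).1 ∈ A}
        ≤ n * (iid ν A + B) := by
      refine (sum_le_sum fun j _ => jointLaw_theta_mem_le hc hA j).trans ?_
      rw [sum_add_distrib, mul_add]
      refine add_le_add (by simp) (sum_jointLaw_backtrack_le hreg hc hp hℓ n)
    have h4 := ENNReal.toReal_mono (ENNReal.mul_ne_top (ENNReal.natCast_ne_top n)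
      (ENNReal.add_ne_top.2 ⟨measure_ne_top _ _, hBtop⟩)) h3
    rw [ENNReal.toReal_sum fun j _ => measure_ne_top _ _, ENNReal.toReal_mul,
      ENNReal.toReal_add (measure_ne_top _ _) hBtop, ENNReal.toReal_natCast] at h4
    exact h4
  have h5 := le_of_tendsto h1 h2
  have h6 : B.toReal = ((stayProb ν u)⁻¹ * ((c : ℝ≥0∞) ^ (p - 1) * m)).toReal
      * (ℓ : ℝ) ^ (1 - p) := by
    have : ((ℓ : ℝ≥0∞) / c) ^ (1 - p) = (ℓ : ℝ≥0∞) ^ (1 - p) * (c : ℝ≥0∞) ^ (p - 1) := by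
      rw [div_eq_mul_inv, ENNReal.mul_rpow_of_ne_top (ENNReal.natCast_ne_top ℓ)
        (ENNReal.inv_ne_top.2 hc0'), ENNReal.inv_rpow, ← ENNReal.rpow_neg, neg_sub]
    rw [hB, this]
    simp only [ENNReal.toReal_mul, ← ENNReal.toReal_rpow, ENNReal.toReal_natCast]
    ring
  linarith

end System

/-! ### Backtracking and slow progress under the limit law -/

theorem measurable_backtrack (u : Site d) :
    Measurable fun X : ℕ → Site d => (⨅ n : ℕ, (((X n ⬝ᵥ u : ℤ) : ℝ) : EReal)).abs := by
  have h1 : Measurable EReal.abs := EReal.measurable_of_measurable_real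
    (f := EReal.abs) (ENNReal.measurable_ofReal.comp measurable_abs)
  refine h1.comp (.iInf fun n => ?_)
  exact (measurable_of_countable fun l : ℤ => ((l : ℝ) : EReal)).comp (measurable_level u n)

theorem abs_iInf_le {f : ℕ → ℤ} {b : ℕ} (h0 : f 0 = 0) (hf : ∀ n, -(b : ℤ) ≤ f n) :
    (⨅ n, ((f n : ℝ) : EReal)).abs ≤ b := by
  have h1 : (⨅ n, ((f n : ℝ) : EReal)) ≤ ((0 : ℝ) : EReal) := by
    refine (iInf_le _ 0).trans ?_
    rw [h0]
    simp
  have h2 : ((-(b : ℝ) : ℝ) : EReal) ≤ ⨅ n, ((f n : ℝ) : EReal) := by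
    refine le_iInf fun n => EReal.coe_le_coe ?_
    exact_mod_cast hf n
  induction hy : (⨅ n, ((f n : ℝ) : EReal)) with
  | bot => rw [hy, le_bot_iff] at h2; exact absurd h2 (EReal.coe_ne_bot _)
  | top => rw [hy, top_le_iff] at h1; exact absurd h1 (EReal.coe_ne_top _)
  | coe x =>
    rw [hy, EReal.coe_le_coe_iff] at h1 h2
    rw [EReal.abs_def, abs_of_nonpos h1]
    refine ENNReal.ofReal_le_of_le_toReal ?_
    rw [ENNReal.toReal_natCast]
    linarith

/-- Slow progress after a time in the first block forces a long block. -/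
theorem Good.exists_long_block {u : Site d} {X : ℕ → Site d} (hg : Good u X) {m n s : ℕ}
    (hm : m < nxt u 1 X) (hs : X (m + n) ⬝ᵥ u - X m ⬝ᵥ u ≤ s) :
    ∃ l < s + 1, n < (s + 1) * nxt u 1 ((regenPath u)^[l] X) := by
  obtain ⟨i, hi, hi'⟩ := exists_block hg.strictMono_tau (tau_zero u X) (m + n)
  -- Each completed block raises the level by at least one, so a gain of at most `s` keeps time `m +
  -- n` within block `s`, and `n` is less than the total length of `s + 1` blocks. Some block then
  -- has length more than `n / (s + 1)`.
  have his : i ≤ s := by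
    cases i with
    | zero => omega
    | succ i =>
      have hτ : tau u X 1 = nxt u 1 X := by simp [tau]
      have h1 := (hg.isRegeneration_tau 0).2.1 m (by rw [zero_add, hτ]; exact hm)
      have h2 := hg.level_tau_add 1 i
      have h3 := (hg.isRegeneration_tau i).2.2 (m + n) hi
      rw [add_comm 1 i] at h2
      rw [zero_add] at h1
      omega
  have h4 : n < tau u X (s + 1) :=
    ((Nat.le_add_left n m).trans_lt hi').trans_le (hg.strictMono_tau.monotone (by omega))
  obtain ⟨l, hl, hl'⟩ := exists_lt_of_sum_lt (s := range (s + 1)) (f := fun _ => n)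
    (g := fun l => (s + 1) * nxt u 1 ((regenPath u)^[l] X)) (by
      rw [sum_const, card_range, smul_eq_mul, ← mul_sum]
      exact Nat.mul_lt_mul_of_pos_left h4 (by omega))
  exact ⟨l, mem_range.1 hl, hl'⟩

section System

variable {ν : Measure (PMF (Site d))} [IsProbabilityMeasure ν] {u : Site d}

omit [IsProbabilityMeasure ν] in
theorem ae_regenLaw_bddStep {c : ℕ} (hc : ∀ᵐ q ∂(jointLaw (iid ν) 0), BddStep u c q.2) :
    ∀ᵐ q ∂(regenLaw ν u), BddStep u c q.2 := by
  have hms : MeasurableSet {q : Env d × (ℕ → Site d) | BddStep u c q.2} :=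
    measurable_snd (measurableSet_bddStep u c)
  rw [regenLaw, ae_map_iff (measurable_regenMap u).aemeasurable hms]
  exact hc.mono fun q hq => bddStep_regenPath hq

variable (hreg : ∀ᵐ q ∂(jointLaw (iid ν) 0), q.2 ∈ hasRegen u 1)
include hreg

/-- The first block is independent of the path after it. -/
theorem regenLaw_nxt_inter {G : Set (ℕ → Site d)} (hG : MeasurableSet G) (j : ℕ) :
    regenLaw ν u {q | nxt u 1 q.2 = j ∧ regenPath u q.2 ∈ G}
      = regenLaw ν u {q | nxt u 1 q.2 = j} * regenLaw ν u {q | q.2 ∈ G} := by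
  have hj : MeasurableSet {q : Env d × (ℕ → Site d) | nxt u 1 q.2 = j} :=
    ((measurable_nxt u 1).comp measurable_snd) (measurableSet_singleton j)
  have hGm : MeasurableSet {q : Env d × (ℕ → Site d) | q.2 ∈ G} := measurable_snd hG
  have hjG : MeasurableSet {q : Env d × (ℕ → Site d) | nxt u 1 q.2 = j ∧ regenPath u q.2 ∈ G} :=
    hj.inter (((measurable_regenPath u).comp measurable_snd) hG)
  have h := jointLaw_nxt_mul hreg (E := Set.univ) .univ
    ((nxtDet_nxt_eq u 1 j).inter (nxtDet_stay u 1)) (measurableSet_stay_res u hGm)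
    (rightSet_res u {q : Env d × (ℕ → Site d) | q.2 ∈ G})
  rw [regenLaw_apply hreg hjG, regenLaw_apply hreg hj, regenLaw_apply hreg hGm]
  have e1 : jointLaw (iid ν) 0 {q | q.1 ∈ Set.univ ∧
      q.2 ∈ {X | nxt u 1 X = j} ∩ stay u ∧
      theta (nxt u 1 q.2) q ∈ {q | q.2 ∈ stay u ∧ res u 0 q ∈ {q | q.2 ∈ G}}}
      = jointLaw (iid ν) 0 {q | q.2 ∈ stay u ∧
        res u 0 q ∈ {q | nxt u 1 q.2 = j ∧ regenPath u q.2 ∈ G}} := by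
    refine measure_congr_iff ?_
    filter_upwards [hreg] with q hq
    have := theta_nxt_mem_stay hq
    constructor
    · exact fun h => ⟨h.2.1.2, h.2.1.1, h.2.2.2⟩
    · exact fun h => ⟨trivial, ⟨h.2.1, h.1⟩, this, h.2.2⟩
  have e2 : jointLaw (iid ν) 0 {q | q.1 ∈ Set.univ ∧ q.2 ∈ {X | nxt u 1 X = j} ∩ stay u}
      = jointLaw (iid ν) 0 {q | q.2 ∈ stay u ∧ res u 0 q ∈ {q | nxt u 1 q.2 = j}} := by
    refine measure_congr_iff (ae_of_all _ fun q => ?_)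
    exact ⟨fun h => ⟨h.2.2, h.2.1⟩, fun h => ⟨trivial, h.2, h.1⟩⟩
  rw [e1, e2] at h
  set x := jointLaw (iid ν) 0 {q | q.2 ∈ stay u ∧
    res u 0 q ∈ {q | nxt u 1 q.2 = j ∧ regenPath u q.2 ∈ G}}
  have hx : x = x * stayProb ν u * (stayProb ν u)⁻¹ := by
    rw [mul_assoc, ENNReal.mul_inv_cancel (stayProb_ne_zero hreg) stayProb_ne_top, mul_one]
  rw [hx, h]
  ring

/-- Sampling a uniform time size-biases the first block; since that block's length is independent of
what follows, the bias contributes only the factor `meanLen ν u`. -/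
theorem lintegral_nxt_indicator {G : Set (ℕ → Site d)} (hG : MeasurableSet G) :
    ∫⁻ q in {q | regenPath u q.2 ∈ G}, (nxt u 1 q.2 : ℝ≥0∞) ∂(regenLaw ν u)
      = meanLen ν u * regenLaw ν u {q | q.2 ∈ G} := by
  have hT : Measurable fun q : Env d × (ℕ → Site d) => nxt u 1 q.2 :=
    (measurable_nxt u 1).comp measurable_snd
  have h1 : ((regenLaw ν u).restrict {q | regenPath u q.2 ∈ G}).map (fun q => nxt u 1 q.2)
      = (regenLaw ν u {q | q.2 ∈ G}) • (regenLaw ν u).map fun q => nxt u 1 q.2 := by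
    refine Measure.ext_iff_singleton.2 fun j => ?_
    rw [Measure.map_apply hT (measurableSet_singleton j),
      Measure.restrict_apply (hT (measurableSet_singleton j)), Measure.smul_apply,
      Measure.map_apply hT (measurableSet_singleton j), smul_eq_mul, mul_comm]
    exact regenLaw_nxt_inter hreg hG j
  have h2 : Measurable fun j : ℕ => (j : ℝ≥0∞) := measurable_of_countable _
  rw [← lintegral_map h2 hT, h1, lintegral_smul_measure, lintegral_map h2 hT, smul_eq_mul, mul_comm]
  rfl

variable (hlen : meanLen ν u ≠ ∞)
include hlen

theorem IsLimitLaw.lintegral_averagedLaw {Q : Measure (Env d)} [IsProbabilityMeasure Q]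
    (hQ : IsLimitLaw (iid ν) u Q) {f : (ℕ → Site d) → ℝ≥0∞} (hf : Measurable f) :
    ∫⁻ X, f X ∂(averagedLaw Q 0) = (meanLen ν u)⁻¹ *
      ∫⁻ q, ∑ m ∈ range (nxt u 1 q.2), f (fun n => q.2 (m + n) - q.2 m) ∂(regenLaw ν u) := by
  rw [hQ.averagedLaw_eq hreg hlen, lintegral_map hf measurable_snd]
  exact lintegral_blockLaw ν u 0 (hf.comp measurable_snd)

/-- Moments of the backtracking under the invariant law. -/
theorem IsLimitLaw.lintegral_backtrack_le {Q : Measure (Env d)} [IsProbabilityMeasure Q]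
    (hQ : IsLimitLaw (iid ν) u Q) {c : ℕ} (hc0 : c ≠ 0)
    (hc : ∀ᵐ q ∂(jointLaw (iid ν) 0), BddStep u c q.2) {p r : ℝ} (hr0 : 0 ≤ r) (hr : r ≤ p - 1) :
    ∫⁻ X, (⨅ n : ℕ, (((X n ⬝ᵥ u : ℤ) : ℝ) : EReal)).abs ^ r ∂(averagedLaw Q 0)
      ≤ (meanLen ν u)⁻¹ * ((c : ℝ≥0∞) ^ p * ∫⁻ q, (nxt u 1 q.2 : ℝ≥0∞) ^ p ∂(regenLaw ν u)) := by
  have hpm : Measurable fun q : Env d × (ℕ → Site d) => (nxt u 1 q.2 : ℝ≥0∞) ^ p :=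
    (measurable_of_countable fun T : ℕ => (T : ℝ≥0∞) ^ p).comp
      ((measurable_nxt u 1).comp measurable_snd)
  rw [hQ.lintegral_averagedLaw hreg hlen ((measurable_backtrack u).pow_const r),
    ← lintegral_const_mul _ hpm]
  refine mul_le_mul_right (lintegral_mono_ae ?_) _
  filter_upwards [ae_regenLaw_good hreg, ae_regenLaw_bddStep hc] with q hg hq
  have hT : 1 ≤ nxt u 1 q.2 := one_le_nxt (hg.1.2 0)
  set T := nxt u 1 q.2
  have hT0 : (T : ℝ≥0∞) ≠ 0 := by exact_mod_cast (by omega : T ≠ 0)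
  -- During the first block the level is at most `c * T`, and the path never goes below `0`. Summing
  -- over its `T` times gives the power `1 + r ≤ p`; as `c` and `T` are at least `1`, a single bound
  -- serves all `r`.
  have h1 : ∀ m ∈ range T, (⨅ n : ℕ, ((((q.2 (m + n) - q.2 m) ⬝ᵥ u : ℤ) : ℝ) : EReal)).abs ^ r
      ≤ ((c * T : ℕ) : ℝ≥0∞) ^ r := by
    intro m hm
    refine ENNReal.rpow_le_rpow (abs_iInf_le (by simp) fun n => ?_) hr0
    have h2 := hq.abs_sub_le 0 m
    have h3 := hg.2 (m + n)
    have h4 : c * m ≤ c * T := Nat.mul_le_mul_left c (mem_range.1 hm).le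
    rw [zero_add, hg.1.1, zero_dotProduct, sub_zero, abs_le] at h2
    rw [sub_dotProduct]
    have h5 : ((c * m : ℕ) : ℤ) ≤ (c * T : ℕ) := by exact_mod_cast h4
    push_cast at h5 ⊢
    linarith [h2.2]
  refine (sum_le_card_nsmul _ _ _ h1).trans ?_
  rw [card_range, nsmul_eq_mul, Nat.cast_mul, ENNReal.mul_rpow_of_nonneg _ _ hr0, mul_left_comm]
  gcongr ?_ * ?_
  · exact ENNReal.rpow_le_rpow_of_exponent_le (by exact_mod_cast (by omega : 1 ≤ c)) (by linarith)
  · calc (T : ℝ≥0∞) * (T : ℝ≥0∞) ^ r = (T : ℝ≥0∞) ^ (1 + r) := by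
          rw [ENNReal.rpow_add _ _ hT0 (ENNReal.natCast_ne_top T), ENNReal.rpow_one]
      _ ≤ (T : ℝ≥0∞) ^ p :=
          ENNReal.rpow_le_rpow_of_exponent_le (by exact_mod_cast hT) (by linarith)

/-- Slow progress is unlikely under the invariant law. -/
theorem IsLimitLaw.averagedLaw_slow_le {Q : Measure (Env d)} [IsProbabilityMeasure Q]
    (hQ : IsLimitLaw (iid ν) u Q) {p : ℝ} (hp : 1 ≤ p) {n s : ℕ} (hs : 1 ≤ s) (hsn : s * s ≤ n) :
    averagedLaw Q 0 {X | X n ⬝ᵥ u ≤ s}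
      ≤ (meanLen ν u)⁻¹ * (((s : ℝ≥0∞) / 2) ^ (1 - p) * (1 + 2 * meanLen ν u) *
        ∫⁻ q, (nxt u 1 q.2 : ℝ≥0∞) ^ p ∂(regenLaw ν u)) := by
  classical
  set mp := ∫⁻ q, (nxt u 1 q.2 : ℝ≥0∞) ^ p ∂(regenLaw ν u) with hmp
  have hs0 : (s : ℝ≥0∞) ≠ 0 := by exact_mod_cast (by omega : s ≠ 0)
  have hb0 : (s : ℝ≥0∞) / 2 ≠ 0 := ENNReal.div_ne_zero.2 ⟨hs0, by simp⟩
  have hbt : (s : ℝ≥0∞) / 2 ≠ ∞ := ENNReal.div_ne_top (ENNReal.natCast_ne_top s) (by simp)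
  have hT : Measurable fun q : Env d × (ℕ → Site d) => nxt u 1 q.2 :=
    (measurable_nxt u 1).comp measurable_snd
  have hpm : Measurable fun q : Env d × (ℕ → Site d) => (nxt u 1 q.2 : ℝ≥0∞) ^ p :=
    (measurable_of_countable fun T : ℕ => (T : ℝ≥0∞) ^ p).comp hT
  have hSm : MeasurableSet {X : ℕ → Site d | X n ⬝ᵥ u ≤ s} :=
    measurableSet_le (measurable_level u n) measurable_const
  set L : Set (ℕ → Site d) := {X | s ≤ 2 * nxt u 1 X} with hL
  have hLm : MeasurableSet L :=
    measurable_nxt u 1 (Set.to_countable {T : ℕ | s ≤ 2 * T}).measurableSet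
  have hLl : ∀ l, MeasurableSet {q : Env d × (ℕ → Site d) | (regenPath u)^[l] q.2 ∈ L} :=
    fun l => (((measurable_regenPath u).iterate l).comp measurable_snd) hLm
  have hL0 : MeasurableSet {q : Env d × (ℕ → Site d) | q.2 ∈ L} := hLl 0
  have hLb : ∀ X ∈ L, (s : ℝ≥0∞) / 2 ≤ nxt u 1 X := fun X hX =>
    ENNReal.div_le_of_le_mul (by rw [mul_comm]; exact_mod_cast (hX : s ≤ 2 * nxt u 1 X))
  have hfirst : ∫⁻ q in {q | q.2 ∈ L}, (nxt u 1 q.2 : ℝ≥0∞) ∂(regenLaw ν u)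
      ≤ ((s : ℝ≥0∞) / 2) ^ (1 - p) * mp := by
    rw [hmp, ← lintegral_const_mul _ hpm]
    refine (setLIntegral_mono' (hLl 0) fun q hq => ?_).trans (setLIntegral_le_lintegral _ _)
    have := rpow_le_rpow_mul (hLb _ hq) hb0 (ENNReal.natCast_ne_top _) hp
    rwa [ENNReal.rpow_one] at this
  have htail : regenLaw ν u {q | q.2 ∈ L} ≤ ((s : ℝ≥0∞) / 2) ^ (-p) * mp := by
    rw [hmp, ← lintegral_const_mul _ hpm, ← lintegral_indicator_one hL0]
    refine lintegral_mono fun q => ?_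
    by_cases hq : q.2 ∈ L
    · rw [Set.indicator_of_mem (by exact hq)]
      have := rpow_le_rpow_mul (hLb _ hq) hb0 (ENNReal.natCast_ne_top _)
        (zero_le_one.trans hp)
      rwa [ENNReal.rpow_zero, zero_sub] at this
    · rw [Set.indicator_of_notMem (by exact hq)]
      exact zero_le
  -- A long later block is independent of the size bias and has the tail power `-p`. There are `s`
  -- of these, which restores the power `1 - p` of the size-biased first block.
  have hblock : ∀ l, ∫⁻ q in {q | (regenPath u)^[l + 1] q.2 ∈ L}, (nxt u 1 q.2 : ℝ≥0∞)
      ∂(regenLaw ν u) ≤ meanLen ν u * (((s : ℝ≥0∞) / 2) ^ (-p) * mp) := by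
    intro l
    have hG : MeasurableSet ((regenPath u)^[l] ⁻¹' L) := ((measurable_regenPath u).iterate l) hLm
    refine (lintegral_nxt_indicator hreg hG).le.trans ?_
    gcongr
    refine le_trans (le_of_eq ?_) htail
    have := lintegral_path_iterate hreg (g := L.indicator 1) (measurable_one.indicator hLm) l
    have hl : MeasurableSet {q : Env d × (ℕ → Site d) | q.2 ∈ (regenPath u)^[l] ⁻¹' L} := hLl l
    rw [← lintegral_indicator_one hL0, ← lintegral_indicator_one hl]
    exact this
  have hsum : ∫⁻ q, ∑ m ∈ range (nxt u 1 q.2),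
      {X : ℕ → Site d | X n ⬝ᵥ u ≤ s}.indicator 1 (fun i => q.2 (m + i) - q.2 m) ∂(regenLaw ν u)
      ≤ ∫⁻ q, ∑ l ∈ range (s + 1), {q : Env d × (ℕ → Site d) | (regenPath u)^[l] q.2 ∈ L}.indicator
        (fun q => (nxt u 1 q.2 : ℝ≥0∞)) q ∂(regenLaw ν u) := by
    refine lintegral_mono_ae ?_
    filter_upwards [ae_regenLaw_good hreg] with q hg
    by_cases h : ∃ l < s + 1, (regenPath u)^[l] q.2 ∈ L
    · obtain ⟨l, hl, hlL⟩ := h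
      refine le_trans ?_ (single_le_sum (fun _ _ => zero_le) (mem_range.2 hl))
      rw [Set.indicator_of_mem (by exact hlL)]
      refine (sum_le_card_nsmul _ _ 1 fun m _ => ?_).trans (by simp)
      exact Set.indicator_le_self' (fun _ _ => zero_le) _
    · refine le_of_eq_of_le (sum_eq_zero fun m hm => ?_) zero_le
      refine Set.indicator_of_notMem (fun hX => h ?_) _
      have hX' : (q.2 (m + n) - q.2 m) ⬝ᵥ u ≤ s := hX
      rw [sub_dotProduct] at hX'
      obtain ⟨l, hl, hl'⟩ := hg.1.exists_long_block (mem_range.1 hm) hX'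
      refine ⟨l, hl, ?_⟩
      -- From `s * s ≤ n < (s + 1) * T` and `s + 1 ≤ 2 * s`.
      change s ≤ 2 * nxt u 1 ((regenPath u)^[l] q.2)
      nlinarith
  have hTm : Measurable fun q : Env d × (ℕ → Site d) => (nxt u 1 q.2 : ℝ≥0∞) :=
    (measurable_of_countable fun T : ℕ => (T : ℝ≥0∞)).comp hT
  have hcalc : ∫⁻ q, ∑ l ∈ range (s + 1),
      {q : Env d × (ℕ → Site d) | (regenPath u)^[l] q.2 ∈ L}.indicator
        (fun q => (nxt u 1 q.2 : ℝ≥0∞)) q ∂(regenLaw ν u)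
      ≤ ((s : ℝ≥0∞) / 2) ^ (1 - p) * (1 + 2 * meanLen ν u) * mp := by
    rw [lintegral_finsetSum _ fun l _ => hTm.indicator (hLl l), sum_range_succ']
    simp_rw [fun l => lintegral_indicator (μ := regenLaw ν u) (hLl l)
      (fun q => (nxt u 1 q.2 : ℝ≥0∞))]
    have hpow : (s : ℝ≥0∞) * ((s : ℝ≥0∞) / 2) ^ (-p) = 2 * ((s : ℝ≥0∞) / 2) ^ (1 - p) := by
      rw [sub_eq_add_neg, ENNReal.rpow_add _ _ hb0 hbt, ENNReal.rpow_one, ← mul_assoc,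
        ENNReal.mul_div_cancel (by simp) (by simp)]
    calc _ ≤ ∑ l ∈ range s, meanLen ν u * (((s : ℝ≥0∞) / 2) ^ (-p) * mp)
          + ((s : ℝ≥0∞) / 2) ^ (1 - p) * mp := add_le_add (sum_le_sum fun l _ => hblock l) hfirst
      _ = meanLen ν u * (((s : ℝ≥0∞) * ((s : ℝ≥0∞) / 2) ^ (-p)) * mp)
          + ((s : ℝ≥0∞) / 2) ^ (1 - p) * mp := by
            rw [sum_const, card_range, nsmul_eq_mul]
            ring
      _ = _ := by
            rw [hpow]
            ring
  rw [← lintegral_indicator_one hSm, hQ.lintegral_averagedLaw hreg hlen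
    (measurable_one.indicator hSm)]
  exact mul_le_mul_right (hsum.trans hcalc) _

end System

/-! ### Consequences of the moment hypothesis and final estimates -/

theorem regenFrom_one_of_isRegeneration {u : Site d} {X : ℕ → Site d} (h0 : X 0 = 0) {n : ℕ}
    (h : IsRegeneration u X n) : RegenFrom u 1 X n := by
  have h1 := h.2.1 0 h.1
  rw [h0, zero_dotProduct] at h1
  refine ⟨h.1, ?_, h⟩
  push_cast
  omega

theorem nxt_le_regenTime {u : Site d} {X : ℕ → Site d} (h0 : X 0 = 0) :
    (nxt u 1 X : ℝ≥0∞) ≤ regenTime u X :=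
  le_iInf₂ fun _ hn => Nat.cast_le.2 (nxt_le (regenFrom_one_of_isRegeneration h0 hn))

theorem regenTime_eq_top {u : Site d} {X : ℕ → Site d} (h : X ∉ hasRegen u 1) (h0 : X 0 = 0) :
    regenTime u X = ∞ :=
  iInf₂_eq_top.2 fun n hn => absurd ⟨n, regenFrom_one_of_isRegeneration h0 hn⟩ h

theorem ae_start (μ : Measure (Env d)) [IsProbabilityMeasure μ] :
    ∀ᵐ X ∂(averagedLaw μ 0), X 0 = 0 := by
  have hm : MeasurableSet {X : ℕ → Site d | X 0 = 0} :=
    (measurable_pi_apply 0) (measurableSet_singleton 0)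
  rw [averagedLaw, Measure.snd, ae_map_iff measurable_snd.aemeasurable hm]
  exact jointLaw_start μ 0

section Moments

variable {μ : Measure (Env d)} [IsProbabilityMeasure μ] {u : Site d} {p : ℝ} (hp : 0 < p)
  (hmom : ∫⁻ X, regenTime u X ^ p ∂(averagedLaw μ 0) < ∞)
include hp hmom

/-- A path from the origin without regeneration has `regenTime` equal to `∞`, so a finite moment
leaves no mass on such paths. -/
theorem ae_hasRegen_of_moment : ∀ᵐ q ∂(jointLaw μ 0), q.2 ∈ hasRegen u 1 := by
  have hS : MeasurableSet (hasRegen u 1)ᶜ := (measurableSet_hasRegen u 1).compl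
  have h1 : ∫⁻ X, (hasRegen u 1)ᶜ.indicator (fun _ => ∞) X ∂(averagedLaw μ 0) < ∞ := by
    refine (lintegral_mono_ae ?_).trans_lt hmom
    filter_upwards [ae_start μ] with X hX
    by_cases h : X ∈ hasRegen u 1
    · rw [Set.indicator_of_notMem (Set.notMem_compl_iff.2 h)]
      exact zero_le
    · rw [regenTime_eq_top h hX, ENNReal.top_rpow_of_pos hp]
      exact le_top
  rw [lintegral_indicator_const hS] at h1
  have h2 : averagedLaw μ 0 (hasRegen u 1)ᶜ = 0 := by
    by_contra h
    rw [ENNReal.top_mul h] at h1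
    exact lt_irrefl _ h1
  exact ae_of_ae_map measurable_snd.aemeasurable
    ((measure_eq_zero_iff_ae_notMem.1 h2).mono fun X hX => not_not.1 hX)

theorem lintegral_nxt_rpow_ne_top :
    ∫⁻ q, (nxt u 1 q.2 : ℝ≥0∞) ^ p ∂(jointLaw μ 0) ≠ ∞ := by
  have hpm : Measurable fun X : ℕ → Site d => (nxt u 1 X : ℝ≥0∞) ^ p :=
    (measurable_of_countable fun T : ℕ => (T : ℝ≥0∞) ^ p).comp (measurable_nxt u 1)
  rw [← lintegral_map (μ := jointLaw μ 0) hpm measurable_snd]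
  refine ((lintegral_mono_ae ?_).trans_lt hmom).ne
  filter_upwards [ae_start μ] with X hX
  exact ENNReal.rpow_le_rpow (nxt_le_regenTime hX) hp.le

end Moments

theorem lintegral_regenLaw_nxt_rpow_ne_top {ν : Measure (PMF (Site d))} [IsProbabilityMeasure ν]
    {u : Site d} (hreg : ∀ᵐ q ∂(jointLaw (iid ν) 0), q.2 ∈ hasRegen u 1) {p : ℝ}
    (hmom : ∫⁻ q, (nxt u 1 q.2 : ℝ≥0∞) ^ p ∂(jointLaw (iid ν) 0) ≠ ∞) :
    ∫⁻ q, (nxt u 1 q.2 : ℝ≥0∞) ^ p ∂(regenLaw ν u) ≠ ∞ := by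
  have hpm : Measurable fun X : ℕ → Site d => (nxt u 1 X : ℝ≥0∞) ^ p :=
    (measurable_of_countable fun T : ℕ => (T : ℝ≥0∞) ^ p).comp (measurable_nxt u 1)
  exact ne_top_of_le_ne_top (ENNReal.mul_ne_top (ENNReal.inv_ne_top.2 (stayProb_ne_zero hreg)) hmom)
    (lintegral_regenLaw_snd_le hreg hpm)

theorem meanLen_ne_top {ν : Measure (PMF (Site d))} {u : Site d} {p : ℝ} (hp : 1 ≤ p)
    (hmom : ∫⁻ q, (nxt u 1 q.2 : ℝ≥0∞) ^ p ∂(regenLaw ν u) ≠ ∞) : meanLen ν u ≠ ∞ := by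
  refine ne_top_of_le_ne_top hmom (lintegral_mono fun q => ?_)
  rcases Nat.eq_zero_or_pos (nxt u 1 q.2) with h | h
  · rw [h, Nat.cast_zero]
    exact zero_le
  · conv_lhs => rw [← ENNReal.rpow_one (nxt u 1 q.2 : ℝ≥0∞)]
    exact ENNReal.rpow_le_rpow_of_exponent_le (by exact_mod_cast h) hp

theorem ae_iid_step {ν : Measure (PMF (Site d))} [IsProbabilityMeasure ν] {z : Site d}
    (h : ∀ᵐ ω ∂(iid ν), ω 0 z = 0) (x : Site d) : ∀ᵐ ω ∂(iid ν), ω x z = 0 := by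
  have hinv : (iid ν).map (shift x) = iid ν := infinitePi_map_shift ν x
  rw [← hinv] at h
  filter_upwards [ae_of_ae_map (measurable_shift x).aemeasurable h] with ω hω
  simpa [shift] using hω

theorem IsLimitLaw.ae_step {ν : Measure (PMF (Site d))} [IsProbabilityMeasure ν] {u : Site d}
    {Q : Measure (Env d)} [IsProbabilityMeasure Q] (hQ : IsLimitLaw (iid ν) u Q) {x z : Site d}
    (h : ∀ᵐ ω ∂(iid ν), ω x z = 0) : ∀ᵐ ω ∂Q, ω x z = 0 := by
  have hA : MeasurableSet {ω : Env d | ¬ ω x z = 0} :=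
    (measurable_jump x z (measurableSet_singleton 0)).compl
  refine hQ.measure_eq_zero (k := (x ⬝ᵥ u).natAbs) hA (fun ω => ?_) h
  have : keep (above u (-((x ⬝ᵥ u).natAbs : ℤ))) ω x = ω x :=
    keep_of_mem (by rw [mem_above]; omega) ω
  change (¬ keep _ ω x z = 0) = ¬ ω x z = 0
  rw [this]

theorem measureReal_sub_le_varDistOn {Ω : Type*} {m m₀ : MeasurableSpace Ω} (μ ν : Measure Ω)
    [IsProbabilityMeasure μ] {A : Set Ω} (hA : MeasurableSet[m] A) :
    μ.real A - ν.real A ≤ varDistOn μ ν m := by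
  refine le_ciSup (f := fun A : {A : Set Ω // MeasurableSet[m] A} => μ.real A.1 - ν.real A.1)
    ⟨1, ?_⟩ ⟨A, hA⟩
  rintro _ ⟨B, rfl⟩
  have h1 : μ.real B.1 ≤ 1 := measureReal_le_one
  have h2 : 0 ≤ ν.real B.1 := measureReal_nonneg
  simp only
  linarith

theorem varDistOn_le {Ω : Type*} {m m₀ : MeasurableSpace Ω} {μ ν : Measure Ω}
    {b : ℝ} (h : ∀ A, MeasurableSet[m] A → μ.real A - ν.real A ≤ b) : varDistOn μ ν m ≤ b := by
  have : Nonempty {A : Set Ω // MeasurableSet[m] A} := ⟨⟨∅, @MeasurableSet.empty _ m⟩⟩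
  exact ciSup_le fun A => h A.1 A.2

theorem levelSigma_natCast (u : Site d) (ℓ : ℕ) :
    levelSigma u (ℓ : ℝ) = siteSigma (above u ℓ) := by
  rw [← levelSigma_intCast, Int.cast_natCast]

theorem exists_levelSigma_le (u : Site d) (a : ℝ) :
    ∃ k : ℕ, levelSigma u (-a) ≤ siteSigma (above u (-(k : ℤ))) := by
  refine ⟨⌈a⌉₊, ?_⟩
  rw [← levelSigma_intCast]
  refine levelSigma_anti u ?_
  push_cast
  linarith [Nat.le_ceil a]

/-- A law with fast enough escape is transient. -/
theorem ae_tendsto_of_slow_le {m : Measure (ℕ → Site d)} [IsFiniteMeasure m] {u : Site d}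
    {C r : ℝ} (hr : 1 < r)
    (h : ∀ n : ℕ, 1 ≤ n → m.real {x | ((x n ⬝ᵥ u : ℤ) : ℝ) ≤ Real.sqrt n} ≤ C * (n : ℝ) ^ (-r)) :
    ∀ᵐ X ∂m, Tendsto (fun n => X n ⬝ᵥ u) atTop atTop := by
  have hsum : Summable fun n : ℕ => m.real {x | ((x n ⬝ᵥ u : ℤ) : ℝ) ≤ Real.sqrt n} := by
    refine ((Real.summable_nat_rpow.2 (by linarith : -r < -1)).mul_left C).of_norm_bounded_eventually_nat
      ?_
    filter_upwards [eventually_ge_atTop 1] with n hn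
    rw [Real.norm_of_nonneg measureReal_nonneg]
    exact h n hn
  have hne : ∑' n : ℕ, m {x | ((x n ⬝ᵥ u : ℤ) : ℝ) ≤ Real.sqrt n} ≠ ∞ := by
    have := hsum.tsum_ofReal_ne_top
    rwa [tsum_congr fun n => ofReal_measureReal] at this
  filter_upwards [ae_eventually_notMem hne] with X hX
  rw [← tendsto_intCast_atTop_iff (R := ℝ)]
  refine tendsto_atTop_mono' _ ?_ (Real.tendsto_sqrt_atTop.comp tendsto_natCast_atTop_atTop)
  filter_upwards [hX] with n hn
  exact (not_le.1 hn).le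

/-- The bound `3 < p` makes the exponent `(p - 1) / 2` exceed `1`, so Borel–Cantelli turns the
slow-progress bound into transience; the variation bound makes null events of the i.i.d. law far
ahead have small `Q'`-probability. -/
theorem isLimitLaw_of_close {ν : Measure (PMF (Site d))} [IsProbabilityMeasure ν] {u : Site d}
    {Q Q' : Measure (Env d)} [IsProbabilityMeasure Q'] (hQ : IsLimitLaw (iid ν) u Q) {p : ℝ}
    (hp : 3 < p)
    (hvar : ∃ C : ℝ, ∀ ℓ : ℕ, 1 ≤ ℓ →
      varDistOn Q' (iid ν) (levelSigma u ℓ) ≤ C * (ℓ : ℝ) ^ (1 - p))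
    (hslow : ∃ C : ℝ, ∀ r : ℝ, 1 ≤ r → r ≤ (p - 1) / 2 → ∀ n : ℕ, 1 ≤ n →
      (averagedLaw Q' 0).real {x | ((x n ⬝ᵥ u : ℤ) : ℝ) ≤ Real.sqrt n} ≤ C * (n : ℝ) ^ (-r)) :
    IsLimitLaw Q' u Q := by
  have : IsProbabilityMeasure (averagedLaw Q' 0) := by unfold averagedLaw; infer_instance
  obtain ⟨C, hC⟩ := hslow
  have htr : ∀ᵐ q ∂(jointLaw Q' 0), Tendsto (fun n => q.2 n ⬝ᵥ u) atTop atTop :=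
    ae_of_ae_map measurable_snd.aemeasurable
      (ae_tendsto_of_slow_le (m := averagedLaw Q' 0) (by linarith : 1 < (p - 1) / 2)
        (hC _ (by linarith) le_rfl))
  obtain ⟨C', hC'⟩ := hvar
  intro k Ψ hΨ hk hb
  refine ae_tendsto_average_of_close (μ := iid ν) (fun z => infinitePi_map_shift ν z) htr ?_ hΨ hk
    (hQ k Ψ hΨ hk hb)
  intro ε hε
  have hlim : Tendsto (fun ℓ : ℕ => ENNReal.ofReal (C' * (ℓ : ℝ) ^ (1 - p))) atTop (𝓝 0) := by
    have h1 := (tendsto_rpow_neg_atTop (y := p - 1) (by linarith)).comp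
      (tendsto_natCast_atTop_atTop (R := ℝ))
    have h2 := ENNReal.tendsto_ofReal (h1.const_mul C')
    rw [mul_zero, ENNReal.ofReal_zero] at h2
    simpa only [neg_sub, Function.comp_def] using h2
  obtain ⟨L, hL, hL1⟩ := ((hlim.eventually_le_const hε).and (eventually_ge_atTop 1)).exists
  refine ⟨L, fun A hA h0 => le_trans ?_ hL⟩
  rw [← levelSigma_natCast] at hA
  have h1 := (measureReal_sub_le_varDistOn Q' (iid ν) hA).trans (hC' L hL1)
  rw [measureReal_def (iid ν), h0, ENNReal.toReal_zero, sub_zero] at h1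
  rw [← ofReal_measureReal]
  exact ENNReal.ofReal_le_ofReal h1

theorem level_le_sqrt_iff {u : Site d} {X : ℕ → Site d} {n : ℕ} :
    ((X n ⬝ᵥ u : ℤ) : ℝ) ≤ Real.sqrt n ↔ X n ⬝ᵥ u ≤ Nat.sqrt n := by
  rw [← Int.le_floor, ← Real.nat_floor_real_sqrt_eq_nat_sqrt, Int.natCast_floor_eq_floor]
  exact Real.sqrt_nonneg _

theorem IsLimitLaw.exists_slow_le {ν : Measure (PMF (Site d))} [IsProbabilityMeasure ν] {u : Site d}
    (hreg : ∀ᵐ q ∂(jointLaw (iid ν) 0), q.2 ∈ hasRegen u 1) (hlen : meanLen ν u ≠ ∞)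
    {Q : Measure (Env d)} [IsProbabilityMeasure Q] (hQ : IsLimitLaw (iid ν) u Q) {p : ℝ}
    (hp : 1 ≤ p) (hmom : ∫⁻ q, (nxt u 1 q.2 : ℝ≥0∞) ^ p ∂(regenLaw ν u) ≠ ∞) :
    ∃ C : ℝ, ∀ r : ℝ, 1 ≤ r → r ≤ (p - 1) / 2 → ∀ n : ℕ, 1 ≤ n →
      (averagedLaw Q 0).real {x | ((x n ⬝ᵥ u : ℤ) : ℝ) ≤ Real.sqrt n} ≤ C * (n : ℝ) ^ (-r) := by
  set mp := ∫⁻ q, (nxt u 1 q.2 : ℝ≥0∞) ^ p ∂(regenLaw ν u)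
  set K := (meanLen ν u)⁻¹ * ((1 + 2 * meanLen ν u) * mp) with hK
  refine ⟨K.toReal * 4 ^ (p - 1), fun r _ hr n hn => ?_⟩
  have hn0 : (0 : ℝ) < n := by exact_mod_cast hn
  have hs : 1 ≤ Nat.sqrt n := Nat.le_sqrt.2 (by simpa using hn)
  have hs0 : (0 : ℝ) < (Nat.sqrt n : ℝ) := by exact_mod_cast hs
  have h1 := hQ.averagedLaw_slow_le hreg hlen hp hs (Nat.sqrt_le n)
  have hset : {x : ℕ → Site d | ((x n ⬝ᵥ u : ℤ) : ℝ) ≤ Real.sqrt n}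
      = {X | X n ⬝ᵥ u ≤ Nat.sqrt n} := by
    ext X
    exact level_le_sqrt_iff
  have h2 : (averagedLaw Q 0).real {x | ((x n ⬝ᵥ u : ℤ) : ℝ) ≤ Real.sqrt n}
      ≤ ((Nat.sqrt n : ℝ) / 2) ^ (1 - p) * K.toReal := by
    have e : (meanLen ν u)⁻¹ * ((((Nat.sqrt n : ℕ) : ℝ≥0∞) / 2) ^ (1 - p) *
        (1 + 2 * meanLen ν u) * mp) = (((Nat.sqrt n : ℕ) : ℝ≥0∞) / 2) ^ (1 - p) * K := by
      rw [hK]; ring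
    have hKtop : K ≠ ∞ := ENNReal.mul_ne_top
      (ENNReal.inv_ne_top.2 (zero_lt_one.trans_le (one_le_meanLen hreg)).ne')
      (ENNReal.mul_ne_top (ENNReal.add_ne_top.2
        ⟨ENNReal.one_ne_top, ENNReal.mul_ne_top (by simp) hlen⟩) hmom)
    have hb : (((Nat.sqrt n : ℕ) : ℝ≥0∞) / 2) ^ (1 - p) ≠ ∞ := by
      refine ENNReal.rpow_ne_top_of_ne_zero (ENNReal.div_ne_zero.2 ⟨?_, by simp⟩)
        (ENNReal.div_ne_top (ENNReal.natCast_ne_top _) (by simp))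
      exact_mod_cast (by omega : Nat.sqrt n ≠ 0)
    rw [e] at h1
    rw [hset, measureReal_def]
    refine (ENNReal.toReal_mono (ENNReal.mul_ne_top hb hKtop) h1).trans (le_of_eq ?_)
    rw [ENNReal.toReal_mul, ← ENNReal.toReal_rpow, ENNReal.toReal_div, ENNReal.toReal_natCast]
    rfl
  refine h2.trans ?_
  -- Since `n ≥ 1`, rounding the root down loses at most a factor `2`; this is the source of `4 ^ (p
  -- - 1)`. The decay obtained is at the endpoint exponent `(p - 1) / 2`, which dominates every
  -- smaller `r`.
  have h3 : Real.sqrt n / 4 ≤ (Nat.sqrt n : ℝ) / 2 := by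
    have : Real.sqrt n ≤ Nat.sqrt n + 1 := Real.real_sqrt_le_nat_sqrt_succ
    have h1' : (1 : ℝ) ≤ Nat.sqrt n := by exact_mod_cast hs
    linarith
  have h4 : ((Nat.sqrt n : ℝ) / 2) ^ (1 - p) ≤ 4 ^ (p - 1) * (n : ℝ) ^ (-r) := by
    refine (Real.rpow_le_rpow_of_nonpos (by positivity) h3 (by linarith)).trans ?_
    rw [Real.div_rpow (Real.sqrt_nonneg _) (by norm_num), div_eq_mul_inv, ← Real.rpow_neg (by norm_num),
      neg_sub, mul_comm, Real.sqrt_eq_rpow, ← Real.rpow_mul hn0.le]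
    gcongr
    · exact_mod_cast hn
    · linarith
  calc ((Nat.sqrt n : ℝ) / 2) ^ (1 - p) * K.toReal
      ≤ (4 ^ (p - 1) * (n : ℝ) ^ (-r)) * K.toReal := by gcongr
    _ = K.toReal * 4 ^ (p - 1) * (n : ℝ) ^ (-r) := by ring

end RWRE

/-! ### The main theorem -/

theorem theorem4p2 {d : ℕ} (u : RWRE.Site d)
    -- the common law of the i.i.d. probability vectors `ω_x`, and the environment law
    (ν : Measure (PMF (RWRE.Site d))) [IsProbabilityMeasure ν]
    (P : Measure (RWRE.Env d)) (hP : P = Measure.infinitePi fun _ : RWRE.Site d => ν)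
    -- transience in direction `u`
    (htrans : ∀ᵐ x ∂(RWRE.averagedLaw P 0), Tendsto (fun n : ℕ => x n ⬝ᵥ u) atTop atTop)
    -- bounded steps
    (M : ℝ) (hM : 0 < M)
    (hstep : ∀ z : RWRE.Site d, M < RWRE.euclNorm z → ∀ᵐ ω ∂P, ω 0 z = 0)
    -- moments of the first regeneration time
    (p : ℝ) (hp : 4 * (d : ℝ) + 1 < p)
    (hmom : ∫⁻ x, RWRE.regenTime u x ^ p ∂(RWRE.averagedLaw P 0) < ∞) :
    ∃ Q : Measure (RWRE.Env d),
      -- `Q` is the invariant environment measure, and it is unique as such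
      RWRE.IsInvariantEnvLaw u M p P Q ∧
      (∀ Q' : Measure (RWRE.Env d), RWRE.IsInvariantEnvLaw u M p P Q' → Q' = Q) ∧
      -- the ergodic theorem under the original averaged measure
      (∀ a : ℝ, 0 < a → ∀ Ψ : RWRE.Env d → ℝ,
        Measurable[RWRE.levelSigma u (-a)] Ψ → (∃ B : ℝ, ∀ ω, |Ψ ω| ≤ B) →
        ∀ᵐ q ∂(RWRE.jointLaw P 0),
          Tendsto
            (fun n : ℕ => (n : ℝ)⁻¹ * ∑ j ∈ range n, Ψ (RWRE.shift (q.2 j) q.1))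
            atTop (𝓝 (∫ ω, Ψ ω ∂Q))) ∧
      -- absolute continuity on half-spaces
      (∀ a : ℝ, 0 < a →
        (Q.trim (RWRE.levelSigma_le u (-a))).AbsolutelyContinuous
          (P.trim (RWRE.levelSigma_le u (-a)))) := by
  change P = RWRE.iid ν at hP
  subst hP
  have hprob : IsProbabilityMeasure (RWRE.averagedLaw (RWRE.iid ν) 0) := by
    unfold RWRE.averagedLaw; infer_instance
  -- In dimension `0` every level is `0`, contradicting transience. Hence `p > 5`, which covers all
  -- the lower bounds on `p` needed below.
  have hd : 1 ≤ d := by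
    by_contra hd
    obtain rfl : d = 0 := by omega
    obtain ⟨X, hX⟩ := htrans.exists
    obtain ⟨n, hn⟩ := (hX.eventually_ge_atTop 1).exists
    simp [dotProduct] at hn
  have hd' : (1 : ℝ) ≤ d := by exact_mod_cast hd
  have hreg := RWRE.ae_hasRegen_of_moment (by linarith) hmom
  have hmomJ := RWRE.lintegral_nxt_rpow_ne_top (by linarith) hmom
  have hmomR := RWRE.lintegral_regenLaw_nxt_rpow_ne_top hreg hmomJ
  have hlen := RWRE.meanLen_ne_top (by linarith) hmomR
  have hsteps : ∀ x z : RWRE.Site d, M < RWRE.euclNorm z → ∀ᵐ ω ∂(RWRE.iid ν), ω x z = 0 :=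
    fun x z hz => RWRE.ae_iid_step (hstep z hz) x
  obtain ⟨c, hc0, hc⟩ : ∃ c : ℕ, c ≠ 0 ∧
      ∀ᵐ q ∂(RWRE.jointLaw (RWRE.iid ν) 0), RWRE.BddStep u c q.2 := by
    -- The extra `1` makes the step bound nonzero, as the block estimates divide by it.
    refine ⟨⌈M⌉₊ * ∑ i, (u i).natAbs + 1, by omega, ?_⟩
    filter_upwards [RWRE.ae_bddStep hsteps u] with q hq n
    exact (hq n).trans (by push_cast; linarith)
  obtain ⟨Q, hQp, hQ⟩ := RWRE.exists_limitLaw_tendsto hreg hlen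
  change RWRE.IsLimitLaw (RWRE.iid ν) u Q at hQ
  have hinv := hQ.invariant
  have hvar : ∃ C : ℝ, ∀ ℓ : ℕ, 1 ≤ ℓ →
      RWRE.varDistOn Q (RWRE.iid ν) (RWRE.levelSigma u ℓ) ≤ C * (ℓ : ℝ) ^ (1 - p) :=
    ⟨_, fun ℓ hℓ => RWRE.varDistOn_le fun A hA => by
      rw [RWRE.levelSigma_natCast] at hA
      exact hQ.measureReal_sub_le hreg hc0 hc (by linarith) hmomJ hℓ hA⟩
  have hslow := hQ.exists_slow_le hreg hlen (by linarith) hmomR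
  refine ⟨Q, ⟨hQp, fun x z hz => hQ.ae_step (hsteps x z hz), hinv,
    RWRE.ergodicFor_of_isLimitLaw hinv (RWRE.isLimitLaw_of_close hQ (by linarith) hvar hslow),
    hvar, ?_, hslow⟩, fun Q' hQ' => ?_, fun a _ Ψ hΨ hb => ?_, fun a _ => ?_⟩
  · refine ⟨((RWRE.meanLen ν u)⁻¹ * ((c : ℝ≥0∞) ^ p *
      ∫⁻ q, (RWRE.nxt u 1 q.2 : ℝ≥0∞) ^ p ∂(RWRE.regenLaw ν u))).toReal, fun r hr1 hr => ?_⟩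
    rw [ENNReal.ofReal_toReal]
    · exact hQ.lintegral_backtrack_le hreg hlen hc0 hc (by linarith) hr
    · exact ENNReal.mul_ne_top
        (ENNReal.inv_ne_top.2 (zero_lt_one.trans_le (RWRE.one_le_meanLen hreg)).ne')
        (ENNReal.mul_ne_top (ENNReal.rpow_ne_top_of_nonneg (by linarith) (by simp)) hmomR)
  · have := hQ'.isProbabilityMeasure
    exact RWRE.eq_of_invariant hQ'.invariant
      (RWRE.isLimitLaw_of_close hQ (by linarith) hQ'.varDist_le hQ'.slow_le)
  · obtain ⟨k, hk⟩ := RWRE.exists_levelSigma_le u a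
    exact hQ k Ψ (hΨ.mono (RWRE.levelSigma_le u (-a)) le_rfl)
      (fun ω => RWRE.keep_eq_of_measurable (hΨ.mono hk le_rfl) ω) hb
  · obtain ⟨k, hk⟩ := RWRE.exists_levelSigma_le u a
    refine Measure.AbsolutelyContinuous.mk fun A hA h0 => ?_
    rw [trim_measurableSet_eq _ hA] at h0 ⊢
    exact hQ.measure_eq_zero (k := k) (RWRE.levelSigma_le u (-a) A hA)
      (fun ω => propext (RWRE.keep_mem_iff (hk A hA) ω)) h0
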